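/- Let $k$ be a field of characteristic zero, $A$ a unital associative $k$-algebra and $d\ge 0$. *Hochschild operations.* Let $\bar{\mathfrak C}^{i}(A)=\operatorname{Hom}_k((A/k)^{\otimes (i+1)},A)$ be the shifted normalized Hochschild cochains; write $|x|=i$ for $x\in\bar{\mathfrak C}^i(A)$. They carry the Gerstenhaber bracket $[x,y]=x\{y\}-(-1)^{|x||y|}y\{x\}$, where $x\{y\}(b_1,\dots)=\sum_i(-1)^{|y|i}x(b_1,\dots,b_i,y(b_{i+1},\dots),\dots)$, and the differential $dx=[\mu_0,x]$ with $\mu_0(a,b)=-ab$. Let $\bar C_n(A)=A\otimes (A/k)^{\otimes n}$ be the normalized Hochschild chains, placed in cohomological degree $-n$, with Hochschild differential $\mathsf b$ and Connes differential $\mathsf B$. For $x\in\bar{\mathfrak C}^\bullet(A)$ with $p=|x|+1$ arguments and $a=a_0\otimes\cdots\otimes a_n$ put $$i_x(a)=a_0x(a_1,\dots,a_p)\otimes a_{p+1}\otimes\cdots\otimes a_n,$$ $$L_x(a)=\sum_{i=0}^{n-p}(-1)^{|x|i}a_0\otimes\cdots\otimes a_i\otimes x(a_{i+1},\dots,a_{i+p})\otimes\cdots\otimes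 a_n+\sum_{i=n+1-p}^{n}(-1)^{n(i+1)+|x|}x(a_{i+1},\dots,a_n,a_0,\dots)\otimes\cdots\otimes a_i,$$ $$S_x(a)=\sum_{j\ge 0,\ j+p\le l\le n}(-1)^{|x|(n+l+j)+n(l+1)}\,1\otimes a_{l+1}\otimes\cdots\otimes a_n\otimes a_0\otimes\cdots\otimes a_j\otimes x(a_{j+1},\dots,a_{j+p})\otimes a_{j+p+1}\otimes\cdots\otimes a_l$$ (with $i_x(a)=0$ if $p>n$ and $L_x(a)=0$ if $p>n+1$). Let $\overline{CC}^-_\bullet(A)=(\bar C_\bullet(A)[[u]],\mathsf b+u\mathsf B)$, $|u|=2$, be the normalized negative cyclic complex and $HC^-_m(A)$ its homology in homological degree $m$. The operations are extended $u$-linearly, and to shifts by $T(s^r b)=(-1)^{r|T|}s^rT(b)$ with $|s|=-1$, $|i_x|=|x|+1$, $|L_x|=|x|$, $|S_x|=|x|-1$, $|\mathsf b|=1$, $|\mathsf B|=-1$. *Calabi-Yau structure.* Assume that $A$ has a finite resolution by finitely generated projective $A^e$-modules, $A^e=A\otimes_kA^{\rm op}$, and let $\eta_0\in\overline{CC}^-_d(A)$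 be a cycle whose constant coefficient $\pi(\eta_0)\in\bar C_d(A)$ is non-degenerate, that is, the morphism $\operatorname{RHom}_{A^e}(A,A^e)\to\Sigma^{-d}A$ in $D(A^e)$ corresponding to the class of $\pi(\eta_0)$ under $HH_d(A)\cong\operatorname{Hom}_{D(A^e)}(\Sigma^d\operatorname{RHom}_{A^e}(A,A^e),A)$ is an isomorphism. (So $(A,\bar\eta_0)$ is a $d$-Calabi-Yau algebra.) *The DG-Lie algebra.* Let $\mathfrak D^\bullet(A,\eta_0)$ be the graded space $\bar{\mathfrak C}^\bullet(A)\oplus\Sigma^{-d-1}\overline{CC}^-_\bullet(A)$ with the semi-direct product bracket $[(x,\eta),(y,\zeta)]=([x,y],L_x\zeta-(-1)^{|y||\eta|}L_y\eta)$ and the differential $$(x,\eta)\mapsto (dx,(\mathsf b+u\mathsf B)\eta)+[(0,s^{-d-1}\eta_0),(x,\eta)].$$ **Theorem.** The graded spaces $\overline{CC}^-_\bullet(A)$ and $\mathfrak D^\bullet(A,\eta_0)$ with these differentials are complexes, and the map $$\Psi:\mathfrak D^\bullet(A,\eta_0)\to\Sigma^{-d+1}\overline{CC}^-_\bullet(A),\qquad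 (\mu,s^{-d-1}\eta)\mapsto(-1)^{|\mu|-1}(i_\mu+uS_\mu)(s^{-d+1}\eta_0)+u\,s^{-d+1}\eta$$ is a morphism of complexes and a quasi-isomorphism. Hence $\Psi$ induces isomorphisms $H^i(\mathfrak D^\bullet(A,\eta_0))\cong HC^-_{d-1-i}(A)$ for all $i\in\mathbb Z$. In particular the tangent space of the deformation functor of $\mathfrak D^\bullet(A,\eta_0)$, that is, the set of gauge equivalence classes of solutions of the Maurer-Cartan equation in $\mathfrak D^\bullet(A,\eta_0)\otimes_k k\varepsilon$, where $k\varepsilon$ is the maximal ideal of $k[\varepsilon]/(\varepsilon^2)$, is identified with $HC^-_{d-2}(A)$ by sending the class of $y\otimes\varepsilon$ to the class of $\Psi(y)$. -/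

import Mathlib

open scoped TensorProduct DualNumber
open CategoryTheory

noncomputable section

namespace CalabiYau

universe u v

lemma exists_place {N : ℕ} (r : ℕ) (l : Fin N) :
    ∃ s < N, (r + s) % N = l ∧ ∀ t < N, (r + t) % N = l → t = s := by
  have hN : 0 < N := l.pos
  have hl := l.isLt
  have hr : r % N < N := Nat.mod_lt _ hN
  have key : ∀ t < N, (r + t) % N = if r % N + t < N then r % N + t else r % N + t - N := by
    intro t ht
    rw [Nat.add_mod, Nat.mod_eq_of_lt ht]
    split_ifs with h
    · exact Nat.mod_eq_of_lt h
    · rw [Nat.mod_eq_sub_mod (by omega), Nat.mod_eq_of_lt (by omega)]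
  refine ⟨if r % N ≤ l then l - r % N else l + N - r % N, ?_, ?_, ?_⟩
  · split_ifs <;> omega
  · rw [key _ (by split_ifs <;> omega)]
    split_ifs <;> omega
  · intro t ht h
    rw [key t ht] at h
    split_ifs at h ⊢ <;> omega

section Multilinear

variable {k : Type u} [Field k] {A : Type v} [Ring A] [Algebra k A]
variable {E : Type*} [AddCommGroup E] [Module k E]

/-- The entries of a tuple `(a_0, …, a_{N-1})`, indexed cyclically by natural numbers. -/
def cyclic {N : ℕ} (a : Fin N → A) (t : ℕ) : A :=
  if h : t % N < N then a ⟨t % N, h⟩ else 0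

/-- Starting from `a_r, a_{r+1}, …, a_{r+N-1}` (indices modulo `N`), replace the `q` consecutive
entries in places `i, …, i + q - 1` by the single entry `x (a_{r+i}, …, a_{r+i+q-1})`. -/
def plugArgs {N q : ℕ} (M : ℕ) (x : MultilinearMap k (fun _ : Fin q => A) A) (r i : ℕ)
    (a : Fin N → A) : Fin M → A := fun j =>
  if (j : ℕ) < i then cyclic a (r + j)
  else if (j : ℕ) = i then x (fun t => cyclic a (r + i + t))
  else cyclic a (r + (j - 1) + q)

lemma cyclic_of_mod {N : ℕ} (a : Fin N → A) {t : ℕ} {l : Fin N} (h : t % N = l) :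
    cyclic a t = a l := by
  have : t % N < N := h ▸ l.isLt
  rw [cyclic, dif_pos this]
  congr 1
  exact Fin.ext h

lemma cyclic_update_of_mod {N : ℕ} [DecidableEq (Fin N)] (a : Fin N → A) {t : ℕ} {l : Fin N}
    (h : t % N = l) (v : A) : cyclic (Function.update a l v) t = v := by
  rw [cyclic_of_mod _ h, Function.update_self]

lemma cyclic_update_of_ne {N : ℕ} [DecidableEq (Fin N)] (a : Fin N → A) {t : ℕ} {l : Fin N}
    (h : t % N ≠ l) (v : A) : cyclic (Function.update a l v) t = cyclic a t := by
  unfold cyclic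
  split_ifs with h'
  · rw [Function.update_of_ne]
    intro h''
    exact h (congrArg Fin.val h'')
  · rfl

lemma plugArgs_update {N M q : ℕ} (x : MultilinearMap k (fun _ : Fin q => A) A) (r i : ℕ)
    (hN : N + 1 = M + q) (hi : i < M) [DecidableEq (Fin N)] (a : Fin N → A) (l : Fin N) :
    ∃ (j : Fin M) (g : A →ₗ[k] A), ∀ v,
      plugArgs M x r i (Function.update a l v) = Function.update (plugArgs M x r i a) j (g v) := by
  obtain ⟨s, hs, hsl, huniq⟩ := exists_place r l
  have hne : ∀ t < N, t ≠ s → (r + t) % N ≠ l := fun t ht h h' => h (huniq t ht h')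
  rcases lt_or_ge s i with h1 | h1
  · refine ⟨⟨s, by omega⟩, LinearMap.id, fun v => ?_⟩
    funext j
    by_cases hj : j = ⟨s, by omega⟩
    · subst hj
      simp only [plugArgs, h1, if_true, Function.update_self, LinearMap.id_apply]
      exact cyclic_update_of_mod a hsl v
    · have hj' : (j : ℕ) ≠ s := fun h => hj (Fin.ext h)
      have hjM := j.isLt
      rw [Function.update_of_ne hj]
      simp only [plugArgs]
      split_ifs with h2 h3
      · exact cyclic_update_of_ne a (hne _ (by omega) hj') v
      · congr 1
        funext t
        have ht := t.isLt
        rw [add_assoc]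
        exact cyclic_update_of_ne a (hne _ (by omega) (by omega)) v
      · rw [add_assoc]
        exact cyclic_update_of_ne a (hne _ (by omega) (by omega)) v
  · rcases lt_or_ge s (i + q) with h2 | h2
    · refine ⟨⟨i, hi⟩, x.toLinearMap (fun t => cyclic a (r + i + t)) ⟨s - i, by omega⟩,
        fun v => ?_⟩
      funext j
      by_cases hj : j = ⟨i, hi⟩
      · subst hj
        simp only [plugArgs, lt_irrefl, if_false, if_true, Function.update_self,
          MultilinearMap.toLinearMap_apply]
        congr 1
        funext t
        have ht := t.isLt
        by_cases hts : t = ⟨s - i, by omega⟩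
        · rw [hts, Function.update_self, add_assoc]
          exact cyclic_update_of_mod a (by simpa [Nat.add_sub_cancel' h1] using hsl) v
        · have hts' : (t : ℕ) ≠ s - i := fun h => hts (Fin.ext h)
          rw [Function.update_of_ne hts, add_assoc]
          exact cyclic_update_of_ne a (hne _ (by omega) (by omega)) v
      · have hj' : (j : ℕ) ≠ i := fun h => hj (Fin.ext h)
        have hjM := j.isLt
        rw [Function.update_of_ne hj]
        simp only [plugArgs, hj', if_false]
        split_ifs with h3
        · exact cyclic_update_of_ne a (hne _ (by omega) (by omega)) v
        · rw [add_assoc]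
          exact cyclic_update_of_ne a (hne _ (by omega) (by omega)) v
    · refine ⟨⟨s + 1 - q, by omega⟩, LinearMap.id, fun v => ?_⟩
      funext j
      by_cases hj : j = ⟨s + 1 - q, by omega⟩
      · subst hj
        have e1 : ¬ (s + 1 - q < i) := by omega
        have e2 : ¬ (s + 1 - q = i) := by omega
        simp only [plugArgs, e1, e2, if_false, Function.update_self, LinearMap.id_apply]
        refine cyclic_update_of_mod a ?_ v
        rw [← hsl]
        congr 1
        omega
      · have hj' : (j : ℕ) ≠ s + 1 - q := fun h => hj (Fin.ext h)
        have hjM := j.isLt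
        rw [Function.update_of_ne hj]
        simp only [plugArgs]
        split_ifs with h3 h4
        · exact cyclic_update_of_ne a (hne _ (by omega) (by omega)) v
        · congr 1
          funext t
          have ht := t.isLt
          rw [add_assoc]
          exact cyclic_update_of_ne a (hne _ (by omega) (by omega)) v
        · rw [add_assoc]
          exact cyclic_update_of_ne a (hne _ (by omega) (by omega)) v

/-- `plug N F x r i` is the multilinear map
`(a_0, …, a_{N-1}) ↦ F (a_r, …, a_{r+i-1}, x (a_{r+i}, …, a_{r+i+q-1}), a_{r+i+q}, …, a_{r-1})`
(indices modulo `N`). It makes sense when `N + 1 = M + q` and `i < M`, and is zero otherwise. -/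
def plug (N : ℕ) {M q : ℕ} (F : MultilinearMap k (fun _ : Fin M => A) E)
    (x : MultilinearMap k (fun _ : Fin q => A) A) (r i : ℕ) :
    MultilinearMap k (fun _ : Fin N => A) E :=
  if h : N + 1 = M + q ∧ i < M then
    { toFun := fun a => F (plugArgs M x r i a)
      map_update_add' := by
        intro _ a l v w
        obtain ⟨j, g, hg⟩ := plugArgs_update x r i h.1 h.2 a l
        simp only [hg, map_add, MultilinearMap.map_update_add]
      map_update_smul' := by
        intro _ a l c v
        obtain ⟨j, g, hg⟩ := plugArgs_update x r i h.1 h.2 a l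
        simp only [hg, map_smul, MultilinearMap.map_update_smul] }
  else 0

lemma plug_apply {N M q : ℕ} (F : MultilinearMap k (fun _ : Fin M => A) E)
    (x : MultilinearMap k (fun _ : Fin q => A) A) (r i : ℕ) (h : N + 1 = M + q) (hi : i < M)
    (a : Fin N → A) : plug N F x r i a = F (plugArgs M x r i a) := by
  simp [plug, h, hi]

lemma plug_eq_zero {N M q : ℕ} (F : MultilinearMap k (fun _ : Fin M => A) E)
    (x : MultilinearMap k (fun _ : Fin q => A) A) (r i : ℕ) (h : N + 1 ≠ M + q) :
    plug N F x r i = 0 := by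
  simp [plug, h]

lemma plugArgs_eq_update {N M q : ℕ} (x y : MultilinearMap k (fun _ : Fin q => A) A) (r i : ℕ)
    (hi : i < M) (a : Fin N → A) :
    plugArgs M x r i a =
      Function.update (plugArgs M y r i a) ⟨i, hi⟩ (x fun t => cyclic a (r + i + t)) := by
  funext j
  by_cases hj : j = ⟨i, hi⟩
  · subst hj; simp [plugArgs]
  · have hj' : (j : ℕ) ≠ i := fun h => hj (Fin.ext h)
    rw [Function.update_of_ne hj]
    simp [plugArgs, hj']

lemma plug_add {N M q : ℕ} (F : MultilinearMap k (fun _ : Fin M => A) E)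
    (x y : MultilinearMap k (fun _ : Fin q => A) A) (r i : ℕ) :
    plug N F (x + y) r i = plug N F x r i + plug N F y r i := by
  by_cases h : N + 1 = M + q ∧ i < M
  · ext a
    rw [_root_.add_apply, plug_apply _ _ _ _ h.1 h.2, plug_apply _ _ _ _ h.1 h.2,
      plug_apply _ _ _ _ h.1 h.2, plugArgs_eq_update (x + y) 0 r i h.2,
      plugArgs_eq_update x 0 r i h.2, plugArgs_eq_update y 0 r i h.2, _root_.add_apply,
      MultilinearMap.map_update_add]
  · simp [plug, h]

lemma plug_smul {N M q : ℕ} (F : MultilinearMap k (fun _ : Fin M => A) E) (c : k)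
    (x : MultilinearMap k (fun _ : Fin q => A) A) (r i : ℕ) :
    plug N F (c • x) r i = c • plug N F x r i := by
  by_cases h : N + 1 = M + q ∧ i < M
  · ext a
    rw [_root_.smul_apply, plug_apply _ _ _ _ h.1 h.2, plug_apply _ _ _ _ h.1 h.2,
      plugArgs_eq_update (c • x) 0 r i h.2, plugArgs_eq_update x 0 r i h.2,
      _root_.smul_apply, MultilinearMap.map_update_smul]
  · simp [plug, h]

lemma add_plug {N M q : ℕ} (F G : MultilinearMap k (fun _ : Fin M => A) E)
    (x : MultilinearMap k (fun _ : Fin q => A) A) (r i : ℕ) :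
    plug N (F + G) x r i = plug N F x r i + plug N G x r i := by
  by_cases h : N + 1 = M + q ∧ i < M
  · ext a; simp [plug, h]
  · simp [plug, h]

lemma smul_plug {N M q : ℕ} (c : k) (F : MultilinearMap k (fun _ : Fin M => A) E)
    (x : MultilinearMap k (fun _ : Fin q => A) A) (r i : ℕ) :
    plug N (c • F) x r i = c • plug N F x r i := by
  by_cases h : N + 1 = M + q ∧ i < M
  · ext a; simp [plug, h]
  · simp [plug, h]

/-- If one of the inputs is `1` and its place in the result is one in which `F` (or `x`)
vanishes on `1`, then so does the composite. -/
lemma plug_vanish {N M q : ℕ} (F : MultilinearMap k (fun _ : Fin M => A) E)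
    (x : MultilinearMap k (fun _ : Fin q => A) A) (r i : ℕ) (P Q : ℕ → Prop)
    (hF : ∀ (w : Fin M → A) (j : Fin M), w j = 1 → P j → F w = 0)
    (hx : ∀ (w : Fin q → A) (t : Fin q), w t = 1 → Q t → x w = 0)
    (a : Fin N → A) (l : Fin N) (hl : a l = 1)
    (h : ∀ s < N, (r + s) % N = l →
      (s < i → P s) ∧ (i ≤ s → s < i + q → Q (s - i)) ∧ (i + q ≤ s → P (s + 1 - q))) :
    plug N F x r i a = 0 := by
  by_cases hN : N + 1 = M + q ∧ i < M
  swap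
  · simp [plug, hN]
  obtain ⟨hN, hi⟩ := hN
  rw [plug_apply _ _ _ _ hN hi]
  obtain ⟨s, hs, hsl, -⟩ := exists_place r l
  obtain ⟨c1, c2, c3⟩ := h s hs hsl
  rcases lt_or_ge s i with h1 | h1
  · refine hF _ ⟨s, by omega⟩ ?_ (c1 h1)
    simp only [plugArgs, h1, if_true]
    rw [cyclic_of_mod a hsl, hl]
  · rcases lt_or_ge s (i + q) with h2 | h2
    · refine F.map_coord_zero ⟨i, hi⟩ ?_
      simp only [plugArgs, lt_irrefl, if_false, if_true]
      refine hx _ ⟨s - i, by omega⟩ ?_ (c2 h1 h2)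
      rw [← hl]
      refine cyclic_of_mod a ?_
      rw [← hsl]
      congr 1
      simp only
      omega
    · refine hF _ ⟨s + 1 - q, by omega⟩ ?_ (c3 h2)
      have e1 : ¬ (s + 1 - q < i) := by omega
      have e2 : ¬ (s + 1 - q = i) := by omega
      simp only [plugArgs, e1, e2, if_false]
      rw [← hl]
      refine cyclic_of_mod a ?_
      rw [← hsl]
      congr 1
      omega

variable (k A)

/-- The multiplication of `A` as a multilinear map in two arguments. -/
def mulMap : MultilinearMap k (fun _ : Fin 2 => A) A :=
  MultilinearMap.mkPiAlgebraFin k 2 A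

/-- The identity of `A` as a multilinear map in one argument. -/
def idMap : MultilinearMap k (fun _ : Fin 1 => A) A :=
  MultilinearMap.mkPiAlgebraFin k 1 A

variable {k A}

lemma plug_idMap {N : ℕ} (F : MultilinearMap k (fun _ : Fin N => A) E) (r : ℕ) (a : Fin N → A)
    (hN : 0 < N) : plug N F (idMap k A) r 0 a = F (fun j => cyclic a (r + j)) := by
  rw [plug_apply _ _ _ _ rfl hN]
  congr 1
  funext j
  simp only [plugArgs, not_lt_zero, if_false, idMap, MultilinearMap.mkPiAlgebraFin_apply]
  split_ifs with c
  · simp [c]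
  · congr 1; omega

/-- `(a_0, …, a_n) ↦ φ (a_0) (f (a_1, …, a_n))` -/
def actLeft {E' : Type*} [AddCommGroup E'] [Module k E'] (φ : A →ₗ[k] E →ₗ[k] E') {n : ℕ}
    (f : MultilinearMap k (fun _ : Fin n => A) E) :
    MultilinearMap k (fun _ : Fin (n + 1) => A) E' :=
  LinearMap.uncurryLeft
    { toFun := fun a => (φ a).compMultilinearMap f
      map_add' := fun a b => by ext; simp
      map_smul' := fun c a => by ext; simp }

/-- `(a_0, …, a_n) ↦ φ (a_n) (f (a_0, …, a_{n-1}))` -/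
def actRight {E' : Type*} [AddCommGroup E'] [Module k E'] (φ : A →ₗ[k] E →ₗ[k] E') {n : ℕ}
    (f : MultilinearMap k (fun _ : Fin n => A) E) :
    MultilinearMap k (fun _ : Fin (n + 1) => A) E' :=
  MultilinearMap.uncurryRight (φ.flip.compMultilinearMap f)

lemma actLeft_vanish {E' : Type*} [AddCommGroup E'] [Module k E'] (φ : A →ₗ[k] E →ₗ[k] E')
    {n : ℕ} {f : MultilinearMap k (fun _ : Fin n => A) E}
    (hf : ∀ (a : Fin n → A) (l : Fin n), a l = 1 → f a = 0) (a : Fin (n + 1) → A)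
    (l : Fin (n + 1)) (h0 : (l : ℕ) ≠ 0) (hl : a l = 1) : actLeft φ f a = 0 := by
  obtain ⟨t, rfl⟩ := Fin.exists_succ_eq.mpr (fun h => h0 (by simp [h]) : l ≠ 0)
  have : f (Fin.tail a) = 0 := hf _ t hl
  simp [actLeft, this]

/-- The tuple `a` with its entry `a_l` removed. -/
def removeArg {N : ℕ} (M l : ℕ) (a : Fin N → A) : Fin M → A := fun j =>
  if (j : ℕ) < l then cyclic a j else cyclic a (j + 1)

lemma plug_mul_left {N M : ℕ} (F : MultilinearMap k (fun _ : Fin M => A) E) (a : Fin N → A)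
    (l : ℕ) (hN : N = M + 1) (hlM : l < M) (h1 : cyclic a l = 1) :
    plug N F (mulMap k A) 0 l a = F (removeArg M l a) := by
  rw [plug_apply _ _ _ _ (by omega) hlM]
  congr 1
  funext j
  simp only [plugArgs, removeArg, zero_add, mulMap, MultilinearMap.mkPiAlgebraFin_apply]
  split_ifs with c1 c2
  · rfl
  · simp [List.ofFn_succ, h1, c2]
  · congr 1; omega

lemma plug_mul_right {N M : ℕ} (F : MultilinearMap k (fun _ : Fin M => A) E) (a : Fin N → A)
    (l : ℕ) (hN : N = M + 1) (hlM : l < M) (h1 : cyclic a (l + 1) = 1) :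
    plug N F (mulMap k A) 0 l a = F (removeArg M (l + 1) a) := by
  rw [plug_apply _ _ _ _ (by omega) hlM]
  congr 1
  funext j
  simp only [plugArgs, removeArg, zero_add, mulMap, MultilinearMap.mkPiAlgebraFin_apply]
  rcases lt_trichotomy (j : ℕ) l with c | c | c
  · rw [if_pos c, if_pos (by omega)]
  · rw [if_neg (by omega), if_pos c, if_pos (by omega)]
    simp [List.ofFn_succ, h1, c]
  · rw [if_neg (by omega), if_neg (by omega), if_neg (by omega)]
    congr 1; omega

lemma plug_mul_cyclic {N M : ℕ} (F : MultilinearMap k (fun _ : Fin M => A) E) (a : Fin N → A)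
    (hN : N = M + 1) (hM : 0 < M) (h1 : cyclic a M = 1) :
    plug N F (mulMap k A) M 0 a = F (removeArg M M a) := by
  rw [plug_apply _ _ _ _ (by omega) hM]
  congr 1
  funext j
  have hj := j.isLt
  have hshift : ∀ t, cyclic a (M + 1 + t) = cyclic a t := by
    intro t
    have : (M + 1 + t) % N = t % N := by rw [hN, Nat.add_mod_left]
    simp only [cyclic, this]
  simp only [plugArgs, removeArg, mulMap, MultilinearMap.mkPiAlgebraFin_apply, hj, if_true]
  split_ifs with c1 c2
  · omega
  · have := hshift 0
    simp only [add_zero] at this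
    simp [List.ofFn_succ, h1, this, c2]
  · rw [← hshift j]
    congr 1; omega

end Multilinear

section Cochains

variable {k : Type u} [Field k] {A : Type v} [Ring A] [Algebra k A]

/-- Hochschild cochains with `n` arguments. -/
abbrev Cochain (k : Type u) [Field k] (A : Type v) [Ring A] [Algebra k A] (n : ℕ) :=
  MultilinearMap k (fun _ : Fin n => A) A

/-- The brace `x{y}`, as a cochain with `N` arguments; it is zero unless `N = p + q - 1`.
For a cochain with `q` arguments, `|y| = q - 1`. -/
def brace (N : ℕ) {p q : ℕ} (x : Cochain k A p) (y : Cochain k A q) : Cochain k A N :=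
  ∑ i ∈ Finset.range p, (-1 : k) ^ ((q + 1) * i) • plug N x y 0 i

/-- The Gerstenhaber bracket `[x, y] = x{y} - (-1)^{|x||y|} y{x}`. -/
def gerstenhaber (N : ℕ) {p q : ℕ} (x : Cochain k A p) (y : Cochain k A q) : Cochain k A N :=
  brace N x y - (-1 : k) ^ ((p + 1) * (q + 1)) • brace N y x

lemma brace_add_left (N : ℕ) {p q : ℕ} (x x' : Cochain k A p) (y : Cochain k A q) :
    brace N (x + x') y = brace N x y + brace N x' y := by
  simp [brace, add_plug, smul_add, Finset.sum_add_distrib]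

lemma brace_smul_left (N : ℕ) {p q : ℕ} (c : k) (x : Cochain k A p) (y : Cochain k A q) :
    brace N (c • x) y = c • brace N x y := by
  simp [brace, smul_plug, Finset.smul_sum, smul_comm c]

lemma brace_add_right (N : ℕ) {p q : ℕ} (x : Cochain k A p) (y y' : Cochain k A q) :
    brace N x (y + y') = brace N x y + brace N x y' := by
  simp [brace, plug_add, smul_add, Finset.sum_add_distrib]

lemma brace_smul_right (N : ℕ) {p q : ℕ} (c : k) (x : Cochain k A p) (y : Cochain k A q) :
    brace N x (c • y) = c • brace N x y := by
  simp [brace, plug_smul, Finset.smul_sum, smul_comm c]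

lemma gerstenhaber_add_left (N : ℕ) {p q : ℕ} (x x' : Cochain k A p) (y : Cochain k A q) :
    gerstenhaber N (x + x') y = gerstenhaber N x y + gerstenhaber N x' y := by
  simp only [gerstenhaber, brace_add_left, brace_add_right, smul_add]; abel

lemma gerstenhaber_smul_left (N : ℕ) {p q : ℕ} (c : k) (x : Cochain k A p) (y : Cochain k A q) :
    gerstenhaber N (c • x) y = c • gerstenhaber N x y := by
  simp only [gerstenhaber, brace_smul_left, brace_smul_right, smul_sub, smul_comm c]

lemma gerstenhaber_add_right (N : ℕ) {p q : ℕ} (x : Cochain k A p) (y y' : Cochain k A q) :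
    gerstenhaber N x (y + y') = gerstenhaber N x y + gerstenhaber N x y' := by
  simp only [gerstenhaber, brace_add_left, brace_add_right, smul_add]; abel

lemma gerstenhaber_smul_right (N : ℕ) {p q : ℕ} (c : k) (x : Cochain k A p)
    (y : Cochain k A q) : gerstenhaber N x (c • y) = c • gerstenhaber N x y := by
  simp only [gerstenhaber, brace_smul_left, brace_smul_right, smul_sub, smul_comm c]

lemma gerstenhaber_zero_left (N : ℕ) {p q : ℕ} (y : Cochain k A q) :
    gerstenhaber N (0 : Cochain k A p) y = 0 := by
  simpa using gerstenhaber_smul_left N (0 : k) (0 : Cochain k A p) y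

lemma gerstenhaber_zero_right (N : ℕ) {p q : ℕ} (x : Cochain k A p) :
    gerstenhaber N x (0 : Cochain k A q) = 0 := by
  simpa using gerstenhaber_smul_right N (0 : k) x (0 : Cochain k A q)

lemma gerstenhaber_arity_zero (N : ℕ) {p q : ℕ} (hp : p = 0) (hq : q = 0) (x : Cochain k A p)
    (y : Cochain k A q) : gerstenhaber N x y = 0 := by
  subst hp hq
  simp [gerstenhaber, brace]

variable (k A)

/-- Normalized cochains with `n` arguments and values in `E`: they vanish as soon as one argument
is `1`, that is, they are multilinear maps on `(A / k)^n`. -/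
def normalized (E : Type*) [AddCommGroup E] [Module k E] (n : ℕ) :
    Submodule k (MultilinearMap k (fun _ : Fin n => A) E) where
  carrier := {x | ∀ (a : Fin n → A) (l : Fin n), a l = 1 → x a = 0}
  add_mem' hx hy a l hl := by simp [hx a l hl, hy a l hl]
  zero_mem' _ _ _ := rfl
  smul_mem' c x hx a l hl := by simp [hx a l hl]

/-- The vector space of cochains with `n` arguments. -/
def CochainSpace (n : ℕ) : Type v := Cochain k A n

instance (n : ℕ) : AddCommGroup (CochainSpace k A n) :=
  inferInstanceAs (AddCommGroup (Cochain k A n))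

instance (n : ℕ) : Module k (CochainSpace k A n) :=
  inferInstanceAs (Module k (Cochain k A n))

/-- The degree `i` part of the shifted normalized Hochschild cochain complex: normalized cochains
with `i + 1` arguments (zero for `i < -1`). -/
def cochains (i : ℤ) : Submodule k (CochainSpace k A (i + 1).toNat) where
  carrier := {x | x ∈ normalized k A A (i + 1).toNat ∧ (i < -1 → x = 0)}
  add_mem' hx hy := ⟨add_mem hx.1 hy.1, fun h => by rw [hx.2 h, hy.2 h, add_zero]⟩
  zero_mem' := ⟨zero_mem _, fun _ => rfl⟩
  smul_mem' c x hx := ⟨(normalized k A A _).smul_mem c hx.1, fun h => by rw [hx.2 h, smul_zero]⟩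

variable {k A}

lemma brace_mem {p q : ℕ} (N : ℕ) {x : Cochain k A p} {y : Cochain k A q}
    (hx : x ∈ normalized k A A p) (hy : y ∈ normalized k A A q) :
    brace N x y ∈ normalized k A A N := by
  refine Submodule.sum_mem _ fun i _ => Submodule.smul_mem _ _ ?_
  intro a l hl
  exact plug_vanish x y 0 i (fun _ => True) (fun _ => True) (fun w j hw _ => hx w j hw)
    (fun w j hw _ => hy w j hw) a l hl (by simp)

lemma gerstenhaber_mem {p q : ℕ} (N : ℕ) {x : Cochain k A p} {y : Cochain k A q}
    (hx : x ∈ normalized k A A p) (hy : y ∈ normalized k A A q) :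
    gerstenhaber N x y ∈ normalized k A A N :=
  sub_mem (brace_mem N hx hy) (Submodule.smul_mem _ _ (brace_mem N hy hx))

lemma gerstenhaber_mem_cochains {i j l : ℤ} (h : i + j = l) (x : cochains k A i)
    (y : cochains k A j) :
    gerstenhaber (l + 1).toNat x.1 y.1 ∈ cochains k A l := by
  refine ⟨gerstenhaber_mem _ x.2.1 y.2.1, fun hl => ?_⟩
  by_cases hi : i < -1
  · rw [x.2.2 hi]
    exact gerstenhaber_zero_left _ y.1
  by_cases hj : j < -1
  · rw [y.2.2 hj]
    exact gerstenhaber_zero_right _ x.1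
  have hi' : (i + 1).toNat = 0 := by omega
  have hj' : (j + 1).toNat = 0 := by omega
  exact gerstenhaber_arity_zero _ hi' hj' x.1 y.1

/-- The Lie bracket of the graded Lie algebra of (shifted) normalized Hochschild cochains. -/
def cochainBracket {i j l : ℤ} (h : i + j = l) :
    cochains k A i →ₗ[k] cochains k A j →ₗ[k] cochains k A l :=
  LinearMap.mk₂ k (fun x y => ⟨gerstenhaber (l + 1).toNat x.1 y.1, gerstenhaber_mem_cochains h x y⟩)
    (fun _ _ _ => Subtype.ext (gerstenhaber_add_left _ _ _ _))
    (fun _ _ _ => Subtype.ext (gerstenhaber_smul_left _ _ _ _))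
    (fun _ _ _ => Subtype.ext (gerstenhaber_add_right _ _ _ _))
    (fun _ _ _ => Subtype.ext (gerstenhaber_smul_right _ _ _ _))

variable (k A)

/-- The inverse multiplication `μ (a, b) = - a b`. -/
def mu : Cochain k A 2 := -mulMap k A

variable {k A}

lemma plug_neg {E : Type*} [AddCommGroup E] [Module k E] {N M q : ℕ}
    (F : MultilinearMap k (fun _ : Fin M => A) E)
    (x : MultilinearMap k (fun _ : Fin q => A) A) (r i : ℕ) :
    plug N F (-x) r i = -plug N F x r i := by
  rw [← neg_one_smul k x, plug_smul, neg_one_smul]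

lemma cyclic_val {N : ℕ} (a : Fin N → A) (l : Fin N) : cyclic a l = a l :=
  cyclic_of_mod a (Nat.mod_eq_of_lt l.isLt)

/-- Two adjacent faces of a tuple with an entry `1` cancel. -/
lemma sum_plug_mul {E : Type*} [AddCommGroup E] [Module k E] {n : ℕ} (l : ℕ)
    (F : MultilinearMap k (fun _ : Fin n => A) E) (a : Fin (n + 1) → A)
    (hF : ∀ i < n, i + 1 ≠ l → i ≠ l → plug (n + 1) F (mulMap k A) 0 i a = 0)
    (hl : cyclic a l = 1) (hln : l ≤ n) :
    ∑ i ∈ Finset.range n, (-1 : k) ^ i • plug (n + 1) F (mulMap k A) 0 i a =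
      (if l = 0 then 0 else (-1 : k) ^ (l - 1) • F (removeArg n l a)) +
      (if l < n then (-1 : k) ^ l • F (removeArg n l a) else 0) := by
  have h1 : ∀ i ∈ Finset.range n, (-1 : k) ^ i • plug (n + 1) F (mulMap k A) 0 i a =
      (if i + 1 = l then (-1 : k) ^ i • F (removeArg n l a) else 0) +
      (if i = l then (-1 : k) ^ i • F (removeArg n l a) else 0) := by
    intro i hi
    rw [Finset.mem_range] at hi
    by_cases c1 : i + 1 = l
    · subst c1
      rw [plug_mul_right F a i rfl hi hl]
      simp
    · by_cases c2 : i = l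
      · subst c2
        rw [plug_mul_left F a i rfl hi hl]
        simp
      · simp [hF i hi c1 c2, c1, c2]
  rw [Finset.sum_congr rfl h1, Finset.sum_add_distrib]
  congr 1
  · rcases l with _ | l
    · simp
    · simp only [Nat.add_right_cancel_iff, Finset.sum_ite_eq', Finset.mem_range]
      rw [if_pos (by omega)]
      simp
  · simp [Finset.sum_ite_eq']

/-- The Hochschild differential `[μ, x]` preserves normalized cochains. -/
lemma gerstenhaber_mu_mem {p N : ℕ} {x : Cochain k A p} (hx : x ∈ normalized k A A p)
    (hN : N = p + 1) : gerstenhaber N (mu k A) x ∈ normalized k A A N := by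
  subst hN
  intro a l hl
  have hl' : cyclic a l = 1 := by rw [cyclic_val, hl]
  have hs := sum_plug_mul (l : ℕ) x a (by
    intro i hi h1 h2
    refine plug_vanish x (mulMap k A) 0 i (fun _ => True) (fun _ => False)
      (fun w j hw _ => hx w j hw) (fun _ _ _ h => h.elim) a l hl ?_
    intro s hs hsl
    rw [zero_add, Nat.mod_eq_of_lt hs] at hsl
    refine ⟨fun _ => trivial, fun _ _ => by omega, fun _ => trivial⟩) hl' (by omega)
  have e0 : plug (p + 1) (mulMap k A) x 0 0 a =
      x (fun t => cyclic a t) * cyclic a p := by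
    rw [plug_apply _ _ _ _ (by omega) (by omega)]
    simp [mulMap, plugArgs, List.ofFn_succ]
  have e1 : plug (p + 1) (mulMap k A) x 0 1 a =
      cyclic a 0 * x (fun t => cyclic a (1 + t)) := by
    rw [plug_apply _ _ _ _ (by omega) (by omega)]
    simp [mulMap, plugArgs, List.ofFn_succ]
  have key : gerstenhaber (p + 1) (mu k A) x a =
      -(x (fun t => cyclic a t) * cyclic a p)
      + (-1 : k) ^ p • (cyclic a 0 * x (fun t => cyclic a (1 + t)))
      - (-1 : k) ^ p • ∑ i ∈ Finset.range p, (-1 : k) ^ i • plug (p + 1) x (mulMap k A) 0 i a := by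
    have s1 : ∀ i, (-1 : k) ^ ((2 + 1) * i) = (-1 : k) ^ i := fun i => by
      rw [pow_mul]; norm_num
    have s2 : (-1 : k) ^ ((2 + 1) * (p + 1)) = -(-1 : k) ^ p := by
      rw [s1, pow_succ]; ring
    have s3 : mu k A = (-1 : k) • mulMap k A := (neg_one_smul k _).symm
    have t1 : brace (p + 1) (mu k A) x a = -(x (fun t => cyclic a t) * cyclic a p)
        + (-1 : k) ^ p • (cyclic a 0 * x (fun t => cyclic a (1 + t))) := by
      rw [s3, brace_smul_left, brace, Finset.sum_range_succ, Finset.sum_range_one,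
        _root_.smul_apply, _root_.add_apply, _root_.smul_apply, _root_.smul_apply, e0, e1]
      simp [pow_succ]
    have t2 : brace (p + 1) x (mu k A) a =
        -∑ i ∈ Finset.range p, (-1 : k) ^ i • plug (p + 1) x (mulMap k A) 0 i a := by
      rw [s3, brace_smul_right, brace]
      simp [s1]
    rw [gerstenhaber, _root_.sub_apply, _root_.smul_apply, t1, t2, s2]
    simp
  rw [key, hs]
  have hlp : (l : ℕ) < p + 1 := l.isLt
  have z0 : (l : ℕ) < p → x (fun t => cyclic a t) = 0 := fun h =>
    hx _ ⟨l, h⟩ hl'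
  have z1 : (l : ℕ) ≠ 0 → x (fun t => cyclic a (1 + t)) = 0 := fun h =>
    hx _ ⟨l - 1, by omega⟩ (by
      rw [← hl']
      congr 1
      simp only
      omega)
  by_cases c0 : (l : ℕ) = 0
  · have hr : (fun t : Fin p => cyclic a (1 + t)) = removeArg p l a := by
      funext t
      simp [removeArg, c0, add_comm]
    rw [hr]
    rw [c0] at hl'
    rcases Nat.eq_zero_or_pos p with hp | hp
    · subst hp
      have hsub : (fun t : Fin 0 => cyclic a t) = removeArg 0 l a := Subsingleton.elim _ _
      simp [hl', hsub]
    · rw [z0 (by omega)]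
      simp [c0, hl', hp]
  · rw [z1 c0, if_neg c0]
    by_cases c1 : (l : ℕ) < p
    · rw [z0 c1, if_pos c1]
      obtain ⟨m, hm⟩ := Nat.exists_eq_succ_of_ne_zero c0
      rw [hm]
      simp [pow_succ]
    · have hp : (l : ℕ) = p := by omega
      have hr : (fun t : Fin p => cyclic a t) = removeArg p l a := by
        funext t
        have := t.isLt
        simp [removeArg, hp]
      have hlp' : cyclic a p = 1 := (congrArg (cyclic a) hp).symm.trans hl'
      have hsg : (-1 : k) ^ p * (-1 : k) ^ ((l : ℕ) - 1) = -1 := by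
        rw [← pow_add]
        exact Odd.neg_one_pow ⟨p - 1, by omega⟩
      rw [hr, if_neg c1, hlp', add_zero, smul_smul, hsg]
      simp

lemma gerstenhaber_mu_mem_cochains {i : ℤ} (x : cochains k A i) :
    gerstenhaber (i + 1 + 1).toNat (mu k A) x.1 ∈ cochains k A (i + 1) := by
  have hz : i < -1 → gerstenhaber (i + 1 + 1).toNat (mu k A) x.1 = 0 := by
    intro h
    rw [x.2.2 h]
    exact gerstenhaber_zero_right _ _
  refine ⟨?_, fun h => hz (by omega)⟩
  by_cases h : i < -1
  · rw [hz h]; exact zero_mem _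
  · exact gerstenhaber_mu_mem x.2.1 (by omega)

variable (k A)

/-- The differential `d x = [μ, x]` of the shifted normalized Hochschild cochain complex. -/
def cochainD (i : ℤ) : cochains k A i →ₗ[k] cochains k A (i + 1) where
  toFun x := ⟨gerstenhaber (i + 1 + 1).toNat (mu k A) x.1, gerstenhaber_mu_mem_cochains x⟩
  map_add' _ _ := Subtype.ext (gerstenhaber_add_right _ _ _ _)
  map_smul' _ _ := Subtype.ext (gerstenhaber_smul_right _ _ _ _)

end Cochains

section Chains

variable (k : Type u) [Field k] (A : Type v) [Ring A] [Algebra k A]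

/-- The span of the tensors `a_0 ⊗ ⋯ ⊗ a_n` with `a_l = 1` for some `l ≠ 0`. -/
def degenerate (n : ℕ) : Submodule k (⨂[k] _ : Fin (n + 1), A) :=
  Submodule.span k
    {z | ∃ (a : Fin (n + 1) → A) (l : Fin (n + 1)), l ≠ 0 ∧ a l = 1 ∧ z = PiTensorProduct.tprod k a}

/-- Normalized Hochschild chains `A ⊗ (A / k)^{⊗ n}`. -/
def Chain (n : ℕ) : Type (max u v) := (⨂[k] _ : Fin (n + 1), A) ⧸ degenerate k A n

instance (n : ℕ) : AddCommGroup (Chain k A n) :=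
  inferInstanceAs (AddCommGroup (_ ⧸ degenerate k A n))

instance (n : ℕ) : Module k (Chain k A n) :=
  inferInstanceAs (Module k (_ ⧸ degenerate k A n))

/-- The projection from tensors to normalized chains. -/
def chainProj (n : ℕ) : (⨂[k] _ : Fin (n + 1), A) →ₗ[k] Chain k A n :=
  (degenerate k A n).mkQ

/-- `(a_0, …, a_n) ↦ a_0 ⊗ ⋯ ⊗ a_n` -/
def chainMk (n : ℕ) : MultilinearMap k (fun _ : Fin (n + 1) => A) (Chain k A n) :=
  (chainProj k A n).compMultilinearMap (PiTensorProduct.tprod k)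

variable {k A}

lemma chainMk_eq_zero {n : ℕ} (a : Fin (n + 1) → A) (l : Fin (n + 1)) (hl : a l = 1)
    (h0 : (l : ℕ) ≠ 0) : chainMk k A n a = 0 := by
  refine (Submodule.Quotient.mk_eq_zero (degenerate k A n)).mpr ?_
  exact Submodule.subset_span ⟨a, l, fun h => h0 (by simp [h]), hl, rfl⟩

variable (k A)

/-- `(a_1, …, a_n) ↦ 1 ⊗ a_1 ⊗ ⋯ ⊗ a_n` -/
def chainMkOne (n : ℕ) : MultilinearMap k (fun _ : Fin n => A) (Chain k A n) :=
  (chainMk k A n).curryLeft 1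

variable {k A}

lemma chainMkOne_eq_zero {n : ℕ} (a : Fin n → A) (l : Fin n) (hl : a l = 1) :
    chainMkOne k A n a = 0 := by
  simp only [chainMkOne, MultilinearMap.curryLeft_apply]
  exact chainMk_eq_zero _ l.succ (by simpa using hl) (by simp)

section Lift

variable {E : Type*} [AddCommGroup E] [Module k E]

/-- The linear map on normalized chains induced by a multilinear map that vanishes on the
degenerate tensors. -/
def chainLift {n : ℕ} (f : MultilinearMap k (fun _ : Fin (n + 1) => A) E)
    (hf : ∀ (a : Fin (n + 1) → A) (l : Fin (n + 1)), (l : ℕ) ≠ 0 → a l = 1 → f a = 0) :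
    Chain k A n →ₗ[k] E :=
  (degenerate k A n).liftQ (PiTensorProduct.lift f) <| by
    rw [degenerate, Submodule.span_le]
    rintro _ ⟨a, l, h0, hl, rfl⟩
    simpa using hf a l (fun h => h0 (Fin.ext h)) hl

lemma chainLift_mk {n : ℕ} (f : MultilinearMap k (fun _ : Fin (n + 1) => A) E)
    (hf : ∀ (a : Fin (n + 1) → A) (l : Fin (n + 1)), (l : ℕ) ≠ 0 → a l = 1 → f a = 0)
    (a : Fin (n + 1) → A) : chainLift f hf (chainMk k A n a) = f a := by
  exact PiTensorProduct.lift.tprod a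

lemma chain_hom_ext {n : ℕ} {f g : Chain k A n →ₗ[k] E}
    (h : ∀ a, f (chainMk k A n a) = g (chainMk k A n a)) : f = g := by
  refine Submodule.linearMap_qext _ (PiTensorProduct.ext ?_)
  ext a
  exact h a

end Lift

variable (k A)

/-- The Hochschild differential as a multilinear map:
`∑_{i<n} (-1)^i a_0 ⊗ ⋯ ⊗ a_i a_{i+1} ⊗ ⋯ ⊗ a_n + (-1)^n a_n a_0 ⊗ a_1 ⊗ ⋯ ⊗ a_{n-1}`,
for `n = m + 1`, and zero otherwise. This is the Lie derivative along `μ`. -/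
def hochschildMulti (n m : ℕ) : MultilinearMap k (fun _ : Fin (n + 1) => A) (Chain k A m) :=
  ∑ i ∈ Finset.range n, (-1 : k) ^ i • plug (n + 1) (chainMk k A m) (mulMap k A) 0 i
    + (-1 : k) ^ n • plug (n + 1) (chainMk k A m) (mulMap k A) n 0

variable {k A}

lemma hochschildMulti_vanish {n m : ℕ} (a : Fin (n + 1) → A) (l : Fin (n + 1)) (h0 : (l : ℕ) ≠ 0)
    (hl : a l = 1) : hochschildMulti k A n m a = 0 := by
  by_cases hn : n = m + 1
  swap
  · have : n + 1 + 1 ≠ m + 1 + 2 := by omega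
    simp [hochschildMulti, plug_eq_zero _ _ _ _ this]
  subst hn
  have hl' : cyclic a l = 1 := by rw [cyclic_val, hl]
  have hlt := l.isLt
  have hs := sum_plug_mul (l : ℕ) (chainMk k A m) a (by
    intro i hi h1 h2
    refine plug_vanish _ (mulMap k A) 0 i (fun t => t ≠ 0) (fun _ => False)
      (fun w j hw hj => chainMk_eq_zero w j hw hj) (fun _ _ _ h => h.elim) a l hl ?_
    intro s hs hsl
    rw [zero_add, Nat.mod_eq_of_lt hs] at hsl
    refine ⟨fun _ => by omega, fun _ _ => by omega, fun _ => by omega⟩) hl' (by omega)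
  simp only [hochschildMulti, _root_.add_apply, _root_.smul_apply, _root_.sum_apply]
  rw [hs, if_neg h0]
  by_cases c : (l : ℕ) < m + 1
  · rw [if_pos c]
    have hz : plug (m + 1 + 1) (chainMk k A m) (mulMap k A) (m + 1) 0 a = 0 := by
      refine plug_vanish _ (mulMap k A) (m + 1) 0 (fun t => t ≠ 0) (fun _ => False)
        (fun w j hw hj => chainMk_eq_zero w j hw hj) (fun _ _ _ h => h.elim) a l hl ?_
      intro s hs hsl
      refine ⟨fun _ => by omega, fun _ h2 => ?_, fun _ => by omega⟩
      rcases s with _ | _ | s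
      · rw [add_zero, Nat.mod_eq_of_lt (by omega)] at hsl
        omega
      · rw [zero_add, Nat.mod_self] at hsl
        omega
      · omega
    obtain ⟨t, ht⟩ := Nat.exists_eq_succ_of_ne_zero h0
    rw [hz, ht]
    simp [pow_succ]
  · have hm : (l : ℕ) = m + 1 := by omega
    rw [if_neg c, plug_mul_cyclic _ a rfl (by omega) ((congrArg (cyclic a) hm).symm.trans hl'), hm]
    simp [pow_succ]

variable (k A)

/-- The Hochschild differential `b` on normalized chains (zero unless `n = m + 1`). -/
def hochschildB (n m : ℕ) : Chain k A n →ₗ[k] Chain k A m :=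
  chainLift (hochschildMulti k A n m) fun a l h0 hl => hochschildMulti_vanish a l h0 hl

/-- The Connes operator `B` on normalized chains,
`a_0 ⊗ ⋯ ⊗ a_n ↦ ∑_i (-1)^{n i} 1 ⊗ a_i ⊗ ⋯ ⊗ a_n ⊗ a_0 ⊗ ⋯ ⊗ a_{i-1}` (zero unless `m = n + 1`).
The remaining terms of the operator on unnormalized chains are degenerate. -/
def connesB (n m : ℕ) : Chain k A n →ₗ[k] Chain k A m :=
  chainLift (∑ i ∈ Finset.range (n + 1),
      (-1 : k) ^ (n * i) • plug (n + 1) (chainMkOne k A m) (idMap k A) i 0) <| by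
    intro a l h0 hl
    simp only [_root_.sum_apply, _root_.smul_apply]
    refine Finset.sum_eq_zero fun i _ => ?_
    by_cases hn : n + 1 = m
    · subst hn
      rw [plug_idMap _ _ _ (by omega)]
      obtain ⟨s, hs, hsl, -⟩ := exists_place i l
      rw [chainMkOne_eq_zero _ ⟨s, hs⟩ (by rw [cyclic_of_mod a hsl, hl]), smul_zero]
    · rw [plug_eq_zero _ _ _ _ (by omega)]
      simp

variable {k A}

/-- Contraction `a_0 ⊗ ⋯ ⊗ a_n ↦ a_0 x (a_1, …, a_p) ⊗ a_{p+1} ⊗ ⋯ ⊗ a_n` with a normalized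
cochain (zero unless `n = m + p`). -/
def contraction {p : ℕ} (x : normalized k A A p) (n m : ℕ) : Chain k A n →ₗ[k] Chain k A m :=
  chainLift (plug (n + 1) (chainMk k A m) (actLeft (LinearMap.mul k A) x.1) 0 0) <| by
    intro a l h0 hl
    refine plug_vanish _ _ 0 0 (fun t => t ≠ 0) (fun t => t ≠ 0)
      (fun w j hw hj => chainMk_eq_zero w j hw hj) (fun w j hw hj => ?_) a l hl ?_
    · exact actLeft_vanish _ x.2 w j hj hw
    · intro s hs hsl
      rw [zero_add, Nat.mod_eq_of_lt hs] at hsl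
      exact ⟨fun _ => by omega, fun _ _ => by omega, fun _ => by omega⟩

/-- The Lie derivative along a cochain with `p` arguments, `|x| = p - 1`, as a multilinear map:
`∑_{i=0}^{n-p} (-1)^{|x| i} a_0 ⊗ ⋯ ⊗ a_i ⊗ x (a_{i+1}, …, a_{i+p}) ⊗ ⋯ ⊗ a_n
+ ∑_{i=n+1-p}^n (-1)^{n(i+1)+|x|} x (a_{i+1}, …, a_n, a_0, …) ⊗ ⋯ ⊗ a_i`
(zero unless `n + 1 = m + p`). -/
def lieMulti {p : ℕ} (x : Cochain k A p) (n m : ℕ) :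
    MultilinearMap k (fun _ : Fin (n + 1) => A) (Chain k A m) :=
  ∑ i ∈ Finset.range (n + 1 - p),
      (-1 : k) ^ ((p + 1) * i) • plug (n + 1) (chainMk k A m) x 0 (i + 1)
    + ∑ i ∈ Finset.Icc (n + 1 - p) n,
      (-1 : k) ^ (n * (i + 1) + (p + 1)) • plug (n + 1) (chainMk k A m) x (i + 1) 0

lemma lieMulti_vanish {p : ℕ} {x : Cochain k A p} (hx : x ∈ normalized k A A p) {n m : ℕ}
    (a : Fin (n + 1) → A) (l : Fin (n + 1)) (h0 : (l : ℕ) ≠ 0) (hl : a l = 1) :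
    lieMulti x n m a = 0 := by
  simp only [lieMulti, _root_.add_apply, _root_.sum_apply, _root_.smul_apply]
  rw [Finset.sum_eq_zero, Finset.sum_eq_zero, add_zero]
  · intro i _
    rw [plug_vanish _ _ (i + 1) 0 (fun t => t ≠ 0) (fun _ => True)
      (fun w j hw hj => chainMk_eq_zero w j hw hj) (fun w j hw _ => hx w j hw) a l hl, smul_zero]
    exact fun s _ _ => ⟨fun _ => by omega, fun _ _ => trivial, fun _ => by omega⟩
  · intro i _
    rw [plug_vanish _ _ 0 (i + 1) (fun t => t ≠ 0) (fun _ => True)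
      (fun w j hw hj => chainMk_eq_zero w j hw hj) (fun w j hw _ => hx w j hw) a l hl, smul_zero]
    intro s hs hsl
    rw [zero_add, Nat.mod_eq_of_lt hs] at hsl
    exact ⟨fun _ => by omega, fun _ _ => trivial, fun _ => by omega⟩

lemma lieMulti_add {p : ℕ} (x y : Cochain k A p) (n m : ℕ) :
    lieMulti (x + y) n m = lieMulti x n m + lieMulti y n m := by
  simp only [lieMulti, plug_add, smul_add, Finset.sum_add_distrib]; abel

lemma lieMulti_smul {p : ℕ} (c : k) (x : Cochain k A p) (n m : ℕ) :
    lieMulti (c • x) n m = c • lieMulti x n m := by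
  simp only [lieMulti, plug_smul, smul_add, Finset.smul_sum, smul_comm c]

/-- The Lie derivative `L_x` along a normalized cochain, on normalized chains. -/
def lieDerivative {p : ℕ} (n m : ℕ) :
    normalized k A A p →ₗ[k] Chain k A n →ₗ[k] Chain k A m where
  toFun x := chainLift (lieMulti x.1 n m) fun a l h0 hl => lieMulti_vanish x.2 a l h0 hl
  map_add' x y := chain_hom_ext fun a => by
    simp [chainLift_mk, lieMulti_add]
  map_smul' c x := chain_hom_ext fun a => by
    simp [chainLift_mk, lieMulti_smul]

lemma lieDerivative_eq_zero {p : ℕ} {n m : ℕ} (h : n + 1 ≠ m + p) :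
    lieDerivative (k := k) (A := A) (p := p) n m = 0 := by
  refine LinearMap.ext fun x => chain_hom_ext fun a => ?_
  have h' : n + 1 + 1 ≠ m + 1 + p := by omega
  simp [lieDerivative, chainLift_mk, lieMulti, plug_eq_zero _ _ _ _ h']

lemma hochschildB_eq_zero {n m : ℕ} (h : n ≠ m + 1) : hochschildB k A n m = 0 := by
  refine chain_hom_ext fun a => ?_
  have h' : n + 1 + 1 ≠ m + 1 + 2 := by omega
  simp [hochschildB, chainLift_mk, hochschildMulti, plug_eq_zero _ _ _ _ h']

lemma connesB_eq_zero {n m : ℕ} (h : n + 1 ≠ m) : connesB k A n m = 0 := by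
  refine chain_hom_ext fun a => ?_
  have h' : n + 1 + 1 ≠ m + 1 := by omega
  simp [connesB, chainLift_mk, plug_eq_zero _ _ _ _ h']

/-- The operator `S_x` for a normalized cochain with `p` arguments, `|x| = p - 1`: the sum over
`0 ≤ j`, `j + p ≤ l ≤ n` of `(-1)^{|x|(n+l+j) + n(l+1)}` times
`1 ⊗ a_{l+1} ⊗ ⋯ ⊗ a_n ⊗ a_0 ⊗ ⋯ ⊗ a_j ⊗ x (a_{j+1}, …, a_{j+p}) ⊗ a_{j+p+1} ⊗ ⋯ ⊗ a_l`
(zero unless `n + 2 = m + p`). -/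
def sOperator {p : ℕ} (x : normalized k A A p) (n m : ℕ) : Chain k A n →ₗ[k] Chain k A m :=
  chainLift (∑ j ∈ Finset.range (n + 1), ∑ l ∈ Finset.Icc (j + p) n,
      (-1 : k) ^ ((p + 1) * (n + l + j) + n * (l + 1)) •
        plug (n + 1) (chainMkOne k A m) x.1 (l + 1) (n - l + j + 1)) <| by
    intro a t h0 ht
    simp only [_root_.sum_apply, _root_.smul_apply]
    refine Finset.sum_eq_zero fun j _ => Finset.sum_eq_zero fun l _ => ?_
    rw [plug_vanish _ _ (l + 1) _ (fun _ => True) (fun _ => True)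
      (fun w j hw _ => chainMkOne_eq_zero w j hw) (fun w j hw _ => x.2 w j hw) a t ht
      (fun _ _ _ => ⟨fun _ => trivial, fun _ _ => trivial, fun _ => trivial⟩), smul_zero]

end Chains

section NegativeCyclic

variable (k : Type u) [Field k] (A : Type v) [Ring A] [Algebra k A]

/-- Formal expressions `∑_{n, j} η_{n,j} u^j` with `η_{n,j}` a normalized `n`-chain. -/
abbrev CycTotal := (n : ℕ) → ℕ → Chain k A n

/-- The part of cohomological degree `i` of the normalized negative cyclic complex
`C(A)[[u]]`, where `|u| = 2` and `n`-chains have degree `-n`. In homological notation this is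
the degree `-i` part. -/
def negCyclic (i : ℤ) : Submodule k (CycTotal k A) where
  carrier := {η | ∀ (n j : ℕ), (2 * j - n : ℤ) ≠ i → η n j = 0}
  add_mem' hx hy n j h := by simp [hx n j h, hy n j h]
  zero_mem' _ _ _ := rfl
  smul_mem' c x hx n j h := by simp [hx n j h]

variable {k A}

/-- The `u`-linear extension of a family of maps of chains. -/
def uLinear (s : ℕ → ℕ) (T : ∀ n, Chain k A (s n) →ₗ[k] Chain k A n) :
    CycTotal k A →ₗ[k] CycTotal k A where
  toFun η n j := T n (η (s n) j)
  map_add' _ _ := by funext n j; simp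
  map_smul' _ _ := by funext n j; simp

variable (k A)

/-- Multiplication by `u`. -/
def mulU : CycTotal k A →ₗ[k] CycTotal k A where
  toFun η n j := match j with
    | 0 => 0
    | j + 1 => η n j
  map_add' _ _ := by funext n j; cases j <;> simp
  map_smul' _ _ := by funext n j; cases j <;> simp

/-- The cyclic differential `b + u B`. -/
def cyclicD : CycTotal k A →ₗ[k] CycTotal k A :=
  uLinear (fun n => n + 1) (fun n => hochschildB k A (n + 1) n)
    + mulU k A ∘ₗ uLinear (fun n => n - 1) (fun n => connesB k A (n - 1) n)

lemma cyclicD_mem (i : ℤ) (η : CycTotal k A) (hη : η ∈ negCyclic k A i) :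
    cyclicD k A η ∈ negCyclic k A (i + 1) := by
  intro n j h
  have h1 : η (n + 1) j = 0 := hη _ _ (by push_cast; omega)
  cases j with
  | zero => simp [cyclicD, uLinear, mulU, h1]
  | succ j =>
    cases n with
    | zero => simp [cyclicD, uLinear, mulU, h1, connesB_eq_zero]
    | succ n =>
      have h2 : η n j = 0 := hη _ _ (by push_cast at h; omega)
      simp [cyclicD, uLinear, mulU, h1, h2]

/-- The differential `b + u B` of the negative cyclic complex. -/
def negCyclicD (i : ℤ) : negCyclic k A i →ₗ[k] negCyclic k A (i + 1) :=
  (cyclicD k A).restrict (cyclicD_mem k A i)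

variable {k A}

/-- `i_x` on the negative cyclic complex. -/
def contractionU {i : ℤ} (x : cochains k A i) : CycTotal k A →ₗ[k] CycTotal k A :=
  uLinear (fun n => n + (i + 1).toNat) fun n => contraction ⟨x.1, x.2.1⟩ (n + (i + 1).toNat) n

/-- `S_x` on the negative cyclic complex. -/
def sOperatorU {i : ℤ} (x : cochains k A i) : CycTotal k A →ₗ[k] CycTotal k A :=
  uLinear (fun n => n + (i + 1).toNat - 2) fun n =>
    sOperator ⟨x.1, x.2.1⟩ (n + (i + 1).toNat - 2) n

/-- `L_x` on the negative cyclic complex. -/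
def lieU {i : ℤ} (x : cochains k A i) : CycTotal k A →ₗ[k] CycTotal k A :=
  uLinear (fun n => n + (i + 1).toNat - 1) fun n =>
    lieDerivative (n + (i + 1).toNat - 1) n ⟨x.1, x.2.1⟩

lemma lieU_mem {i e e' : ℤ} (h : i + e = e') (x : cochains k A i) {η : CycTotal k A}
    (hη : η ∈ negCyclic k A e) : lieU x η ∈ negCyclic k A e' := by
  intro n j hn
  simp only [lieU, uLinear, LinearMap.coe_mk, AddHom.coe_mk]
  by_cases hi : i < -1
  · have : (⟨x.1, x.2.1⟩ : normalized k A A (i + 1).toNat) = 0 := Subtype.ext (x.2.2 hi)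
    simp [this]
  · by_cases h0 : n + (i + 1).toNat = 0
    · rw [lieDerivative_eq_zero (by omega)]
      simp
    · rw [hη _ _ (by omega), map_zero]

/-- The action `(x, η) ↦ L_x η` of cochains on the negative cyclic complex. -/
def lieAction {i e e' : ℤ} (h : i + e = e') :
    cochains k A i →ₗ[k] negCyclic k A e →ₗ[k] negCyclic k A e' :=
  LinearMap.mk₂ k (fun x η => ⟨lieU x η.1, lieU_mem h x η.2⟩)
    (fun x y η => Subtype.ext <| by
      funext n j
      exact congrArg (fun f => f (η.1 _ j)) ((lieDerivative (n + (i + 1).toNat - 1) n).map_add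
        ⟨x.1, x.2.1⟩ ⟨y.1, y.2.1⟩))
    (fun c x η => Subtype.ext <| by
      funext n j
      exact congrArg (fun f => f (η.1 _ j)) ((lieDerivative (n + (i + 1).toNat - 1) n).map_smul c
        ⟨x.1, x.2.1⟩))
    (fun x η ζ => Subtype.ext ((lieU x).map_add η.1 ζ.1))
    (fun c x η => Subtype.ext ((lieU x).map_smul c η.1))

variable (k A)

/-- The sign `(-1)^n`. -/
def sgn (n : ℤ) : k := ((n.negOnePow : ℤ) : k)

/-- The degree `i` part of `Σ^{-d-1} CC^-(A)`. -/
abbrev ShiftedCyclic (d : ℕ) (i : ℤ) := negCyclic k A (i + (-d - 1))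

/-- The degree `i` part of the semi-direct product of the shifted normalized Hochschild cochain
complex with `Σ^{-d-1} CC^-(A)`. -/
abbrev DObj (d : ℕ) (i : ℤ) := cochains k A i × ShiftedCyclic k A d i

/-- The differential of `Σ^{-d-1} CC^-(A)`. -/
def shiftedD (d : ℕ) (i : ℤ) : ShiftedCyclic k A d i →ₗ[k] ShiftedCyclic k A d (i + 1) :=
  sgn k (-d - 1) • (cyclicD k A).restrict fun η hη => by
    have := cyclicD_mem k A _ η hη
    rwa [add_right_comm] at this

/-- The differential of the semi-direct product. -/
def sharpD (d : ℕ) (i : ℤ) : DObj k A d i →ₗ[k] DObj k A d (i + 1) :=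
  (cochainD k A i).prodMap (shiftedD k A d i)

variable {k A}

/-- The action of cochains on `Σ^{-d-1} CC^-(A)`, `L_x (s^r η) = (-1)^{r |x|} s^r L_x η`. -/
def shiftedLie (d : ℕ) {i j l : ℤ} (h : i + j = l) :
    cochains k A i →ₗ[k] ShiftedCyclic k A d j →ₗ[k] ShiftedCyclic k A d l :=
  sgn k ((-d - 1) * i) • lieAction (by omega)

/-- The Lie bracket of the semi-direct product,
`[(x, η), (y, ζ)] = ([x, y], x ζ - (-1)^{|y||η|} y η)`. -/
def sharpBracket (d : ℕ) {i j l : ℤ} (h : i + j = l) :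
    DObj k A d i →ₗ[k] DObj k A d j →ₗ[k] DObj k A d l :=
  LinearMap.mk₂ k
    (fun p q => (cochainBracket h p.1 q.1,
      shiftedLie d h p.1 q.2 - sgn k (j * i) • shiftedLie d (by omega) q.1 p.2))
    (fun p p' q => by ext1 <;> simp [smul_add]; abel)
    (fun c p q => by
      ext1
      · simp
      · simp only [Prod.smul_fst, Prod.smul_snd, map_smul, LinearMap.smul_apply, smul_sub,
          smul_comm _ c])
    (fun p q q' => by ext1 <;> simp [smul_add]; abel)
    (fun c p q => by
      ext1
      · simp
      · simp only [Prod.smul_fst, Prod.smul_snd, map_smul, LinearMap.smul_apply, smul_sub,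
          smul_comm _ c])

/-- The element `(0, s^{-d-1} η₀)` of degree one. -/
def twist {d : ℕ} (η₀ : negCyclic k A (-d)) : DObj k A d 1 :=
  (0, ⟨η₀.1, by
    intro n j h
    exact η₀.2 n j (fun h' => h (by rw [h']; ring))⟩)

/-- The differential of `𝔇(A, η₀)`: the differential of the semi-direct product twisted by the
bracket with `(0, s^{-d-1} η₀)`. -/
def twistedD {d : ℕ} (η₀ : negCyclic k A (-d)) (i : ℤ) :
    DObj k A d i →ₗ[k] DObj k A d (i + 1) :=
  sharpD k A d i + sharpBracket d (add_comm 1 i) (twist η₀)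

variable (k A)

/-- The normalized negative cyclic complex `CC^-(A)` with its differential `b + u B`. -/
def negCyclicComplex (h : ∀ i, negCyclicD k A (i + 1) ∘ₗ negCyclicD k A i = 0) :
    CochainComplex (ModuleCat.{max u v} k) ℤ :=
  CochainComplex.of (fun i => ModuleCat.of k (negCyclic k A i))
    (fun i => ModuleCat.ofHom (negCyclicD k A i))
    (fun i => by rw [← ModuleCat.ofHom_comp, h i]; rfl)

/-- Negative cyclic homology `HC^-_m(A)`. -/
abbrev HCneg (h : ∀ i, negCyclicD k A (i + 1) ∘ₗ negCyclicD k A i = 0) (m : ℤ) :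
    ModuleCat.{max u v} k :=
  (negCyclicComplex k A h).homology (-m)

variable {k A}

/-- The complex underlying the DG-Lie algebra `𝔇(A, η₀)`. -/
def twistedComplex {d : ℕ} (η₀ : negCyclic k A (-d))
    (h : ∀ i, twistedD η₀ (i + 1) ∘ₗ twistedD η₀ i = 0) :
    CochainComplex (ModuleCat.{max u v} k) ℤ :=
  CochainComplex.of (fun i => ModuleCat.of k (DObj k A d i))
    (fun i => ModuleCat.ofHom (twistedD η₀ i))
    (fun i => by rw [← ModuleCat.ofHom_comp, h i]; rfl)

/-- `Ψ (μ, s^{-d-1} η) = (-1)^{|μ| - 1} (i_μ + u S_μ)(s^{-d+1} η₀) + u s^{-d+1} η`, where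
`(i_μ + u S_μ)(s^r η₀) = (-1)^{r (|μ| + 1)} s^r (i_μ + u S_μ) η₀`. -/
def psi {d : ℕ} (η₀ : negCyclic k A (-d)) {i : ℤ} (y : DObj k A d i) : CycTotal k A :=
  sgn k (i - 1) • sgn k ((-d + 1) * (i + 1)) •
      (contractionU y.1 η₀.1 + mulU k A (sOperatorU y.1 η₀.1))
    + mulU k A y.2.1

/-- The value of the degree `i` component of a map `𝔇(A, η₀) → Σ^{-d+1} CC^-(A)`. -/
def componentAt {d : ℕ} {η₀ : negCyclic k A (-d)}
    {hD : ∀ i, twistedD η₀ (i + 1) ∘ₗ twistedD η₀ i = 0}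
    {hC : ∀ i, negCyclicD k A (i + 1) ∘ₗ negCyclicD k A i = 0}
    (Ψ : twistedComplex η₀ hD ⟶ (negCyclicComplex k A hC)⟦(-d + 1 : ℤ)⟧) (i : ℤ)
    (y : DObj k A d i) : negCyclic k A (i + (-d + 1)) :=
  (Ψ.f i).hom y

/-- The element of `𝔇(A, η₀)` underlying a cocycle. -/
def cocycleVal {d : ℕ} {η₀ : negCyclic k A (-d)}
    {hD : ∀ i, twistedD η₀ (i + 1) ∘ₗ twistedD η₀ i = 0} {i : ℤ}
    (z : (twistedComplex η₀ hD).cycles i) : DObj k A d i :=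
  ((twistedComplex η₀ hD).iCycles i).hom z

/-- The element of `CC^-(A)` underlying a cocycle. -/
def cyclicCocycleVal {hC : ∀ i, negCyclicD k A (i + 1) ∘ₗ negCyclicD k A i = 0} {i : ℤ}
    (w : (negCyclicComplex k A hC).cycles i) : negCyclic k A i :=
  ((negCyclicComplex k A hC).iCycles i).hom w

end NegativeCyclic

section CalabiYauAlgebras

variable (k : Type u) [Field k] (A : Type v) [Ring A] [Algebra k A]

/-- `A` has a finite resolution by finitely generated projective modules over
`A^e = A ⊗ A^op`. (Flatness over the field `k` is automatic.) -/
def HomologicallySmooth : Prop :=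
  letI : Module (A ⊗[k] Aᵐᵒᵖ) A := instModuleTensorProductMop k A
  ∃ P : ProjectiveResolution (ModuleCat.of (A ⊗[k] Aᵐᵒᵖ) A),
    (∀ n, Module.Finite (A ⊗[k] Aᵐᵒᵖ) (P.complex.X n)) ∧
    ∃ N : ℕ, ∀ n ≥ N, Limits.IsZero (P.complex.X n)

/-- Normalized Hochschild cochains with values in the bimodule `A ⊗ A`. By the normalized bar
resolution they form the complex `RHom_{A^e}(A, A^e)`. -/
abbrev BiCochain (n : ℕ) := MultilinearMap k (fun _ : Fin n => A) (A ⊗[k] A)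

/-- The Hochschild coboundary for the outer bimodule structure `a (x ⊗ y) b = a x ⊗ y b`. -/
def biD (n : ℕ) : BiCochain k A n →ₗ[k] BiCochain k A (n + 1) where
  toFun f :=
    actLeft (LinearMap.rTensorHom A ∘ₗ LinearMap.mul k A) f
      + ∑ i ∈ Finset.range n, (-1 : k) ^ (i + 1) • plug (n + 1) f (mulMap k A) 0 i
      + (-1 : k) ^ (n + 1) • actRight (LinearMap.lTensorHom A ∘ₗ (LinearMap.mul k A).flip) f
  map_add' f g := by
    ext a
    simp [add_plug, smul_add, Finset.sum_add_distrib, actLeft, actRight]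
    abel
  map_smul' c f := by
    ext a
    simp [smul_plug, smul_add, Finset.smul_sum, smul_comm c, actLeft, actRight]

/-- Cocycles among the normalized `A ⊗ A`-valued cochains. -/
def biCocycles (n : ℕ) : Submodule k (BiCochain k A n) :=
  normalized k A (A ⊗[k] A) n ⊓ LinearMap.ker (biD k A n)

/-- Coboundaries of normalized `A ⊗ A`-valued cochains. -/
def biCoboundaries : (n : ℕ) → Submodule k (BiCochain k A n)
  | 0 => ⊥
  | n + 1 => (normalized k A (A ⊗[k] A) n).map (biD k A n)

/-- `a ↦ (x ⊗ y ↦ y a x)`, the isomorphism `A ⊗_{A^e} A^e ≅ A`. -/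
def innerContract : A →ₗ[k] (A ⊗[k] A) →ₗ[k] A where
  toFun a := TensorProduct.lift (LinearMap.mk₂ k (fun x y => y * a * x)
    (fun _ _ _ => by simp [mul_add]) (fun _ _ _ => by simp)
    (fun _ _ _ => by simp [add_mul]) (fun _ _ _ => by simp))
  map_add' a b := by ext x y; simp [mul_add, add_mul]
  map_smul' c a := by ext x y; simp

variable {k A}

/-- The evaluation `a_0 ⊗ ⋯ ⊗ a_n ↦ y a_0 x`, `x ⊗ y = f (a_1, …, a_n)`, of a normalized
`A ⊗ A`-valued cochain on chains. -/
def evalChain {n : ℕ} (f : normalized k A (A ⊗[k] A) n) : Chain k A n →ₗ[k] A :=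
  chainLift (actLeft (innerContract k A) f.1) fun a l h0 hl => actLeft_vanish _ f.2 a l h0 hl

/-- A Hochschild cycle `η` of degree `d` is non-degenerate if the morphism
`RHom_{A^e}(A, A^e) → Σ^{-d} A` in `D(A^e)` that corresponds to it under
`HH_d(A) ≅ Hom(Σ^d RHom_{A^e}(A, A^e), A)` is an isomorphism. With `RHom_{A^e}(A, A^e)` computed
by normalized cochains, this morphism is `f ↦ evalChain f η` in degree `d`; it has to be bijective
on cohomology. -/
structure IsNondegenerate {d : ℕ} (η : Chain k A d) : Prop where
  acyclic : ∀ n, n ≠ d → biCocycles k A n ≤ biCoboundaries k A n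
  injective : ∀ (f : BiCochain k A d) (hf : f ∈ biCocycles k A d),
    evalChain ⟨f, hf.1⟩ η = 0 → f ∈ biCoboundaries k A d
  surjective : ∀ a : A, ∃ (f : BiCochain k A d) (hf : f ∈ biCocycles k A d),
    evalChain ⟨f, hf.1⟩ η = a

/-- `(A, η₀)` is a `d`-Calabi-Yau algebra, where `η₀` is a cycle of degree `d` in the normalized
negative cyclic complex that represents the Calabi-Yau structure. -/
structure IsCalabiYau {d : ℕ} (η₀ : negCyclic k A (-d)) : Prop where
  smooth : HomologicallySmooth k A
  cycle : negCyclicD k A (-d) η₀ = 0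
  nondegenerate : IsNondegenerate (η₀.1 d 0)

end CalabiYauAlgebras

section MaurerCartan

variable {k : Type u} [Field k] {A : Type v} [Ring A] [Algebra k A]
variable (R : Type*) [CommRing R] [IsLocalRing R] [Algebra k R]

variable (k) in
/-- The maximal ideal of `R` as a vector space. -/
abbrev maxIdeal : Submodule k R := (IsLocalRing.maximalIdeal R).restrictScalars k

variable (k) in
/-- The multiplication of the maximal ideal. -/
def maxIdealMul : maxIdeal k R →ₗ[k] maxIdeal k R →ₗ[k] maxIdeal k R :=
  LinearMap.mk₂ k (fun a b => ⟨a.1 * b.1, Ideal.mul_mem_left _ _ b.2⟩)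
    (fun _ _ _ => Subtype.ext (by simp [add_mul])) (fun _ _ _ => Subtype.ext (by simp))
    (fun _ _ _ => Subtype.ext (by simp [mul_add])) (fun _ _ _ => Subtype.ext (by simp))

/-- The differential of `𝔇(A, η₀) ⊗ m`. -/
def twistedDTensor {d : ℕ} (η₀ : negCyclic k A (-d)) (i : ℤ) :
    DObj k A d i ⊗[k] maxIdeal k R →ₗ[k] DObj k A d (i + 1) ⊗[k] maxIdeal k R :=
  (twistedD η₀ i).rTensor _

/-- The Lie bracket of `𝔇(A, η₀) ⊗ m`. -/
def bracketTensor (d : ℕ) {i j l : ℤ} (h : i + j = l) :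
    DObj k A d i ⊗[k] maxIdeal k R →ₗ[k] DObj k A d j ⊗[k] maxIdeal k R →ₗ[k]
      DObj k A d l ⊗[k] maxIdeal k R :=
  TensorProduct.map₂ (sharpBracket d h) (maxIdealMul k R)

/-- Solutions in `𝔇(A, η₀) ⊗ m` of the Maurer-Cartan equation `d y + [y, y] / 2 = 0`. -/
def MaurerCartan {d : ℕ} (η₀ : negCyclic k A (-d)) : Type _ :=
  {y : DObj k A d 1 ⊗[k] maxIdeal k R //
    twistedDTensor R η₀ 1 y + (2 : k)⁻¹ • bracketTensor R d rfl y y = 0}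

/-- The gauge action `exp(x) * y = ∑ (ad x)^n y / n! - ∑ (ad x)^n (d x) / (n + 1)!`. If `R` is a
finite dimensional local algebra then `m^n = 0` for `n ≥ dim R`, so that the remaining terms
vanish. -/
def gauge {d : ℕ} (η₀ : negCyclic k A (-d)) (x : DObj k A d 0 ⊗[k] maxIdeal k R)
    (y : DObj k A d 1 ⊗[k] maxIdeal k R) : DObj k A d 1 ⊗[k] maxIdeal k R :=
  ∑ n ∈ Finset.range (Module.finrank k R),
      (n.factorial : k)⁻¹ • ((bracketTensor R d (zero_add 1) x) ^ n) y
    - ∑ n ∈ Finset.range (Module.finrank k R),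
      ((n + 1).factorial : k)⁻¹ • ((bracketTensor R d (zero_add 1) x) ^ n)
        (twistedDTensor R η₀ 0 x)

/-- Gauge equivalence classes of solutions of the Maurer-Cartan equation in `𝔇(A, η₀) ⊗ m`. -/
def MCClasses {d : ℕ} (η₀ : negCyclic k A (-d)) : Type _ :=
  Quot fun y y' : MaurerCartan R η₀ => ∃ x, y'.1 = gauge R η₀ x y.1

/-- The tangent space of the deformation functor `R ↦ MC(𝔇(A, η₀) ⊗ m)`: its value on the
dual numbers. -/
abbrev TangentSpace {d : ℕ} (η₀ : negCyclic k A (-d)) := MCClasses k[ε] η₀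

variable (k) in
/-- `ε` as an element of the maximal ideal of the dual numbers. -/
def epsMax : maxIdeal k k[ε] :=
  ⟨DualNumber.eps, by
    change DualNumber.eps ∈ IsLocalRing.maximalIdeal k[ε]
    rw [DualNumber.maximalIdeal_eq_span_singleton_eps]
    exact Ideal.mem_span_singleton_self _⟩

end MaurerCartan

end CalabiYau

end

open CalabiYau

/-! On the subcomplex of pairs `(0, η)` the map `Ψ` is multiplication by `u`, an isomorphism onto `u
CC^-`. On the quotients, the Hochschild cochains and the Hochschild chains `CC^- / u CC^-`, it
becomes up to sign the contraction `μ ↦ i_μ π(η₀)`. So two things are needed: `Ψ` commutes with the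
differentials, and contraction with `π(η₀)` is a quasi-isomorphism. The comparison of the two short
exact sequences is then carried out on elements (`exists_cartanU_lift`, `exists_twistedD_eq`,
`exists_psi_eq`).

Compatibility with the differentials is the Cartan formula `[b + uB, i_x + uS_x] = uL_x - (i_{dx} +
uS_{dx})` (`cyclicD_cartanU`): applied to the cycle `η₀`, its term `u L_x η₀` is what the twist of
the differential contributes. Since `Ψ(0, η) = uη` is injective in `η`, the same formula gives that
the twisted differential squares to zero (`twistedD_twistedD`), with no appeal to the Jacobi
identity or to the axioms of a Lie action. The Cartan formula splits into `[b, i_x] = -i_{dx}`, the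
vanishing of `B S_x` and `S_x B`, and `[b, S_x] + [B, i_x] = L_x - S_{dx}` (`cartan_homotopy`). The
last identity is proved for operators on formal combinations of sequences. Let `T` be the signed
rotation, `N` the sum of its powers, `S` the prefixing of `1`, `b` the sum of all signed faces and
`b'` the sum without the cyclic face. Then `b' N = N b`, `b S = 1 - T - S b'`, `B = S N`, and `S_x =
S M`, where `M` inserts `x` and rotates. The product `(1 - T) M` telescopes to `L_x` minus a term `±
i_x B`, and `b' M` splits into parts giving `B i_x`, `S_{dx}` and `± S_x b`.

The duality statement is proved for the cap product with coefficients in a varying bimodule, as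
acyclicity of a cone (`CapAcyclic`). For `A ⊗ A` the chains form the bar resolution of `A`, and
acyclicity is non-degeneracy (`IsNondegenerate.capAcyclic`). It passes to direct summands of finite
sums and to the last term of a short exact sequence, hence along a finite resolution by finitely
generated projectives to `A` itself (`HomologicallySmooth.capAcyclic`).

Over the dual numbers all brackets vanish, so Maurer-Cartan elements are `1`-cocycles and gauge
equivalence is being cohomologous. -/

open scoped TensorProduct DualNumber
open CategoryTheory

noncomputable section

namespace CalabiYau

universe u v

/-! ### Insertions and rotations of infinite sequences, which stand for words whose length is a
separate parameter. -/

section Words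

variable {k : Type u} [Field k] {A : Type v} [Ring A] [Algebra k A]

set_option linter.unusedSectionVars false

/-- Replace the entries `w_q, …, w_{q+p-1}` of a sequence by the single entry
`x (w_q, …, w_{q+p-1})`. -/
def ins {p : ℕ} (x : Cochain k A p) (q : ℕ) (w : ℕ → A) : ℕ → A := fun j =>
  if j < q then w j else if j = q then x (fun t => w (q + t)) else w (j - 1 + p)

/-- Move the entry `w_{m-1}` of a sequence to the front. -/
def rot (m : ℕ) (w : ℕ → A) : ℕ → A := fun j =>
  if j = 0 then w (m - 1) else if j < m then w (j - 1) else w j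

/-- Move the entries `w_{m-r}, …, w_{m-1}` of a sequence to the front. -/
def rotBy (m r : ℕ) (w : ℕ → A) : ℕ → A := fun j =>
  if j < r then w (m - r + j) else if j < m then w (j - r) else w j

/-- Put `1` in front of a sequence. -/
def consOne (w : ℕ → A) : ℕ → A := fun j => if j = 0 then 1 else w (j - 1)

lemma rot_iterate (m r : ℕ) (hr : r ≤ m) : (rot (A := A) m)^[r] = rotBy m r := by
  induction r with
  | zero => funext w j; simp [rotBy]
  | succ r ih =>
    rw [Function.iterate_succ', ih (by omega)]
    funext w j
    simp only [Function.comp, rot, rotBy]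
    split_ifs <;> first | omega | exact congrArg w (by omega)

lemma ins_apply_lt {p : ℕ} (x : Cochain k A p) {q j : ℕ} (w : ℕ → A) (h : j < q) :
    ins x q w j = w j := by simp [ins, h]

lemma ins_apply_self {p : ℕ} (x : Cochain k A p) (q : ℕ) (w : ℕ → A) :
    ins x q w q = x (fun t => w (q + t)) := by simp [ins]

lemma ins_apply_gt {p : ℕ} (x : Cochain k A p) {q j : ℕ} (w : ℕ → A) (h : q < j) :
    ins x q w j = w (j - 1 + p) := by
  have h1 : ¬ j < q := by omega
  have h2 : ¬ j = q := by omega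
  simp [ins, h1, h2]

/-- `N` and `m` are the lengths before and after the insertion. The condition `q + r < m` says that
the `r` rotated letters all stand behind `x (…)`, so the two operations act on disjoint blocks. -/
lemma ins_rotBy {p : ℕ} (x : Cochain k A p) {q r N m : ℕ} (hN : N + 1 = m + p)
    (hq : q + r < m) : ins x (q + r) ∘ rotBy N r = rotBy m r ∘ ins x q := by
  funext w j
  simp only [Function.comp]
  rcases lt_trichotomy j (q + r) with h | h | h
  · rw [ins_apply_lt _ _ h]
    simp only [rotBy]
    by_cases h1 : j < r
    · rw [if_pos h1, if_pos h1, ins_apply_gt _ _ (by omega)]; congr 1; omega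
    · rw [if_neg h1, if_neg h1, if_pos (by omega), if_pos (by omega), ins_apply_lt _ _ (by omega)]
  · subst h
    rw [ins_apply_self]
    simp only [rotBy]
    rw [if_neg (by omega), if_pos (by omega), Nat.add_sub_cancel, ins_apply_self]
    congr 1
    funext t
    have := t.isLt
    rw [if_neg (by omega), if_pos (by omega)]; congr 1; omega
  · rw [ins_apply_gt _ _ h]
    simp only [rotBy]
    by_cases h1 : j < m
    · rw [if_neg (by omega), if_pos (by omega), if_neg (by omega), if_pos h1,
        ins_apply_gt _ _ (by omega)]
      congr 1; omega
    · rw [if_neg (by omega), if_neg (by omega), if_neg (by omega), if_neg (by omega),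
        ins_apply_gt _ _ (by omega)]

lemma rot_eq_rotBy (m : ℕ) : rot (A := A) m = rotBy m 1 := by
  funext w j
  simp only [rot, rotBy]
  split_ifs <;> first | omega | exact congrArg w (by omega)

lemma ins_rot {p : ℕ} (x : Cochain k A p) {q N m : ℕ} (hN : N + 1 = m + p)
    (hq : q + 1 < m) : ins x (q + 1) ∘ rot N = rot m ∘ ins x q := by
  rw [rot_eq_rotBy, rot_eq_rotBy]; exact ins_rotBy x hN hq

/-- Rotating the entry `x (…)` to the front. -/
lemma rotBy_ins {p : ℕ} (x : Cochain k A p) {q N m : ℕ} (hN : N + 1 = m + p) (hq : q < m) :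
    rotBy m (m - q) ∘ ins x q = ins x 0 ∘ rotBy N (N - q) := by
  funext w j
  simp only [Function.comp]
  rcases Nat.eq_zero_or_pos j with h | h
  · subst h
    rw [ins_apply_self]
    simp only [rotBy]
    rw [if_pos (by omega), show m - (m - q) + 0 = q by omega, ins_apply_self]
    congr 1
    funext t
    have := t.isLt
    rw [if_pos (by omega)]; congr 1; omega
  · rw [ins_apply_gt _ _ h]
    simp only [rotBy]
    by_cases h1 : j < m - q
    · rw [if_pos h1, if_pos (by omega), ins_apply_gt _ _ (by omega)]; congr 1; omega
    · have h3 : ¬ j - 1 + p < N - q := by omega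
      rw [if_neg h1, if_neg h3]
      by_cases h2 : j < m
      · rw [if_pos h2, if_pos (by omega), ins_apply_lt _ _ (by omega)]; congr 1; omega
      · rw [if_neg h2, if_neg (by omega), ins_apply_gt _ _ (by omega)]

/-- Disjoint insertions commute. -/
lemma ins_ins {p p' : ℕ} (x : Cochain k A p) (y : Cochain k A p') {c q : ℕ}
    (h : c + p' ≤ q) :
    ins y c ∘ ins x q = ins x (q + 1 - p') ∘ ins y c := by
  funext w j
  simp only [Function.comp]
  rcases lt_trichotomy j c with h1 | h1 | h1
  · rw [ins_apply_lt _ _ h1, ins_apply_lt _ _ (by omega), ins_apply_lt _ _ (by omega),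
      ins_apply_lt _ _ h1]
  · subst h1
    rw [ins_apply_self, ins_apply_lt _ _ (by omega), ins_apply_self]
    congr 1
    funext t
    have := t.isLt
    rw [ins_apply_lt _ _ (by omega)]
  · rw [ins_apply_gt _ _ h1]
    rcases lt_trichotomy j (q + 1 - p') with h2 | h2 | h2
    · rw [ins_apply_lt _ _ (by omega), ins_apply_lt _ _ h2, ins_apply_gt _ _ h1]
    · subst h2
      rw [ins_apply_self, show q + 1 - p' - 1 + p' = q by omega, ins_apply_self]
      congr 1
      funext t
      rw [ins_apply_gt _ _ (by omega)]; congr 1; omega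
    · rw [ins_apply_gt _ _ (by omega), ins_apply_gt _ _ h2, ins_apply_gt _ _ (by omega)]
      congr 1; omega

/-- Multiplying by a prefixed `1` removes it. Together with `ins_mul_rot_consOne`, where the cyclic
face absorbs the `1`, this produces the summands `1` and `T` of `b S`. -/
lemma ins_mul_consOne_zero : ins (mulMap k A) 0 ∘ consOne = id := by
  funext w j
  simp only [Function.comp, id]
  rcases Nat.eq_zero_or_pos j with h | h
  · subst h
    rw [ins_apply_self]
    simp [mulMap, consOne, List.ofFn_succ]
  · rw [ins_apply_gt _ _ h]
    simp only [consOne]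
    rw [if_neg (by omega)]; congr 1; omega

lemma ins_consOne {p : ℕ} (x : Cochain k A p) (c : ℕ) :
    ins x (c + 1) ∘ consOne = consOne ∘ ins x c := by
  funext w j
  simp only [Function.comp]
  rcases lt_trichotomy j (c + 1) with h | h | h
  · rw [ins_apply_lt _ _ h]
    simp only [consOne]
    split_ifs
    · rfl
    · rw [ins_apply_lt _ _ (by omega)]
  · subst h
    rw [ins_apply_self]
    simp only [consOne]
    rw [if_neg (by omega), Nat.add_sub_cancel, ins_apply_self]
    congr 1
    funext t
    rw [if_neg (by omega)]; congr 1; omega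
  · rw [ins_apply_gt _ _ h]
    simp only [consOne]
    rw [if_neg (by omega), if_neg (by omega), ins_apply_gt _ _ (by omega)]; congr 1; omega

lemma ins_mul_rot_consOne (m : ℕ) (hm : 0 < m) :
    ins (mulMap k A) 0 ∘ rot (m + 1) ∘ consOne = rot m := by
  funext w j
  simp only [Function.comp]
  rcases Nat.eq_zero_or_pos j with h | h
  · subst h
    rw [ins_apply_self]
    simp [mulMap, consOne, rot, List.ofFn_succ, hm.ne']
  · rw [ins_apply_gt _ _ h]
    obtain ⟨j, rfl⟩ := Nat.exists_eq_succ_of_ne_zero h.ne'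
    simp only [consOne, rot, Nat.succ_eq_add_one, Nat.add_sub_cancel]
    by_cases h1 : j + 1 < m
    · simp [h1]; omega
    · simp [h1]; omega

end Words

/-! ### Rotations, faces and the prefix operator: the cyclic identities behind `b` and `B`. -/

section WordOperators

variable (k : Type u) [Field k] (A : Type v) [Ring A] [Algebra k A]

set_option linter.unusedSectionVars false

/-- Formal linear combinations of sequences. -/
def Words : Type (max u v) := (ℕ → A) →₀ k

instance : AddCommGroup (Words k A) := inferInstanceAs (AddCommGroup ((ℕ → A) →₀ k))

instance : Module k (Words k A) := inferInstanceAs (Module k ((ℕ → A) →₀ k))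

variable {A}

/-- A sequence as a word. -/
def word (w : ℕ → A) : Words k A := (Finsupp.single w 1 : (ℕ → A) →₀ k)

variable {k} in
/-- The linear extension of a map on sequences. -/
def wordLift {E : Type*} [AddCommGroup E] [Module k E] (φ : (ℕ → A) → E) : Words k A →ₗ[k] E :=
  (Finsupp.linearCombination k φ : ((ℕ → A) →₀ k) →ₗ[k] E)

lemma wordLift_word {E : Type*} [AddCommGroup E] [Module k E] (φ : (ℕ → A) → E) (w : ℕ → A) :
    wordLift φ (word k w) = φ w := by
  refine (Finsupp.linearCombination_single k 1 w).trans ?_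
  rw [one_smul]

variable {k} in
lemma words_hom_ext {E : Type*} [AddCommGroup E] [Module k E] {f g : Words k A →ₗ[k] E}
    (h : ∀ w, f (word k w) = g (word k w)) : f = g :=
  Finsupp.lhom_ext' fun w => LinearMap.ext_ring (h w)

/-- The linear operator on words induced by a map of sequences. -/
def wordMap (f : (ℕ → A) → (ℕ → A)) : Module.End k (Words k A) := wordLift fun w => word k (f w)

lemma wordMap_word (f : (ℕ → A) → (ℕ → A)) (w : ℕ → A) :
    wordMap k f (word k w) = word k (f w) := wordLift_word k _ w

lemma wordMap_comp (f g : (ℕ → A) → (ℕ → A)) :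
    wordMap k (f ∘ g) = wordMap k f * wordMap k g :=
  words_hom_ext fun w => by simp [wordMap_word]

lemma wordMap_id : wordMap k (id : (ℕ → A) → (ℕ → A)) = 1 :=
  words_hom_ext fun w => by simp [wordMap_word]

variable (A)

/-- The signed cyclic rotation of words of length `m`. -/
def wordT (m : ℕ) : Module.End k (Words k A) := (-1 : k) ^ (m + 1) • wordMap k (rot m)

/-- The signed faces of words of length `m`: multiply the entries in places `c`, `c + 1`
if `c + 1 < m`, and multiply the last entry and the first one otherwise. -/
def wordE (m c : ℕ) : Module.End k (Words k A) :=
  if c + 1 < m then (-1 : k) ^ c • wordMap k (ins (mulMap k A) c)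
  else (-1 : k) ^ (m + 1) • wordMap k (ins (mulMap k A) 0 ∘ rot m)

/-- Put `1` in front. -/
def wordS : Module.End k (Words k A) := wordMap k consOne

variable {k A}

/-- Comparisons of signs reduce through this to parities of exponents, which are decided
mechanically. -/
lemma neg_one_pow_congr {R : Type*} [Ring R] {a b : ℕ} (h : Even a ↔ Even b) :
    (-1 : R) ^ a = (-1) ^ b := by
  rcases Nat.even_or_odd a with ha | ha
  · rw [ha.neg_one_pow, (h.mp ha).neg_one_pow]
  · have hb : Odd b := by
      rw [← Nat.not_even_iff_odd] at ha ⊢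
      exact fun hb => ha (h.mpr hb)
    rw [ha.neg_one_pow, hb.neg_one_pow]

lemma wordE_of_lt {m c : ℕ} (h : c + 1 < m) :
    wordE k A m c = (-1 : k) ^ c • wordMap k (ins (mulMap k A) c) := if_pos h

lemma wordE_last {m c : ℕ} (h : m ≤ c + 1) :
    wordE k A m c = (-1 : k) ^ (m + 1) • wordMap k (ins (mulMap k A) 0 ∘ rot m) :=
  if_neg (by omega)

lemma wordT_pow (m r : ℕ) (hr : r ≤ m) :
    wordT k A m ^ r = (-1 : k) ^ ((m + 1) * r) • wordMap k (rotBy m r) := by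
  rw [wordT, smul_pow, ← pow_mul, ← rot_iterate m r hr]
  congr 1
  clear hr
  induction r with
  | zero => simp [← wordMap_id]
  | succ r ih => rw [pow_succ, ih, Function.iterate_succ, wordMap_comp]

lemma wordT_pow_self (m : ℕ) : wordT k A m ^ m = 1 := by
  rw [wordT_pow m m le_rfl, ← wordMap_id]
  have : Even ((m + 1) * m) := by rw [mul_comm]; exact Nat.even_mul_succ_self m
  rw [this.neg_one_pow, one_smul]
  congr 1
  funext w j
  simp only [rotBy, id]
  split_ifs <;> first | omega | exact congrArg w (by omega)

lemma wordE_zero_mul_wordT {m : ℕ} (hm : 2 ≤ m) :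
    wordE k A m 0 * wordT k A m = wordE k A m (m - 1) := by
  rw [wordE_of_lt (by omega), wordE_last (by omega), wordT, wordMap_comp]
  simp

/-- A rotation shifts all letters by one place, so a face after it is the preceding face before it,
on a word one letter shorter. -/
lemma wordE_succ_mul_wordT {m c : ℕ} (hc : c + 1 < m) :
    wordE k A m (c + 1) * wordT k A m = wordT k A (m - 1) * wordE k A m c := by
  rw [wordE_of_lt hc]
  by_cases h : c + 1 + 1 < m
  · rw [wordE_of_lt h, wordT, wordT, smul_mul_smul_comm, smul_mul_smul_comm, ← wordMap_comp,
      ← wordMap_comp, ins_rot _ (m := m - 1) (by omega) (by omega)]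
    congr 1
    rw [← pow_add, ← pow_add]
    apply neg_one_pow_congr
    rw [show c + 1 + (m + 1) = (m - 1 + 1 + c) + 2 by omega]
    simp [parity_simps]
  -- Here the left face is the cyclic one. Both sides move the last two letters to the front and
  -- multiply them.
  · obtain rfl : m = c + 2 := by omega
    rw [wordE_last (by omega), wordT, wordT, smul_mul_smul_comm, smul_mul_smul_comm,
      ← wordMap_comp, ← wordMap_comp]
    congr 1
    · rw [← pow_add, ← pow_add]
      apply neg_one_pow_congr
      simp [parity_simps]
    · congr 1
      have h1 := rotBy_ins (mulMap k A) (q := c) (N := c + 2) (m := c + 1) (by omega) (by omega)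
      rw [show c + 1 - c = 1 by omega, show c + 2 - c = 2 by omega, ← rot_eq_rotBy] at h1
      rw [show c + 2 - 1 = c + 1 by omega, h1, ← rot_iterate _ _ (by omega)]
      rfl

lemma wordE_mul_wordT_pow_of_le {m c r : ℕ} (hr : r ≤ c) (hc : c < m) :
    wordE k A m c * wordT k A m ^ r = wordT k A (m - 1) ^ r * wordE k A m (c - r) := by
  induction r generalizing c with
  | zero => simp
  | succ r ih =>
    obtain ⟨c, rfl⟩ : ∃ c', c = c' + 1 := ⟨c - 1, by omega⟩
    rw [pow_succ', ← mul_assoc, wordE_succ_mul_wordT hc, mul_assoc, ih (by omega) (by omega),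
      ← mul_assoc, ← pow_succ', Nat.add_sub_add_right]

/-- After `c` rotations the face has become face `0`. The next rotation turns it into the cyclic
face and is absorbed, which lowers the exponent by one; the remaining rotations pass as before. -/
lemma wordE_mul_wordT_pow_of_lt {m c r : ℕ} (hm : 2 ≤ m) (hr : c < r) (hrm : r ≤ m) :
    wordE k A m c * wordT k A m ^ r = wordT k A (m - 1) ^ (r - 1) * wordE k A m (m - r + c) := by
  obtain ⟨s, rfl⟩ : ∃ s, r = c + (1 + s) := ⟨r - c - 1, by omega⟩
  rw [pow_add, ← mul_assoc, wordE_mul_wordT_pow_of_le le_rfl (by omega), Nat.sub_self, pow_add,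
    pow_one, mul_assoc, ← mul_assoc _ (wordT k A m), wordE_zero_mul_wordT hm,
    wordE_mul_wordT_pow_of_le (by omega) (by omega), ← mul_assoc, ← pow_add,
    show c + (1 + s) - 1 = c + s by omega, show m - 1 - s = m - (c + (1 + s)) + c by omega]

/-- The sum of the faces that do not involve the cyclic structure, applied to the sum of the
first rotations. -/
lemma sum_wordE_mul_sum_wordT {m : ℕ} (hm : 2 ≤ m) {R : ℕ} (hR : R < m) :
    (∑ c ∈ Finset.range (m - 1), wordE k A m c) * ∑ r ∈ Finset.range (R + 1), wordT k A m ^ r =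
      (∑ r ∈ Finset.range R, wordT k A (m - 1) ^ r) * ∑ c ∈ Finset.range m, wordE k A m c
      + wordT k A (m - 1) ^ R * ∑ c ∈ Finset.range (m - 1 - R), wordE k A m c := by
  induction R with
  | zero => simp
  | succ R ih =>
    rw [Finset.sum_range_succ, mul_add, ih (by omega), Finset.sum_range_succ _ R, add_mul]
    -- The faces `c ≤ R` wrap around and lose one rotation, becoming the faces from `m - 1 - R` on;
    -- the faces `c > R` pass all `R + 1` rotations.
    have h1 : (∑ c ∈ Finset.range (m - 1), wordE k A m c) * wordT k A m ^ (R + 1) =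
        wordT k A (m - 1) ^ R * ∑ c ∈ Finset.Ico (m - 1 - R) m, wordE k A m c
        + wordT k A (m - 1) ^ (R + 1) *
          ∑ c ∈ Finset.range (m - 1 - (R + 1)), wordE k A m c := by
      rw [← Finset.sum_range_add_sum_Ico _ (show R + 1 ≤ m - 1 by omega), add_mul, Finset.sum_mul,
        Finset.sum_mul, Finset.mul_sum, Finset.mul_sum]
      congr 1
      · rw [Finset.sum_Ico_eq_sum_range, show m - (m - 1 - R) = R + 1 by omega]
        refine Finset.sum_congr rfl fun c hc => ?_
        rw [Finset.mem_range] at hc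
        rw [wordE_mul_wordT_pow_of_lt hm hc (by omega), Nat.add_sub_cancel,
          show m - (R + 1) = m - 1 - R by omega]
      · rw [Finset.sum_Ico_eq_sum_range]
        refine Finset.sum_congr rfl fun c hc => ?_
        rw [Finset.mem_range] at hc
        rw [wordE_mul_wordT_pow_of_le (by omega) (by omega), Nat.add_sub_cancel_left]
    have h2 : ∑ c ∈ Finset.range m, wordE k A m c =
        ∑ c ∈ Finset.range (m - 1 - R), wordE k A m c
          + ∑ c ∈ Finset.Ico (m - 1 - R) m, wordE k A m c :=
      (Finset.sum_range_add_sum_Ico _ (by omega)).symm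
    rw [h1, h2]
    noncomm_ring

/-- The relation `b S = 1 - T - S b'`. The first face deletes the prefixed `1`, the cyclic face
multiplies the last letter into it and so rotates, and the inner faces commute with the prefix up to
the sign from the shift by one place. -/
lemma sum_wordE_mul_wordS {m : ℕ} (hm : 0 < m) :
    (∑ c ∈ Finset.range (m + 1), wordE k A (m + 1) c) * wordS k A =
      1 - wordT k A m - wordS k A * ∑ c ∈ Finset.range (m - 1), wordE k A m c := by
  have h0 : wordE k A (m + 1) 0 * wordS k A = 1 := by
    rw [wordE_of_lt (by omega), wordS, pow_zero, one_smul, ← wordMap_comp, ins_mul_consOne_zero,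
      wordMap_id]
  have h1 : wordE k A (m + 1) m * wordS k A = - wordT k A m := by
    rw [wordE_last (by omega), wordS, smul_mul_assoc, ← wordMap_comp, Function.comp_assoc,
      ins_mul_rot_consOne m hm, wordT, pow_succ]
    simp
  have h2 : ∀ c ∈ Finset.range (m - 1), wordE k A (m + 1) (c + 1) * wordS k A =
      -(wordS k A * wordE k A m c) := by
    intro c hc
    rw [Finset.mem_range] at hc
    rw [wordE_of_lt (by omega), wordE_of_lt (by omega), wordS, smul_mul_assoc, mul_smul_comm,
      ← wordMap_comp, ← wordMap_comp, ins_consOne, pow_succ]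
    simp
  obtain ⟨n, rfl⟩ : ∃ n, m = n + 1 := ⟨m - 1, by omega⟩
  rw [Finset.sum_range_succ, Finset.sum_range_succ', add_mul, add_mul, h0, h1, Finset.sum_mul]
  rw [Nat.add_sub_cancel] at h2 ⊢
  rw [Finset.sum_congr rfl h2, Finset.sum_neg_distrib, ← Finset.mul_sum]
  abel

lemma one_sub_wordT_mul_sum (m : ℕ) (R : ℕ) :
    (1 - wordT k A m) * ∑ r ∈ Finset.range R, wordT k A m ^ r = 1 - wordT k A m ^ R :=
  mul_neg_geom_sum _ _

end WordOperators

/-! ### Insertion of a cochain into words, and its commutation with rotations and faces. -/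

section InsertionOperators

variable {k : Type u} [Field k] {A : Type v} [Ring A] [Algebra k A]

/-- The signed insertion of `x` in place `q ≥ 1`. -/
def wordIns {p : ℕ} (x : Cochain k A p) (q : ℕ) : Module.End k (Words k A) :=
  (-1 : k) ^ ((p + 1) * (q + 1)) • wordMap k (ins x q)

/-- Insert `x` in all places `1 ≤ q < m`, to get words of length `m`, and apply all rotations that
leave the entry `x (…)` behind the entry that was in front. -/
def wordM {p : ℕ} (x : Cochain k A p) (m : ℕ) : Module.End k (Words k A) :=
  ∑ q ∈ Finset.Ico 1 m, (∑ r ∈ Finset.range (m - q), wordT k A m ^ r) * wordIns x q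

/-- Rotating `m - q` letters brings the entry `x (…)` to the front. The same word arises by first
rotating the arguments of `x` to the front, `N - q` letters of the input, and then inserting at
place `0`. -/
lemma wordT_pow_mul_wordIns {p : ℕ} (x : Cochain k A p) {q m N : ℕ} (hN : N + 1 = m + p)
    (hq : q < m) (hq' : 1 ≤ q) :
    wordT k A m ^ (m - q) * wordIns x q =
      (-1 : k) ^ (p + 1) • (wordMap k (ins x 0) * wordT k A N ^ (N - q)) := by
  rw [wordT_pow _ _ (by omega), wordT_pow _ _ (by omega), wordIns, smul_mul_smul_comm,
    mul_smul_comm, ← wordMap_comp, ← wordMap_comp, rotBy_ins x hN hq, smul_smul, ← pow_add,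
    ← pow_add]
  congr 1
  apply neg_one_pow_congr
  obtain ⟨s, rfl⟩ : ∃ s, m = q + s := ⟨m - q, by omega⟩
  obtain rfl : N = q + s + p - 1 := by omega
  obtain ⟨q, rfl⟩ : ∃ t, q = t + 1 := ⟨q - 1, by omega⟩
  rw [show q + 1 + s - (q + 1) = s by omega, show q + 1 + s + p - 1 + 1 = q + 1 + s + p by omega,
    show q + 1 + s + p - 1 - (q + 1) = s + p - 1 by omega]
  obtain ⟨s, rfl⟩ : ∃ t, s = t + 1 := ⟨s - 1, by omega⟩
  rw [show s + 1 + p - 1 = s + p by omega]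
  simp only [parity_simps]
  tauto

/-- For each place `q` the sum of rotations in `M` telescopes to `1 - T ^ (m - q)`. The ends have `x
(…)` in front; they cancel against the terms of `i_x B`, all but those with fewer than `p`
rotations. What is left is `L_x`, the last sum being its terms with `a_0` among the arguments of
`x`. -/
lemma one_sub_wordT_mul_wordM {p : ℕ} (x : Cochain k A p) {m N : ℕ} (hN : N + 1 = m + p)
    (hm : 0 < m) :
    (1 - wordT k A m) * wordM x m
      + (-1 : k) ^ (p + 1) • (wordMap k (ins x 0) * ∑ r ∈ Finset.range N, wordT k A N ^ r) =
    ∑ q ∈ Finset.Ico 1 m, wordIns x q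
      + (-1 : k) ^ (p + 1) • (wordMap k (ins x 0) * ∑ r ∈ Finset.range p, wordT k A N ^ r) := by
  have h1 : (1 - wordT k A m) * wordM x m = ∑ q ∈ Finset.Ico 1 m, wordIns x q
      - (-1 : k) ^ (p + 1) •
        (wordMap k (ins x 0) * ∑ q ∈ Finset.Ico 1 m, wordT k A N ^ (N - q)) := by
    rw [wordM, Finset.mul_sum, Finset.mul_sum, Finset.smul_sum, ← Finset.sum_sub_distrib]
    refine Finset.sum_congr rfl fun q hq => ?_
    rw [Finset.mem_Ico] at hq
    rw [← mul_assoc, one_sub_wordT_mul_sum, sub_mul, one_mul,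
      wordT_pow_mul_wordIns x hN hq.2 hq.1]
  -- As `N + 1 = m + p`, the exponents `N - q` for `1 ≤ q < m` run through `p ≤ r < N`.
  have h2 : ∑ q ∈ Finset.Ico 1 m, wordT k A N ^ (N - q) =
      ∑ r ∈ Finset.Ico p N, wordT k A N ^ r := by
    rw [Finset.sum_Ico_reflect (fun r => wordT k A N ^ r) 1 (show m ≤ N + 1 by omega)]
    rw [show N + 1 - m = p by omega, show N + 1 - 1 = N by omega]
  rw [h1, h2, ← Finset.sum_range_add_sum_Ico _ (show p ≤ N by omega), mul_add, smul_add]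
  abel

/-- A face in front of `x (…)` can be taken before the insertion; it removes one letter, whence the
shift of the place by one. -/
lemma wordE_mul_wordIns_of_lt {p : ℕ} (x : Cochain k A p) {c q m N : ℕ} (hN : N + 1 = m + p)
    (hc : c < q) (hq : q + 1 < m) :
    wordE k A m c * wordIns x (q + 1) = (-1 : k) ^ (p + 1) • (wordIns x q * wordE k A N c) := by
  rw [wordE_of_lt (by omega), wordE_of_lt (by omega), wordIns, wordIns, smul_mul_smul_comm,
    smul_mul_smul_comm, ← wordMap_comp, ← wordMap_comp, ins_ins _ _ (by omega), smul_smul,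
    ← pow_add, ← pow_add, ← pow_add]
  rw [show q + 1 + 1 - 2 = q by omega]
  congr 1
  apply neg_one_pow_congr
  simp only [parity_simps]
  tauto

lemma wordE_mul_wordIns_of_gt {p : ℕ} (x : Cochain k A p) {c q m N : ℕ} (hN : N + 1 = m + p)
    (hq : 1 ≤ q) (hc : q ≤ c) (hcm : c + 1 < m) :
    wordE k A m (c + 1) * wordIns x q =
      (-1 : k) ^ (p + 1) • (wordIns x q * wordE k A N (c + p)) := by
  by_cases h : c + 1 + 1 < m
  · rw [wordE_of_lt h, wordE_of_lt (by omega), wordIns, smul_mul_smul_comm,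
      smul_mul_smul_comm, ← wordMap_comp, ← wordMap_comp, ins_ins _ _ (show q + p ≤ c + p by omega),
      smul_smul, ← pow_add, ← pow_add, ← pow_add, show c + p + 1 - p = c + 1 by omega]
    congr 1
    apply neg_one_pow_congr
    simp only [parity_simps]
    tauto
  -- This is the cyclic face. It multiplies the last letter into the front one, and `q ≥ 1` keeps `x
  -- (…)` away from the front.
  · rw [wordE_last (by omega), wordE_last (by omega), wordIns, smul_mul_smul_comm,
      smul_mul_smul_comm, ← wordMap_comp, ← wordMap_comp, Function.comp_assoc,
      ← ins_rot x hN (by omega), ← Function.comp_assoc, ins_ins _ _ (by omega),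
      Function.comp_assoc, smul_smul, ← pow_add, ← pow_add, ← pow_add,
      show q + 1 + 1 - 2 = q by omega]
    congr 1
    apply neg_one_pow_congr
    obtain rfl : m = c + 2 := by omega
    obtain rfl : N = c + 1 + p := by omega
    simp only [parity_simps]
    tauto

/-- The faces of the insertion of `x` that are not insertions of `x` into a face. -/
def wordY {p : ℕ} (x : Cochain k A p) (m N q : ℕ) : Module.End k (Words k A) :=
  wordE k A m q * wordIns x (q + 1) + wordE k A m q * wordIns x q
    - (-1 : k) ^ (p + 1) • (wordIns x q * ∑ c ∈ Finset.Ico q (q + p), wordE k A N c)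

/-- After prefixing `1`, the three summands become `B i_x`, the operator `S_{dx}` and `± S_x b`: a
face is either the product of the front letter with `x (…)` in the next place, or makes up `dx` at
the place of `x` (the operators `wordY`), or is disjoint from `x`. -/
lemma sum_wordE_mul_wordM {p : ℕ} (x : Cochain k A p) {m N : ℕ} (hN : N + 1 = m + p)
    (hm : 0 < m) :
    (∑ c ∈ Finset.range (m - 1), wordE k A m c) * wordM x m =
      (∑ r ∈ Finset.range (m - 1), wordT k A (m - 1) ^ r) * (wordE k A m 0 * wordIns x 1)
      + ∑ q ∈ Finset.Ico 1 (m - 1),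
          (∑ r ∈ Finset.range (m - 1 - q), wordT k A (m - 1) ^ r) * wordY x m N q
      + (-1 : k) ^ (p + 1) • (wordM x (m - 1) * ∑ c ∈ Finset.range N, wordE k A N c) := by
  obtain rfl | hm2 : m = 1 ∨ 2 ≤ m := by omega
  · simp [wordM]
  -- The partial sums of rotations are only moved around from here on, so they are kept opaque.
  obtain ⟨Q, hQ⟩ : ∃ Q : ℕ → Module.End k (Words k A),
      ∀ s, ∑ r ∈ Finset.range s, wordT k A (m - 1) ^ r = Q s := ⟨_, fun _ => rfl⟩
  simp only [hQ]
  set σ : k := (-1 : k) ^ (p + 1) with hσ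
  -- Faces are moved past the rotations with `R = m - 1 - q`. The faces `c < q` receive one rotation
  -- more than the others.
  have h1 : (∑ c ∈ Finset.range (m - 1), wordE k A m c) * wordM x m =
      ∑ q ∈ Finset.Ico 1 m, Q (m - q) * ((∑ c ∈ Finset.range q, wordE k A m c) * wordIns x q)
      + ∑ q ∈ Finset.Ico 1 m,
        Q (m - 1 - q) * ((∑ c ∈ Finset.Ico q m, wordE k A m c) * wordIns x q) := by
    rw [wordM, Finset.mul_sum, ← Finset.sum_add_distrib]
    refine Finset.sum_congr rfl fun q hq => ?_
    rw [Finset.mem_Ico] at hq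
    have := sum_wordE_mul_sum_wordT (k := k) (A := A) hm2 (R := m - 1 - q) (by omega)
    rw [show m - 1 - q + 1 = m - q by omega, show m - 1 - (m - 1 - q) = q by omega,
      ← Finset.sum_range_add_sum_Ico _ (show q ≤ m by omega)] at this
    rw [← mul_assoc, this, hQ, show Q (m - q) = Q (m - 1 - q) + wordT k A (m - 1) ^ (m - 1 - q) by
      rw [show m - q = m - 1 - q + 1 by omega, ← hQ, ← hQ, Finset.sum_range_succ]]
    noncomm_ring
  -- Faces in front of `x (…)`: the adjacent one, `c = q - 1`, is isolated and the others commute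
  -- with the insertion. The term `q = 1` is split off, and the rest is reindexed so that the number
  -- of rotations agrees with that in `h3`.
  have h2 : ∑ q ∈ Finset.Ico 1 m,
        Q (m - q) * ((∑ c ∈ Finset.range q, wordE k A m c) * wordIns x q) =
      Q (m - 1) * (wordE k A m 0 * wordIns x 1)
      + ∑ q ∈ Finset.Ico 1 (m - 1), Q (m - 1 - q) * (wordE k A m q * wordIns x (q + 1)
          + σ • (wordIns x q * ∑ c ∈ Finset.range q, wordE k A N c)) := by
    rw [Finset.sum_Ico_eq_sum_range, Finset.sum_Ico_eq_sum_range,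
      show m - 1 = (m - 1 - 1) + 1 by omega, Finset.sum_range_succ', add_comm]
    congr 1
    · simp [show m - 1 - 1 + 1 = m - 1 by omega]
    · rw [Nat.add_sub_cancel]
      refine Finset.sum_congr rfl fun q hq => ?_
      rw [Finset.mem_range] at hq
      rw [show m - (1 + (q + 1)) = m - 1 - 1 + 1 - (1 + q) by omega, ← add_assoc 1 q 1,
        Finset.sum_range_succ, add_mul, Finset.sum_mul,
        Finset.sum_congr rfl fun c hc => wordE_mul_wordIns_of_lt x hN (Finset.mem_range.mp hc)
          (by omega), ← Finset.smul_sum, ← Finset.mul_sum, add_comm (σ • _)]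
  -- Faces from `x (…)` on: `c = q` is adjacent and isolated, the others commute with the insertion.
  have h3 : ∑ q ∈ Finset.Ico 1 m,
        Q (m - 1 - q) * ((∑ c ∈ Finset.Ico q m, wordE k A m c) * wordIns x q) =
      ∑ q ∈ Finset.Ico 1 (m - 1), Q (m - 1 - q) * (wordE k A m q * wordIns x q
          + σ • (wordIns x q * ∑ c ∈ Finset.Ico (q + p) N, wordE k A N c)) := by
    conv_lhs => rw [show m = m - 1 + 1 by omega, Finset.sum_Ico_succ_top (by omega)]
    rw [show m - 1 + 1 = m by omega]
    -- For `q = m - 1` the sum of rotations is empty, so the range may end at `m - 2`.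
    have h0 : Q (m - 1 - (m - 1)) = 0 := by simp [← hQ]
    rw [h0, zero_mul, add_zero]
    refine Finset.sum_congr rfl fun q hq => ?_
    rw [Finset.mem_Ico] at hq
    rw [Finset.sum_eq_sum_Ico_succ_bot (by omega), add_mul, Finset.sum_mul, Finset.mul_sum,
      Finset.smul_sum, Finset.sum_Ico_eq_sum_range, Finset.sum_Ico_eq_sum_range,
      show N - (q + p) = m - (q + 1) by omega]
    congr 2
    refine Finset.sum_congr rfl fun c hc => ?_
    rw [Finset.mem_range] at hc
    rw [show q + 1 + c = (q + c) + 1 by omega, show q + p + c = q + c + p by omega]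
    exact wordE_mul_wordIns_of_gt x hN hq.1 (by omega) (by omega)
  rw [h1, h2, h3, add_assoc, add_assoc]
  congr 1
  simp only [wordM, hQ]
  rw [Finset.sum_mul, Finset.smul_sum, ← Finset.sum_add_distrib, ← Finset.sum_add_distrib]
  refine Finset.sum_congr rfl fun q hq => ?_
  rw [Finset.mem_Ico] at hq
  rw [mul_assoc, ← mul_smul_comm σ (Q _), ← mul_add, ← mul_add, wordY]
  congr 1
  rw [← Finset.sum_range_add_sum_Ico _ (show q ≤ N by omega),
    ← Finset.sum_Ico_consecutive _ (show q ≤ q + p by omega) (show q + p ≤ N by omega)]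
  simp only [mul_add, smul_add]
  abel

end InsertionOperators

/-! ### Translation of the operators on normalized chains into word operators. -/

section ChainWords

variable {k : Type u} [Field k] {A : Type v} [Ring A] [Algebra k A]

set_option linter.unusedSectionVars false

variable (k) in
/-- The chain `w_0 ⊗ ⋯ ⊗ w_n` given by the beginning of a sequence. -/
def chainSeq (n : ℕ) (w : ℕ → A) : Chain k A n := chainMk k A n fun j => w j

variable (k A) in
/-- The linear extension of `chainSeq` to words. -/
def chainWord (n : ℕ) : Words k A →ₗ[k] Chain k A n := wordLift (chainSeq k n)

lemma chainWord_word (n : ℕ) (w : ℕ → A) : chainWord k A n (word k w) = chainSeq k n w :=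
  wordLift_word k _ w

lemma chainMk_eq_chainSeq (n : ℕ) (a : Fin (n + 1) → A) :
    chainMk k A n a = chainSeq k n (cyclic a) := by
  rw [chainSeq]; congr 1; funext j; rw [cyclic_val]

lemma chain_hom_ext_seq {E : Type*} [AddCommGroup E] [Module k E] {n : ℕ}
    {f g : Chain k A n →ₗ[k] E} (h : ∀ w, f (chainSeq k n w) = g (chainSeq k n w)) : f = g :=
  chain_hom_ext fun a => by rw [chainMk_eq_chainSeq, h]

/-- Elementary tensors span the chains, so identities between operators on chains may be checked on
words, where no quotient is involved. -/
lemma chain_hom_ext_word {E : Type*} [AddCommGroup E] [Module k E] {n : ℕ}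
    {f g : Chain k A n →ₗ[k] E} (h : f ∘ₗ chainWord k A n = g ∘ₗ chainWord k A n) : f = g :=
  chain_hom_ext_seq fun w => by
    simpa [chainWord_word] using LinearMap.congr_fun h (word k w)

lemma chainMkOne_eq_chainSeq (m : ℕ) (w : ℕ → A) :
    chainMkOne k A m (fun j => w j) = chainSeq k m (consOne w) := by
  simp only [chainMkOne, MultilinearMap.curryLeft_apply, chainSeq]
  congr 1
  funext j
  refine Fin.cases ?_ (fun j => ?_) j
  · simp [consOne]
  · simp [consOne]

lemma cyclic_seq_of_lt {N t : ℕ} (w : ℕ → A) (h : t < N) :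
    cyclic (fun j : Fin N => w j) t = w t := by
  simp [cyclic, Nat.mod_eq_of_lt h, h]

/-- Reading a word of length `N` cyclically from place `r` amounts to moving its last `N - r`
letters to the front. -/
lemma cyclic_seq {N r j : ℕ} (w : ℕ → A) (hr : r ≤ N) (hj : j < N) :
    cyclic (fun j : Fin N => w j) (r + j) = rotBy N (N - r) w j := by
  simp only [rotBy]
  by_cases h : j < N - r
  · rw [if_pos h, cyclic_seq_of_lt _ (by omega)]; congr 1; omega
  · have : (r + j) % N = j - (N - r) := by
      rw [Nat.mod_eq_sub_mod (by omega), Nat.mod_eq_of_lt (by omega)]; omega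
    rw [if_neg h, if_pos hj, cyclic_of_mod (l := ⟨j - (N - r), by omega⟩) _ this]

lemma plugArgs_seq {N M q : ℕ} (x : Cochain k A q) {r i : ℕ} (h : N + 1 = M + q) (hi : i < M)
    (hr : r ≤ N) (w : ℕ → A) :
    plugArgs M x r i (fun j : Fin N => w j) = fun j : Fin M => ins x i (rotBy N (N - r) w) j := by
  funext j
  have hj := j.isLt
  simp only [plugArgs, ins]
  split_ifs with h1 h2
  · exact cyclic_seq w hr (by omega)
  · congr 1
    funext t
    have := t.isLt
    rw [add_assoc]
    exact cyclic_seq w hr (by omega)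
  · rw [add_assoc]
    exact cyclic_seq w hr (by omega)

lemma rotBy_self (N : ℕ) : rotBy (A := A) N N = id := by
  funext w j
  simp only [rotBy, id]
  split_ifs <;> first | omega | exact congrArg w (by omega)

lemma plug_seq {E : Type*} [AddCommGroup E] [Module k E] {N M q : ℕ}
    (F : MultilinearMap k (fun _ : Fin M => A) E) (x : Cochain k A q) {r i : ℕ}
    (h : N + 1 = M + q) (hi : i < M) (hr : r ≤ N) (w : ℕ → A) :
    plug N F x r i (fun j => w j) = F fun j => ins x i (rotBy N (N - r) w) j := by
  rw [plug_apply _ _ _ _ h hi, plugArgs_seq x h hi hr]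

lemma plug_seq_zero {E : Type*} [AddCommGroup E] [Module k E] {N M q : ℕ}
    (F : MultilinearMap k (fun _ : Fin M => A) E) (x : Cochain k A q) {i : ℕ}
    (h : N + 1 = M + q) (hi : i < M) (w : ℕ → A) :
    plug N F x 0 i (fun j => w j) = F fun j => ins x i w j := by
  rw [plug_seq F x h hi (Nat.zero_le _), Nat.sub_zero, rotBy_self]; rfl

/-- Inserting a composite is inserting the inner cochain first and the outer one around it; this
lets `dx` be compared with faces of insertions. -/
lemma ins_plug {p p' N : ℕ} (y : Cochain k A p') (x : Cochain k A p) {i : ℕ}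
    (h : N + 1 = p' + p) (hi : i < p') (q : ℕ) :
    ins (plug N y x 0 i) q = ins y q ∘ ins x (q + i) := by
  funext w j
  simp only [Function.comp]
  rcases lt_trichotomy j q with h1 | h1 | h1
  · rw [ins_apply_lt _ _ h1, ins_apply_lt _ _ h1, ins_apply_lt _ _ (by omega)]
  · subst h1
    rw [ins_apply_self, ins_apply_self, plug_seq_zero y x h hi (fun t => w (j + t))]
    congr 1
    funext t
    simp only [ins]
    split_ifs <;> first | omega | rfl | (congr 1; omega) | skip
    congr 1
    funext s
    congr 1; omega
  · rw [ins_apply_gt _ _ h1, ins_apply_gt _ _ h1, ins_apply_gt _ _ (by omega)]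
    congr 1; omega

lemma hochschildB_comp_chainWord (m : ℕ) :
    hochschildB k A (m + 1) m ∘ₗ chainWord k A (m + 1) =
      chainWord k A m ∘ₗ ∑ c ∈ Finset.range (m + 2), wordE k A (m + 2) c := by
  refine words_hom_ext fun w => ?_
  rw [LinearMap.comp_apply, chainWord_word, chainSeq, hochschildB, chainLift_mk, hochschildMulti,
    Finset.sum_range_succ _ (m + 1)]
  simp only [_root_.add_apply, _root_.smul_apply, _root_.sum_apply, LinearMap.comp_apply, map_add,
    map_sum, LinearMap.add_apply, LinearMap.sum_apply]
  congr 1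
  · refine Finset.sum_congr rfl fun c hc => ?_
    rw [Finset.mem_range] at hc
    rw [wordE_of_lt (by omega), LinearMap.smul_apply, wordMap_word, map_smul, chainWord_word, chainSeq,
      plug_seq_zero _ _ (by omega) hc]
  · rw [wordE_last (by omega), LinearMap.smul_apply, wordMap_word, map_smul, chainWord_word, chainSeq,
      plug_seq _ _ (by omega) (by omega) (by omega), show m + 1 + 1 - (m + 1) = 1 by omega,
      ← rot_eq_rotBy, show m + 2 + 1 = m + 1 + 2 by ring, pow_add _ (m + 1) 2]
    simp

lemma wordT_pow_word {m r : ℕ} (hr : r ≤ m) (w : ℕ → A) :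
    (wordT k A m ^ r) (word k w) = (-1 : k) ^ ((m + 1) * r) • word k (rotBy m r w) := by
  rw [wordT_pow _ _ hr, LinearMap.smul_apply, wordMap_word]

lemma connesB_comp_chainWord (n : ℕ) :
    connesB k A n (n + 1) ∘ₗ chainWord k A n =
      chainWord k A (n + 1) ∘ₗ
        (wordS k A * ∑ r ∈ Finset.range (n + 1), wordT k A (n + 1) ^ r) := by
  -- The summand of `B` starting at `a_i` is `T ^ (n + 1 - i)`. Since `T ^ (n + 1) = 1`, the
  -- exponents may run over `1, …, n + 1` instead of `0, …, n`.
  have hsum : ∑ r ∈ Finset.range (n + 1), wordT k A (n + 1) ^ r =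
      ∑ i ∈ Finset.range (n + 1), wordT k A (n + 1) ^ (n + 1 - i) := by
    have h1 := Finset.sum_range_succ (fun r => wordT k A (n + 1) ^ r) (n + 1)
    rw [Finset.sum_range_succ', wordT_pow_self, pow_zero, add_left_inj] at h1
    rw [← h1, ← Finset.sum_range_reflect]
    refine Finset.sum_congr rfl fun i hi => ?_
    rw [Finset.mem_range] at hi
    congr 1; omega
  refine words_hom_ext fun w => ?_
  rw [LinearMap.comp_apply, chainWord_word, chainSeq, connesB, chainLift_mk, hsum]
  simp only [_root_.smul_apply, _root_.sum_apply, LinearMap.comp_apply, Module.End.mul_apply,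
    map_sum, LinearMap.sum_apply]
  refine Finset.sum_congr rfl fun i hi => ?_
  rw [Finset.mem_range] at hi
  rw [plug_idMap _ _ _ (by omega), wordT_pow_word (by omega), map_smul, map_smul, wordS,
    wordMap_word, chainWord_word, ← chainMkOne_eq_chainSeq]
  congr 1
  · apply neg_one_pow_congr
    obtain ⟨s, rfl⟩ : ∃ s, n = i + s := ⟨n - i, by omega⟩
    rw [show i + s + 1 - i = s + 1 by omega]
    simp only [parity_simps]
    tauto
  · congr 1
    funext j
    exact cyclic_seq w (by omega) j.isLt

/-- The operator `S_x` as a multilinear map. -/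
def sMulti {p : ℕ} (x : Cochain k A p) (n m : ℕ) :
    MultilinearMap k (fun _ : Fin (n + 1) => A) (Chain k A m) :=
  ∑ j ∈ Finset.range (n + 1), ∑ l ∈ Finset.Icc (j + p) n,
      (-1 : k) ^ ((p + 1) * (n + l + j) + n * (l + 1)) •
        plug (n + 1) (chainMkOne k A m) x (l + 1) (n - l + j + 1)

lemma sOperator_chainSeq {p : ℕ} (x : normalized k A A p) (n m : ℕ) (w : ℕ → A) :
    sOperator x n m (chainSeq k n w) = sMulti x.1 n m fun j => w j :=
  chainLift_mk _ _ _

/-- The substitution is `q = j + 1`, `r = n - l`: the place of `x (…)` in the word beginning with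
`a_0`, and the number of letters then rotated in front of `a_0`. In these variables the sign is that
of `T ^ r` times that of `wordIns`. -/
lemma sMulti_seq {p : ℕ} (x : Cochain k A p) {n m : ℕ} (h : n + 2 = m + p) (w : ℕ → A) :
    sMulti x n m (fun j => w j) =
      ∑ q ∈ Finset.Ico 1 m, ∑ r ∈ Finset.range (m - q),
        ((-1 : k) ^ ((m + 1) * r + (p + 1) * (q + 1))) •
          plug (n + 1) (chainMkOne k A m) x (n + 1 - r) (q + r) fun j => w j := by
  simp only [sMulti, _root_.smul_apply, _root_.sum_apply]
  have h1 : ∀ j, ∑ l ∈ Finset.Icc (j + p) n, (-1 : k) ^ ((p + 1) * (n + l + j) + n * (l + 1)) •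
        plug (n + 1) (chainMkOne k A m) x (l + 1) (n - l + j + 1) (fun j => w j) =
      ∑ r ∈ Finset.range (m - (1 + j)), ((-1 : k) ^ ((m + 1) * r + (p + 1) * (1 + j + 1))) •
          plug (n + 1) (chainMkOne k A m) x (n + 1 - r) (1 + j + r) fun j => w j := by
    intro j
    rw [← Finset.Ico_succ_right_eq_Icc, Finset.sum_Ico_eq_sum_range, Order.succ_eq_add_one,
      show n + 1 - (j + p) = m - (1 + j) by omega, ← Finset.sum_range_reflect]
    refine Finset.sum_congr rfl fun r hr => ?_
    rw [Finset.mem_range] at hr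
    obtain ⟨s, hs⟩ : ∃ s, m = 2 + j + r + s := ⟨m - (2 + j + r), by omega⟩
    rw [show j + p + (m - (1 + j) - 1 - r) = n - r by omega, show n - r + 1 = n + 1 - r by omega,
      show n - (n - r) + j + 1 = 1 + j + r by omega]
    congr 1
    apply neg_one_pow_congr
    rw [show n + 1 - r = j + s + p + 1 by omega, show n - r = j + s + p by omega,
      show n = j + r + s + p by omega, hs]
    by_cases h1 : Even j <;> by_cases h2 : Even r <;> by_cases h3 : Even s <;>
      by_cases h4 : Even p <;> simp [h1, h2, h3, h4, parity_simps]
  rw [Finset.sum_congr rfl fun j _ => h1 j, Finset.sum_Ico_eq_sum_range]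
  -- For `j ≥ m - 1` there is no `l` with `j + p ≤ l ≤ n`, so these `j` contribute empty sums.
  refine (Finset.sum_subset_zero_on_sdiff ?_ ?_ fun _ _ => rfl).symm
  · intro j hj
    rw [Finset.mem_range] at hj ⊢
    omega
  · intro j hj
    rw [Finset.mem_sdiff, Finset.mem_range, Finset.mem_range] at hj
    rw [show m - (1 + j) = 0 by omega, Finset.range_zero, Finset.sum_empty]

lemma plug_chainMkOne_seq {p : ℕ} (x : Cochain k A p) {n m q r : ℕ} (h : n + 2 = m + p)
    (hq : q + r < m) (hr : r ≤ n + 1) (w : ℕ → A) :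
    plug (n + 1) (chainMkOne k A m) x (n + 1 - r) (q + r) (fun j => w j) =
      chainSeq k m (consOne (rotBy m r (ins x q w))) := by
  rw [plug_seq _ _ (by omega) hq (by omega), ← chainMkOne_eq_chainSeq,
    show n + 1 - (n + 1 - r) = r by omega]
  congr 1
  funext j
  exact congrFun (congrFun (ins_rotBy x (N := n + 1) (by omega) hq) w) j

lemma sOperator_comp_chainWord {p : ℕ} (x : normalized k A A p) {n m : ℕ} (h : n + 2 = m + p) :
    sOperator x n m ∘ₗ chainWord k A n = chainWord k A m ∘ₗ (wordS k A * wordM x.1 m) := by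
  refine words_hom_ext fun w => ?_
  rw [LinearMap.comp_apply, chainWord_word, sOperator_chainSeq, sMulti_seq x.1 h, wordM]
  simp only [LinearMap.comp_apply, Module.End.mul_apply, LinearMap.sum_apply, map_sum]
  refine Finset.sum_congr rfl fun q hq => Finset.sum_congr rfl fun r hr => ?_
  rw [Finset.mem_Ico] at hq
  rw [Finset.mem_range] at hr
  rw [plug_chainMkOne_seq x.1 h (by omega) (by omega), wordIns, LinearMap.smul_apply, wordMap_word,
    map_smul, wordT_pow_word (by omega), smul_smul, map_smul, map_smul, wordS, wordMap_word,
    chainWord_word, ← pow_add, add_comm]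

/-- In the first sum of `L_x` the entry `x (…)` stands behind `a_0`. In the second `a_0` is an
argument of `x`: the last `r < p` letters are rotated to the front and `x` is applied there. -/
lemma lieDerivative_comp_chainWord {p : ℕ} (x : normalized k A A p) {n m : ℕ}
    (h : n + 1 = m + p) :
    lieDerivative n m x ∘ₗ chainWord k A n = chainWord k A m ∘ₗ
      (∑ q ∈ Finset.Ico 1 (m + 1), wordIns x.1 q
        + (-1 : k) ^ (p + 1) •
          (wordMap k (ins x.1 0) * ∑ r ∈ Finset.range p, wordT k A (n + 1) ^ r)) := by
  refine words_hom_ext fun w => ?_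
  have h0 : lieDerivative n m x (chainSeq k n w) = lieMulti x.1 n m fun j => w j :=
    chainLift_mk _ (fun _ _ => lieMulti_vanish x.2 _ _) _
  rw [LinearMap.comp_apply, chainWord_word, h0, lieMulti, Finset.sum_Ico_eq_sum_range,
    ← Finset.Ico_succ_right_eq_Icc, Finset.sum_Ico_eq_sum_range, Order.succ_eq_add_one,
    show n + 1 - (n + 1 - p) = p by omega, show n + 1 - p = m + 1 - 1 by omega,
    ← Finset.sum_range_reflect _ p]
  simp only [LinearMap.comp_apply, LinearMap.add_apply, LinearMap.smul_apply,
    Module.End.mul_apply, LinearMap.sum_apply, map_sum, _root_.add_apply, _root_.smul_apply,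
    _root_.sum_apply, map_add, map_smul, Finset.smul_sum]
  congr 1
  · refine Finset.sum_congr rfl fun q hq => ?_
    rw [Finset.mem_range] at hq
    rw [plug_seq_zero _ _ (by omega) (by omega), wordIns, LinearMap.smul_apply, wordMap_word,
      map_smul, chainWord_word, chainSeq, add_comm q 1]
    congr 1
    apply neg_one_pow_congr
    simp only [parity_simps]
    tauto
  · refine Finset.sum_congr rfl fun r hr => ?_
    rw [Finset.mem_range] at hr
    rw [plug_seq _ _ (by omega) (by omega) (by omega), wordT_pow_word (by omega), map_smul,
      wordMap_word, map_smul, chainWord_word, chainSeq, smul_smul, ← pow_add,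
      show n + 1 - (m + 1 - 1 + (p - 1 - r) + 1) = r by omega]
    congr 1
    apply neg_one_pow_congr
    rw [show m + 1 - 1 + (p - 1 - r) = n - r by omega]
    obtain ⟨s, rfl⟩ : ∃ s, n = r + s := ⟨n - r, by omega⟩
    rw [show r + s - r = s by omega]
    by_cases h1 : Even r <;> by_cases h3 : Even s <;>
      by_cases h4 : Even p <;> simp [h1, h3, h4, parity_simps]

/-- Contraction is insertion directly behind `a_0` followed by face `0`, which is how `B i_x` is
recognized in `b' M`. -/
lemma ins_actLeft_mul {p : ℕ} (x : Cochain k A p) :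
    ins (actLeft (LinearMap.mul k A) x) 0 = ins (mulMap k A) 0 ∘ ins x 1 := by
  funext w j
  simp only [Function.comp]
  rcases Nat.eq_zero_or_pos j with h | h
  · subst h
    rw [ins_apply_self, ins_apply_self]
    simp [mulMap, actLeft, List.ofFn_succ, ins]
    congr 2
    funext t
    simp [Fin.tail, add_comm]
  · rw [ins_apply_gt _ _ h, ins_apply_gt _ _ h, ins_apply_gt _ _ (by omega)]
    congr 1; omega

lemma contraction_comp_chainWord {p : ℕ} (x : normalized k A A p) {n m : ℕ} (h : n = m + p) :
    contraction x n m ∘ₗ chainWord k A n =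
      chainWord k A m ∘ₗ (wordMap k (ins (mulMap k A) 0) * wordMap k (ins x.1 1)) := by
  refine words_hom_ext fun w => ?_
  have h0 : contraction x n m (chainSeq k n w) =
      plug (n + 1) (chainMk k A m) (actLeft (LinearMap.mul k A) x.1) 0 0 fun j => w j :=
    chainLift_mk _ _ _
  rw [LinearMap.comp_apply, chainWord_word, h0, plug_seq_zero _ _ (by omega) (by omega),
    ins_actLeft_mul, ← wordMap_comp, LinearMap.comp_apply, wordMap_word, chainWord_word, chainSeq]

/-- The Hochschild differential of a cochain as a sum of compositions. -/
lemma gerstenhaber_mu_eq {p : ℕ} (x : Cochain k A p) :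
    gerstenhaber (p + 1) (mu k A) x =
      (-1 : k) • plug (p + 1) (mulMap k A) x 0 0
      + (-1 : k) ^ p • plug (p + 1) (mulMap k A) x 0 1
      + ∑ i ∈ Finset.range p, (-1 : k) ^ (p + 1 + i) • plug (p + 1) x (mulMap k A) 0 i := by
  have s3 : mu k A = (-1 : k) • mulMap k A := (neg_one_smul k _).symm
  rw [gerstenhaber, s3, brace_smul_left, brace_smul_right, brace, brace, Finset.sum_range_succ,
    Finset.sum_range_one, sub_eq_add_neg, smul_add, smul_smul, smul_smul, mul_zero, pow_zero,
    mul_one, ← neg_one_smul k ((-1 : k) ^ _ • _), smul_smul, smul_smul, Finset.smul_sum]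
  congr 1
  · congr 2
    rw [mul_one]; ring
  · refine Finset.sum_congr rfl fun i _ => ?_
    rw [smul_smul]
    congr 1
    rw [neg_one_mul, mul_neg_one, neg_neg, ← pow_add]
    apply neg_one_pow_congr
    by_cases h1 : Even p <;> by_cases h2 : Even i <;> simp [h1, h2, parity_simps]

/-- `plug` as a linear map in the inserted cochain. -/
def plugHom {E : Type*} [AddCommGroup E] [Module k E] (N : ℕ) {M q : ℕ}
    (F : MultilinearMap k (fun _ : Fin M => A) E) (r i : ℕ) :
    Cochain k A q →ₗ[k] MultilinearMap k (fun _ : Fin N => A) E where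
  toFun x := plug N F x r i
  map_add' x y := plug_add F x y r i
  map_smul' c x := plug_smul F c x r i

/-- The bracket `[μ₀, x]` is a sum of composites of `x` with the multiplication: `x (…)` times the
next letter, the preceding letter times `x (…)`, and `x` of products. By `ins_plug` their insertions
are exactly the three parts of `wordY`, including signs. -/
lemma sOperator_gerstenhaber_comp_chainWord {p p' : ℕ} (hp : p' = p + 1) (x : Cochain k A p)
    (hx : gerstenhaber p' (mu k A) x ∈ normalized k A A p') {n m : ℕ} (h : n + 1 = m + p) :
    sOperator ⟨gerstenhaber p' (mu k A) x, hx⟩ n m ∘ₗ chainWord k A n =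
      chainWord k A m ∘ₗ (wordS k A * ∑ q ∈ Finset.Ico 1 m,
        (∑ r ∈ Finset.range (m - q), wordT k A m ^ r) * wordY x (m + 1) (n + 1) q) := by
  subst hp
  refine words_hom_ext fun w => ?_
  rw [LinearMap.comp_apply, chainWord_word, sOperator_chainSeq, sMulti_seq _ (by omega)]
  simp only [LinearMap.comp_apply, Module.End.mul_apply, LinearMap.sum_apply, map_sum]
  refine Finset.sum_congr rfl fun q hq => Finset.sum_congr rfl fun r hr => ?_
  rw [Finset.mem_Ico] at hq
  rw [Finset.mem_range] at hr
  -- The outer operators are the same for every term, so they are abbreviated by one linear map and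
  -- only the insertions are compared.
  obtain ⟨T, hT⟩ : ∃ T : Words k A →ₗ[k] Chain k A m, ∀ z, T z =
    chainWord k A m (wordS k A ((wordT k A m ^ r) z)) :=
    ⟨chainWord k A m ∘ₗ wordS k A ∘ₗ (wordT k A m ^ r), fun _ => rfl⟩
  have key : ∀ z : Cochain k A (p + 1),
      plug (n + 1) (chainMkOne k A m) z (n + 1 - r) (q + r) (fun j => w j) =
        (-1 : k) ^ ((m + 1) * r) • T (word k (ins z q w)) := by
    intro z
    rw [plug_chainMkOne_seq z (by omega) (by omega) (by omega), hT, wordT_pow_word (by omega),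
      map_smul, map_smul, wordS, wordMap_word, chainWord_word, smul_smul, ← pow_add,
      (Even.neg_one_pow ⟨_, rfl⟩ : (-1 : k) ^ ((m + 1) * r + (m + 1) * r) = 1), one_smul]
  have lin : plug (n + 1) (chainMkOne k A m) (gerstenhaber (p + 1) (mu k A) x) (n + 1 - r) (q + r) =
      (-1 : k) • plug (n + 1) (chainMkOne k A m) (plug (p + 1) (mulMap k A) x 0 0)
        (n + 1 - r) (q + r)
      + (-1 : k) ^ p • plug (n + 1) (chainMkOne k A m) (plug (p + 1) (mulMap k A) x 0 1)
        (n + 1 - r) (q + r)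
      + ∑ i ∈ Finset.range p, (-1 : k) ^ (p + 1 + i) • plug (n + 1) (chainMkOne k A m)
        (plug (p + 1) x (mulMap k A) 0 i) (n + 1 - r) (q + r) := by
    have := congrArg (plugHom (n + 1) (chainMkOne k A m) (n + 1 - r) (q + r))
      (gerstenhaber_mu_eq x)
    simp only [map_add, map_sum, map_smul] at this
    exact this
  rw [← hT, lin]
  simp only [_root_.add_apply, _root_.smul_apply, _root_.sum_apply, key]
  rw [ins_plug _ _ (by omega) (by omega), ins_plug _ _ (by omega) (by omega), wordY,
    wordE_of_lt (by omega), Finset.sum_Ico_eq_sum_range, show q + p - q = p by omega]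
  have h3 : ∀ i ∈ Finset.range p,
      (-1 : k) ^ (p + 1 + i) • (-1 : k) ^ ((m + 1) * r) •
        T (word k (ins (plug (p + 1) x (mulMap k A) 0 i) q w)) =
      (-1 : k) ^ (p + 1 + i) • (-1 : k) ^ ((m + 1) * r) •
        T (word k (ins x q (ins (mulMap k A) (q + i) w))) := by
    intro i hi
    rw [Finset.mem_range] at hi
    rw [ins_plug _ _ (by omega) hi]; rfl
  have h4 : ∀ i ∈ Finset.range p, wordE k A (n + 1) (q + i) =
      (-1 : k) ^ (q + i) • wordMap k (ins (mulMap k A) (q + i)) := by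
    intro i hi
    rw [Finset.mem_range] at hi
    exact wordE_of_lt (by omega)
  rw [Finset.sum_congr rfl h3, Finset.sum_congr rfl h4]
  simp only [wordIns, LinearMap.add_apply, LinearMap.sub_apply, LinearMap.smul_apply,
    Module.End.mul_apply, LinearMap.sum_apply, map_smul, map_add, map_sub, map_sum, wordMap_word,
    Function.comp_apply, smul_add, Finset.smul_sum, smul_smul, ← pow_add, add_zero]
  simp only [sub_eq_add_neg, ← Finset.sum_neg_distrib, ← neg_smul]
  rw [add_comm (((-1 : k) ^ _ * _) • _)]
  congr 1
  · congr 1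
    · congr 1
      apply neg_one_pow_congr
      by_cases h1 : Even p <;> by_cases h2 : Even q <;> by_cases h3 : Even m <;>
        by_cases h4 : Even r <;> simp [h1, h2, h3, h4, parity_simps]
    · congr 1
      rw [← pow_succ', ← pow_add]
      apply neg_one_pow_congr
      by_cases h1 : Even p <;> by_cases h2 : Even q <;> by_cases h3 : Even m <;>
        by_cases h4 : Even r <;> simp [h1, h2, h3, h4, parity_simps]
  · refine Finset.sum_congr rfl fun i _ => ?_
    congr 1
    rw [← neg_one_mul ((-1 : k) ^ _), ← pow_succ']
    apply neg_one_pow_congr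
    by_cases h1 : Even p <;> by_cases h2 : Even q <;> by_cases h3 : Even m <;>
      by_cases h4 : Even r <;> by_cases h5 : Even i <;> simp [h1, h2, h3, h4, h5, parity_simps]

end ChainWords

/-! ### The mixed complex relations and the Cartan homotopy formula. -/

section CartanHomotopy

variable {k : Type u} [Field k] {A : Type v} [Ring A] [Algebra k A]

/-- From `b S = 1 - T - S b'`, `(1 - T) N = 0` and `b' N = N b` one gets `b S N = -S N b`. -/
lemma hochschildB_comp_connesB (n : ℕ) :
    hochschildB k A (n + 1) n ∘ₗ connesB k A n (n + 1)
      + connesB k A (n - 1) n ∘ₗ hochschildB k A n (n - 1) = 0 := by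
  apply chain_hom_ext_word
  have h1 := sum_wordE_mul_wordS (k := k) (A := A) (m := n + 1) (by omega)
  have h2 := one_sub_wordT_mul_sum (k := k) (A := A) (n + 1) (n + 1)
  rw [wordT_pow_self, sub_self] at h2
  rw [LinearMap.zero_comp, LinearMap.add_comp, LinearMap.comp_assoc, connesB_comp_chainWord,
    ← LinearMap.comp_assoc, hochschildB_comp_chainWord, LinearMap.comp_assoc, ← Module.End.mul_eq_comp,
    ← mul_assoc, h1, sub_mul, h2, zero_sub, mul_assoc]
  cases n with
  -- With `n = 0` the truncated index `n - 1` is `0`, and the differential between these degrees is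
  -- zero by definition.
  | zero => simp [hochschildB_eq_zero]
  | succ n =>
    have h3 := sum_wordE_mul_sum_wordT (k := k) (A := A) (m := n + 1 + 1) (by omega)
      (R := n + 1) (by omega)
    rw [Nat.add_sub_cancel, Nat.sub_self, Finset.range_zero, Finset.sum_empty, mul_zero,
      add_zero] at h3
    rw [Nat.add_sub_cancel, Nat.add_sub_cancel, LinearMap.comp_assoc, hochschildB_comp_chainWord,
      ← LinearMap.comp_assoc, connesB_comp_chainWord, LinearMap.comp_assoc,
      ← Module.End.mul_eq_comp, h3, mul_assoc, ← LinearMap.comp_add, neg_add_cancel,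
      LinearMap.comp_zero]

/-- The front entry `1` lands behind the new front entry `1`, so every term is degenerate. The same
happens for `S_x`. As `B` and `S_x` only produce chains with front entry `1`, the composites `B B`,
`B S_x` and `S_x B` vanish. -/
lemma connesB_chainSeq_consOne (n m : ℕ) (w : ℕ → A) :
    connesB k A n m (chainSeq k n (consOne w)) = 0 := by
  rw [chainSeq, connesB, chainLift_mk]
  simp only [_root_.sum_apply, _root_.smul_apply]
  refine Finset.sum_eq_zero fun i _ => ?_
  by_cases hn : n + 1 = m
  · subst hn
    rw [plug_idMap _ _ _ (by omega)]
    obtain ⟨s, hs, hsl, -⟩ := exists_place i (0 : Fin (n + 1))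
    rw [chainMkOne_eq_zero _ ⟨s, hs⟩ (by rw [cyclic_of_mod _ hsl]; simp [consOne]), smul_zero]
  · rw [plug_eq_zero _ _ _ _ (by omega)]
    simp

lemma sOperator_chainSeq_consOne {p : ℕ} (x : normalized k A A p) (n m : ℕ) (w : ℕ → A) :
    sOperator x n m (chainSeq k n (consOne w)) = 0 := by
  rw [sOperator_chainSeq]
  simp only [sMulti, _root_.sum_apply, _root_.smul_apply]
  refine Finset.sum_eq_zero fun j _ => Finset.sum_eq_zero fun l _ => ?_
  rw [plug_vanish _ _ (l + 1) _ (fun _ => True) (fun _ => True)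
    (fun w j hw _ => chainMkOne_eq_zero w j hw) (fun w j hw _ => x.2 w j hw) _ 0
    (by simp [consOne]) (fun _ _ _ => ⟨fun _ => trivial, fun _ _ => trivial, fun _ => trivial⟩),
    smul_zero]

lemma comp_chainWord_wordS {E : Type*} [AddCommGroup E] [Module k E] {m : ℕ}
    {f : Chain k A m →ₗ[k] E} (hf : ∀ w, f (chainSeq k m (consOne w)) = 0)
    (T : Module.End k (Words k A)) :
    f ∘ₗ (chainWord k A m ∘ₗ (wordS k A * T)) = 0 := by
  have : f ∘ₗ chainWord k A m ∘ₗ wordS k A = 0 := words_hom_ext fun w => by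
    simp [wordS, wordMap_word, chainWord_word, hf]
  rw [Module.End.mul_eq_comp, ← LinearMap.comp_assoc T, ← LinearMap.comp_assoc T, this,
    LinearMap.zero_comp]

lemma comp_connesB_eq_zero {E : Type*} [AddCommGroup E] [Module k E] {n m : ℕ}
    {f : Chain k A m →ₗ[k] E} (hf : ∀ w, f (chainSeq k m (consOne w)) = 0) :
    f ∘ₗ connesB k A n m = 0 := by
  by_cases h : n + 1 = m
  · subst h
    apply chain_hom_ext_word
    rw [LinearMap.comp_assoc, connesB_comp_chainWord, comp_chainWord_wordS hf, LinearMap.zero_comp]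
  · rw [connesB_eq_zero h, LinearMap.comp_zero]

lemma sOperator_eq_zero {p : ℕ} (x : normalized k A A p) {n m : ℕ} (h : n + 2 ≠ m + p) :
    sOperator x n m = 0 := by
  refine chain_hom_ext fun a => ?_
  have h' : n + 1 + 1 ≠ m + p := by omega
  simp [sOperator, chainLift_mk, plug_eq_zero _ _ _ _ h']

lemma contraction_eq_zero {p : ℕ} (x : normalized k A A p) {n m : ℕ} (h : n ≠ m + p) :
    contraction x n m = 0 := by
  refine chain_hom_ext fun a => ?_
  have h' : n + 1 + 1 ≠ m + 1 + (p + 1) := by omega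
  simp [contraction, chainLift_mk, plug_eq_zero _ _ _ _ h']

lemma comp_sOperator_eq_zero {E : Type*} [AddCommGroup E] [Module k E] {p : ℕ}
    (x : normalized k A A p) {n m : ℕ} {f : Chain k A m →ₗ[k] E}
    (hf : ∀ w, f (chainSeq k m (consOne w)) = 0) : f ∘ₗ sOperator x n m = 0 := by
  by_cases h : n + 2 = m + p
  · apply chain_hom_ext_word
    rw [LinearMap.comp_assoc, sOperator_comp_chainWord x h, comp_chainWord_wordS hf,
      LinearMap.zero_comp]
  · rw [sOperator_eq_zero x h, LinearMap.comp_zero]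

/-- The Cartan homotopy formula `[b, S_x] + [B, i_x] = L_x - S_{dx}`. -/
lemma cartan_homotopy {p p' : ℕ} (hp : p' = p + 1) (x : normalized k A A p)
    (hx : gerstenhaber p' (mu k A) x.1 ∈ normalized k A A p') {n m : ℕ} (h : n + 1 = m + p) :
    hochschildB k A (m + 1) m ∘ₗ sOperator x n (m + 1)
      + (-1 : k) ^ (p + 1) • (sOperator x (n - 1) m ∘ₗ hochschildB k A n (n - 1))
      + connesB k A (m - 1) m ∘ₗ contraction x n (m - 1)
      + (-1 : k) ^ (p + 1) • (contraction x (n + 1) m ∘ₗ connesB k A n (n + 1)) =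
    lieDerivative n m x - sOperator ⟨gerstenhaber p' (mu k A) x.1, hx⟩ n m := by
  apply chain_hom_ext_word
  simp only [LinearMap.add_comp, LinearMap.sub_comp, LinearMap.smul_comp]
  -- The telescoping identity replaces `L_x` by `(1 - T) M` plus the signed word form of `i_x B`;
  -- both terms reappear on the left.
  rw [lieDerivative_comp_chainWord x h, sOperator_gerstenhaber_comp_chainWord hp x.1 hx h,
    ← one_sub_wordT_mul_wordM x.1 (m := m + 1) (by omega) (by omega)]
  have t1 : (hochschildB k A (m + 1) m ∘ₗ sOperator x n (m + 1)) ∘ₗ chainWord k A n =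
      chainWord k A m ∘ₗ ((1 - wordT k A (m + 1)) * wordM x.1 (m + 1)
        - wordS k A * ((∑ c ∈ Finset.range (m + 1 - 1), wordE k A (m + 1) c) *
          wordM x.1 (m + 1))) := by
    rw [LinearMap.comp_assoc, sOperator_comp_chainWord x (by omega), ← LinearMap.comp_assoc,
      hochschildB_comp_chainWord, LinearMap.comp_assoc, ← Module.End.mul_eq_comp, ← mul_assoc,
      sum_wordE_mul_wordS (by omega), sub_mul, mul_assoc]
  have t2 : (sOperator x (n - 1) m ∘ₗ hochschildB k A n (n - 1)) ∘ₗ chainWord k A n =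
      chainWord k A m ∘ₗ (wordS k A * (wordM x.1 m *
        ∑ c ∈ Finset.range (n + 1), wordE k A (n + 1) c)) := by
    -- For `n = 0` the left side contains `b` on `0`-chains, and on the right `m ≤ 1` leaves no
    -- place for an insertion.
    rcases n with _ | n
    · rw [hochschildB_eq_zero (by omega), LinearMap.comp_zero, LinearMap.zero_comp,
        show wordM x.1 m = 0 by
          rw [wordM, Finset.Ico_eq_empty (by omega), Finset.sum_empty], zero_mul, mul_zero,
        LinearMap.comp_zero]
    · rw [Nat.add_sub_cancel, LinearMap.comp_assoc, hochschildB_comp_chainWord,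
        ← LinearMap.comp_assoc, sOperator_comp_chainWord x (by omega), LinearMap.comp_assoc,
        ← Module.End.mul_eq_comp, mul_assoc]
  have t3 : (connesB k A (m - 1) m ∘ₗ contraction x n (m - 1)) ∘ₗ chainWord k A n =
      chainWord k A m ∘ₗ (wordS k A * ((∑ r ∈ Finset.range (m + 1 - 1), wordT k A (m + 1 - 1) ^ r) *
        (wordE k A (m + 1) 0 * wordIns x.1 1))) := by
    rcases m with _ | m
    · simp [connesB_eq_zero]
    · rw [Nat.add_sub_cancel, Nat.add_sub_cancel, LinearMap.comp_assoc,
        contraction_comp_chainWord x (by omega), ← LinearMap.comp_assoc, connesB_comp_chainWord,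
        LinearMap.comp_assoc, ← Module.End.mul_eq_comp, mul_assoc, wordE_of_lt (by omega), wordIns,
        pow_zero, one_smul, Even.neg_one_pow (by simp), one_smul]
  -- The front entry of `B a` is `1`, and `1 · x (…) = x (…)`, so contracting is insertion at place
  -- `0`.
  have t4 : (contraction x (n + 1) m ∘ₗ connesB k A n (n + 1)) ∘ₗ chainWord k A n =
      chainWord k A m ∘ₗ (wordMap k (ins x.1 0) *
        ∑ r ∈ Finset.range (n + 1), wordT k A (n + 1) ^ r) := by
    rw [LinearMap.comp_assoc, connesB_comp_chainWord, ← LinearMap.comp_assoc,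
      contraction_comp_chainWord x (by omega), LinearMap.comp_assoc, ← Module.End.mul_eq_comp,
      ← mul_assoc, wordS, ← wordMap_comp, ← wordMap_comp, Function.comp_assoc, ins_consOne,
      ← Function.comp_assoc, ins_mul_consOne_zero, Function.id_comp]
  -- In the expansion of `S b' M` the parts for `B i_x` and `S_x b` cancel and the part for `S_{dx}`
  -- stays.
  rw [t1, t2, t3, t4, sum_wordE_mul_wordM x.1 (m := m + 1) (N := n + 1) (by omega) (by omega)]
  simp only [← LinearMap.comp_smul, ← LinearMap.comp_add, ← LinearMap.comp_sub]
  congr 1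
  simp only [mul_add, Nat.add_sub_cancel, mul_smul_comm]
  abel

end CartanHomotopy

/-! ### Hochschild cochains with coefficients in a bimodule. -/

section Bimodules

variable {k : Type u} [Field k] {A : Type v} [Ring A] [Algebra k A]

set_option linter.unusedSectionVars false

variable (k A) in
/-- Bimodule structures on a vector space, given by the left and right multiplications. -/
structure Bimod (M : Type*) [AddCommGroup M] [Module k M] where
  /-- Left multiplication. -/
  l : A →ₗ[k] M →ₗ[k] M
  /-- Right multiplication. -/
  r : A →ₗ[k] M →ₗ[k] M
  l_one : ∀ m, l 1 m = m
  r_one : ∀ m, r 1 m = m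
  l_mul : ∀ a b m, l (a * b) m = l a (l b m)
  r_mul : ∀ a b m, r (a * b) m = r b (r a m)
  comm : ∀ a b m, r b (l a m) = l a (r b m)

/-- Remove the first entry of a sequence. -/
def tailSeq (w : ℕ → A) : ℕ → A := fun j => w (j + 1)

/-- The index pairs `(j, i)` with `i < j` and `(i, j - 1)` have equal values and opposite signs, and
exchanging them is an involution without fixed points. -/
lemma sum_alternating_eq_zero {E : Type*} [AddCommGroup E] [Module k E] {n : ℕ}
    (g : ℕ → ℕ → E) (hg : ∀ i j, i < j → j ≤ n + 1 → g j i = g i (j - 1)) :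
    ∑ j ∈ Finset.range (n + 2), ∑ i ∈ Finset.range (n + 1), (-1 : k) ^ (j + i) • g j i = 0 := by
  rw [← Finset.sum_product']
  refine Finset.sum_involution
    (fun x _ => if x.2 < x.1 then (x.2, x.1 - 1) else (x.2 + 1, x.1)) ?_ ?_ ?_ ?_
  · rintro ⟨j, i⟩ h
    simp only [Finset.mem_product, Finset.mem_range] at h
    simp only
    split_ifs with hij
    · rw [hg i j hij (by omega), ← add_smul]
      obtain ⟨j, rfl⟩ : ∃ t, j = t + 1 := ⟨j - 1, by omega⟩
      rw [Nat.add_sub_cancel, show j + 1 + i = i + j + 1 by omega, pow_succ]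
      simp
    · rw [hg j (i + 1) (by omega) (by omega), Nat.add_sub_cancel, ← add_smul,
        show i + 1 + j = j + i + 1 by omega, pow_succ]
      simp
  · rintro ⟨j, i⟩ h -
    simp only
    split_ifs with hij <;> simp only [ne_eq, Prod.mk.injEq] <;> omega
  · rintro ⟨j, i⟩ h
    simp only [Finset.mem_product, Finset.mem_range] at h
    simp only
    split_ifs with hij <;> simp only [Finset.mem_product, Finset.mem_range] <;> omega
  · rintro ⟨j, i⟩ h
    by_cases hij : i < j
    · simp only [hij, if_true, if_neg (show ¬ j - 1 < i by omega)]
      rw [Nat.sub_add_cancel (by omega)]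
    · simp only [hij, if_false, if_pos (show j < i + 1 by omega), Nat.add_sub_cancel]

lemma tailSeq_ins_succ {p : ℕ} (x : Cochain k A p) (q : ℕ) (w : ℕ → A) :
    tailSeq (ins x (q + 1) w) = ins x q (tailSeq w) := by
  funext j
  simp only [tailSeq, ins]
  rcases lt_trichotomy j q with h | h | h
  · simp [h]
  · subst h
    simp only [lt_irrefl, if_false, if_true]
    congr 1
    funext t
    congr 1; omega
  · rw [if_neg (by omega), if_neg (by omega), if_neg (by omega), if_neg (by omega)]
    congr 1; omega

lemma ins_mul_ins_mul (c : ℕ) :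
    ins (mulMap k A) c ∘ ins (mulMap k A) (c + 1) = ins (mulMap k A) c ∘ ins (mulMap k A) c := by
  funext w j
  simp only [Function.comp]
  rcases lt_trichotomy j c with h | h | h
  · rw [ins_apply_lt _ _ h, ins_apply_lt _ _ h, ins_apply_lt _ _ h, ins_apply_lt _ _ (by omega)]
  · subst h
    rw [ins_apply_self, ins_apply_self]
    simp [mulMap, List.ofFn_succ, ins, mul_assoc]
  · rw [ins_apply_gt _ _ h, ins_apply_gt _ _ h, ins_apply_gt _ _ (by omega),
      ins_apply_gt _ _ (by omega)]

lemma mulMap_apply (a : Fin 2 → A) : mulMap k A a = a 0 * a 1 := by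
  simp [mulMap, List.ofFn_succ]

variable {M : Type*} [AddCommGroup M] [Module k M]

/-- The Hochschild coboundary with coefficients in a bimodule. -/
def coboundary (S : Bimod k A M) (n : ℕ) :
    MultilinearMap k (fun _ : Fin n => A) M →ₗ[k] MultilinearMap k (fun _ : Fin (n + 1) => A) M where
  toFun f :=
    actLeft S.l f
      + ∑ i ∈ Finset.range n, (-1 : k) ^ (i + 1) • plug (n + 1) f (mulMap k A) 0 i
      + (-1 : k) ^ (n + 1) • actRight S.r f
  map_add' f g := by
    ext a
    simp [add_plug, smul_add, Finset.sum_add_distrib, actLeft, actRight]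
    abel
  map_smul' c f := by
    ext a
    simp [smul_plug, smul_add, Finset.smul_sum, smul_comm c, actLeft, actRight]

/-- The faces of a cochain, as functions on sequences. -/
def coface (S : Bimod k A M) (n i : ℕ) (φ : (ℕ → A) → M) (w : ℕ → A) : M :=
  if i = 0 then S.l (w 0) (φ (tailSeq w))
  else if i ≤ n then φ (ins (mulMap k A) (i - 1) w) else S.r (w n) (φ w)

lemma coboundary_seq (S : Bimod k A M) (n : ℕ) (f : MultilinearMap k (fun _ : Fin n => A) M)
    (w : ℕ → A) :
    coboundary S n f (fun j => w j) = S.l (w 0) (f fun j => w (j + 1))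
      + ∑ i ∈ Finset.range n, (-1 : k) ^ (i + 1) • f (fun j => ins (mulMap k A) i w j)
      + (-1 : k) ^ (n + 1) • S.r (w n) (f fun j => w j) := by
  simp only [coboundary, LinearMap.coe_mk, AddHom.coe_mk, _root_.add_apply, _root_.smul_apply,
    _root_.sum_apply]
  congr 1
  congr 1
  refine Finset.sum_congr rfl fun i hi => ?_
  rw [Finset.mem_range] at hi
  rw [plug_seq_zero _ _ (by omega) hi]

lemma coboundary_eq_sum_coface (S : Bimod k A M) (n : ℕ)
    (f : MultilinearMap k (fun _ : Fin n => A) M) (w : ℕ → A) :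
    coboundary S n f (fun j => w j) =
      ∑ i ∈ Finset.range (n + 2), (-1 : k) ^ i • coface S n i (fun v => f fun j => v j) w := by
  rw [coboundary_seq, Finset.sum_range_succ, Finset.sum_range_succ', add_comm (Finset.sum _ _)]
  congr 1
  · congr 1
    · simp [coface, tailSeq]
    · refine Finset.sum_congr rfl fun i hi => ?_
      rw [Finset.mem_range] at hi
      rw [coface, if_neg (by omega), if_pos (by omega), Nat.add_sub_cancel]
  · rw [coface, if_neg (by omega), if_neg (by omega)]

/-- The cofaces satisfy the cosimplicial identities, so the double sum cancels in pairs. -/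
lemma coboundary_coboundary (S : Bimod k A M) (n : ℕ)
    (f : MultilinearMap k (fun _ : Fin n => A) M) :
    coboundary S (n + 1) (coboundary S n f) = 0 := by
  ext a
  have ha : a = fun j : Fin (n + 1 + 1) => cyclic a j := by funext j; rw [cyclic_val]
  rw [ha]
  generalize cyclic a = w
  rw [coboundary_eq_sum_coface]
  have h1 : ∀ j, coface S (n + 1) j (fun v => coboundary S n f fun j => v j) w =
      ∑ i ∈ Finset.range (n + 2), (-1 : k) ^ i •
        coface S (n + 1) j (coface S n i fun v => f fun j => v j) w := by
    intro j
    simp only [coboundary_eq_sum_coface]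
    rw [coface]
    split_ifs with h1 h2
    · simp only [map_sum, map_smul]
      refine Finset.sum_congr rfl fun i _ => ?_
      conv_rhs => rw [coface, if_pos h1]
    · refine Finset.sum_congr rfl fun i _ => ?_
      conv_rhs => rw [coface, if_neg h1, if_pos h2]
    · simp only [map_sum, map_smul]
      refine Finset.sum_congr rfl fun i _ => ?_
      conv_rhs => rw [coface, if_neg h1, if_neg h2]
  simp only [h1, Finset.smul_sum, smul_smul, ← pow_add]
  refine sum_alternating_eq_zero
    (fun j i => coface S (n + 1) j (coface S n i fun v => f fun j => v j) w) ?_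
  intro i j hij hj
  -- The identities with content are `i = 0, j = 1` (left action of a product), `i = 0` with `j`
  -- last (the two actions commute), `j = i + 1` inside (associativity) and both last (right action
  -- of a product). In the others the faces are disjoint.
  rcases Nat.eq_zero_or_pos i with rfl | hi
  · obtain rfl | hj1 : j = 1 ∨ 2 ≤ j := by omega
    · simp only [coface, tailSeq, Nat.sub_self, if_true, if_neg one_ne_zero,
        if_pos (show 1 ≤ n + 1 by omega)]
      rw [ins_apply_self, mulMap_apply, S.l_mul]
      congr 2
    · obtain hj2 | rfl : j ≤ n + 1 ∨ j = n + 2 := by omega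
      · obtain ⟨j, rfl⟩ : ∃ t, j = t + 2 := ⟨j - 2, by omega⟩
        simp only [coface, if_true, if_neg (show j + 2 ≠ 0 by omega), if_pos hj2,
          if_neg (show j + 2 - 1 ≠ 0 by omega), if_pos (show j + 2 - 1 ≤ n by omega)]
        rw [ins_apply_lt _ _ (by omega), show j + 2 - 1 = j + 1 by omega, tailSeq_ins_succ,
          Nat.add_sub_cancel]
      · simp only [coface, if_true, if_neg (show n + 2 ≠ 0 by omega),
          if_neg (show ¬ n + 2 ≤ n + 1 by omega), if_neg (show n + 2 - 1 ≠ 0 by omega),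
          if_neg (show ¬ n + 2 - 1 ≤ n by omega)]
        rw [S.comm]; rfl
  · obtain ⟨i, rfl⟩ : ∃ t, i = t + 1 := ⟨i - 1, by omega⟩
    obtain hj2 | rfl : j ≤ n + 1 ∨ j = n + 2 := by omega
    · obtain ⟨j, rfl⟩ : ∃ t, j = t + 2 := ⟨j - 2, by omega⟩
      simp only [coface, if_neg (show i + 1 ≠ 0 by omega), if_neg (show j + 2 ≠ 0 by omega),
        if_pos hj2, if_pos (show i + 1 ≤ n by omega), if_neg (show j + 2 - 1 ≠ 0 by omega),
        if_pos (show j + 2 - 1 ≤ n by omega), if_pos (show i + 1 ≤ n + 1 by omega)]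
      rw [Nat.add_sub_cancel, show j + 2 - 1 = j + 1 by omega, Nat.add_sub_cancel]
      obtain rfl | h : i = j ∨ i + 2 ≤ j + 1 := by omega
      · have := congrFun (ins_mul_ins_mul (k := k) (A := A) i) w
        simp only [Function.comp] at this
        rw [this]
      · have := congrFun (ins_ins (mulMap k A) (mulMap k A) h) w
        simp only [Function.comp] at this
        rw [this]
        congr
    · simp only [coface, if_neg (show i + 1 ≠ 0 by omega), if_neg (show n + 2 ≠ 0 by omega),
        if_neg (show ¬ n + 2 ≤ n + 1 by omega), if_neg (show n + 2 - 1 ≠ 0 by omega),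
        if_neg (show ¬ n + 2 - 1 ≤ n by omega), if_pos (show i + 1 ≤ n + 1 by omega)]
      rw [Nat.add_sub_cancel]
      split_ifs with h
      · rw [ins_apply_gt _ _ (by omega)]
        congr 2
        congr 1
        omega
      · obtain rfl : i = n := by omega
        rw [ins_apply_self, mulMap_apply, S.r_mul]
        congr 3
        funext t
        rw [ins_apply_lt _ _ t.isLt]

/-- Only the two faces that merge the entry `1` with a neighbour survive; both delete it and they
have opposite signs. If the `1` is the first or last entry, one of the two is the action of `1` on
the coefficients. -/
lemma coboundary_mem (S : Bimod k A M) {n : ℕ} {f : MultilinearMap k (fun _ : Fin n => A) M}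
    (hf : f ∈ normalized k A M n) : coboundary S n f ∈ normalized k A M (n + 1) := by
  intro a l hl
  have ha : a = fun j : Fin (n + 1) => cyclic a j := by funext j; rw [cyclic_val]
  have hl' : cyclic a l = 1 := by rw [cyclic_val, hl]
  have hs := sum_plug_mul (l : ℕ) f a (by
    intro i hi h1 h2
    refine plug_vanish f (mulMap k A) 0 i (fun _ => True) (fun _ => False)
      (fun w j hw _ => hf w j hw) (fun _ _ _ h => h.elim) a l hl ?_
    intro s hs hsl
    rw [zero_add, Nat.mod_eq_of_lt hs] at hsl
    refine ⟨fun _ => trivial, fun _ _ => by omega, fun _ => trivial⟩) hl' (by omega)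
  have key : coboundary S n f a = S.l (cyclic a 0) (f fun j => cyclic a (j + 1))
      - ∑ i ∈ Finset.range n, (-1 : k) ^ i • plug (n + 1) f (mulMap k A) 0 i a
      + (-1 : k) ^ (n + 1) • S.r (cyclic a n) (f fun j => cyclic a j) := by
    conv_lhs => rw [ha]
    rw [coboundary_seq, sub_eq_add_neg, ← Finset.sum_neg_distrib]
    congr 2
    refine Finset.sum_congr rfl fun i hi => ?_
    rw [Finset.mem_range] at hi
    conv_rhs => rw [ha]
    rw [plug_seq_zero _ _ (by omega) hi, pow_succ, mul_neg_one, neg_smul]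
  rw [key, hs]
  have hlp : (l : ℕ) < n + 1 := l.isLt
  have z0 : (l : ℕ) < n → f (fun t => cyclic a t) = 0 := fun h => hf _ ⟨l, h⟩ hl'
  have z1 : (l : ℕ) ≠ 0 → f (fun t => cyclic a (t + 1)) = 0 := fun h =>
    hf _ ⟨l - 1, by omega⟩ (by
      rw [← hl']
      congr 1
      simp only
      omega)
  by_cases c0 : (l : ℕ) = 0
  · have hr : (fun t : Fin n => cyclic a (t + 1)) = removeArg n l a := by
      funext t
      simp [removeArg, c0]
    rw [hr]
    rw [c0] at hl'
    rcases Nat.eq_zero_or_pos n with hp | hp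
    · subst hp
      have hsub : (fun t : Fin 0 => cyclic a t) = removeArg 0 l a := Subsingleton.elim _ _
      simp [hl', hsub, S.l_one, S.r_one]
    · rw [z0 (by omega)]
      simp [c0, hl', hp, S.l_one]
  · rw [z1 c0, if_neg c0]
    by_cases c1 : (l : ℕ) < n
    · rw [z0 c1, if_pos c1]
      obtain ⟨m, hm⟩ := Nat.exists_eq_succ_of_ne_zero c0
      rw [hm]
      simp [pow_succ]
    · have hp : (l : ℕ) = n := by omega
      have hr : (fun t : Fin n => cyclic a t) = removeArg n l a := by
        funext t
        have := t.isLt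
        simp [removeArg, hp]
      have hlp' : cyclic a n = 1 := (congrArg (cyclic a) hp).symm.trans hl'
      obtain ⟨m, rfl⟩ := Nat.exists_eq_succ_of_ne_zero (hp ▸ c0 : n ≠ 0)
      rw [hr, if_neg c1, hlp', add_zero, S.r_one, hp]
      simp [pow_succ]

end Bimodules

/-! ### Hochschild chains with coefficients in a bimodule, and the cap product. -/

section CoefficientChains

variable (k : Type u) [Field k] (A : Type v) [Ring A] [Algebra k A]

set_option linter.unusedSectionVars false

/-- The vector space `(A / k)^{⊗ n}`. -/
def BarPower (n : ℕ) : Type (max u v) :=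
  (⨂[k] _ : Fin n, A) ⧸ Submodule.span k
    {z | ∃ (a : Fin n → A) (l : Fin n), a l = 1 ∧ z = PiTensorProduct.tprod k a}

instance (n : ℕ) : AddCommGroup (BarPower k A n) := inferInstanceAs (AddCommGroup (_ ⧸ _))

instance (n : ℕ) : Module k (BarPower k A n) :=
  inferInstanceAs (Module k (_ ⧸ Submodule.span k _))

/-- `(a_1, …, a_n) ↦ a_1 ⊗ ⋯ ⊗ a_n` -/
def barMk (n : ℕ) : MultilinearMap k (fun _ : Fin n => A) (BarPower k A n) :=
  (Submodule.mkQ _ : _ →ₗ[k] BarPower k A n).compMultilinearMap (PiTensorProduct.tprod k)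

variable {k A}

lemma barMk_mem (n : ℕ) : barMk k A n ∈ normalized k A (BarPower k A n) n := by
  intro a l hl
  exact (Submodule.Quotient.mk_eq_zero _).mpr (Submodule.subset_span ⟨a, l, hl, rfl⟩)

/-- The linear map on `(A / k)^{⊗ n}` induced by a normalized multilinear map. -/
def barLift {E : Type*} [AddCommGroup E] [Module k E] {n : ℕ} (f : normalized k A E n) :
    BarPower k A n →ₗ[k] E :=
  Submodule.liftQ _ (PiTensorProduct.lift f.1) <| by
    rw [Submodule.span_le]
    rintro _ ⟨a, l, hl, rfl⟩
    simpa using f.2 a l hl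

lemma barLift_mk {E : Type*} [AddCommGroup E] [Module k E] {n : ℕ} (f : normalized k A E n)
    (a : Fin n → A) : barLift f (barMk k A n a) = f.1 a :=
  PiTensorProduct.lift.tprod a

variable (k) in
/-- The element `w_0 ⊗ ⋯ ⊗ w_{n-1}` given by the beginning of a sequence. -/
def barSeq (n : ℕ) (w : ℕ → A) : BarPower k A n := barMk k A n fun j => w j

lemma barSeq_congr {n : ℕ} {w w' : ℕ → A} (h : ∀ j < n, w j = w' j) :
    barSeq k n w = barSeq k n w' := by
  rw [barSeq, barSeq]
  congr 1
  funext j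
  exact h j j.isLt

lemma bar_hom_ext {E : Type*} [AddCommGroup E] [Module k E] {n : ℕ}
    {f g : BarPower k A n →ₗ[k] E} (h : ∀ w, f (barSeq k n w) = g (barSeq k n w)) : f = g := by
  refine Submodule.linearMap_qext _ (PiTensorProduct.ext ?_)
  ext a
  have ha : a = fun j : Fin n => cyclic a j := by funext j; rw [cyclic_val]
  rw [ha]
  exact h (cyclic a)

variable {M : Type*} [AddCommGroup M] [Module k M]

lemma tensor_bar_hom_ext {E : Type*} [AddCommGroup E] [Module k E] {n : ℕ}
    {f g : M ⊗[k] BarPower k A n →ₗ[k] E}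
    (h : ∀ m w, f (m ⊗ₜ barSeq k n w) = g (m ⊗ₜ barSeq k n w)) : f = g :=
  TensorProduct.ext (LinearMap.ext fun m => bar_hom_ext fun w => h m w)

/-- The bimodule structure on linear maps from a bimodule to a vector space. -/
def homBimod (S : Bimod k A M) (Y : Type*) [AddCommGroup Y] [Module k Y] :
    Bimod k A (M →ₗ[k] Y) where
  l := (LinearMap.llcomp k M M Y).flip ∘ₗ S.r
  r := (LinearMap.llcomp k M M Y).flip ∘ₗ S.l
  l_one f := by ext m; simp [S.r_one]
  r_one f := by ext m; simp [S.l_one]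
  l_mul a b f := by ext m; simp [S.r_mul]
  r_mul a b f := by ext m; simp [S.l_mul]
  comm a b f := by ext m; simp [S.comm]

variable (k A M) in
/-- The cochain `(a_1, …, a_n) ↦ (m ↦ m ⊗ a_1 ⊗ ⋯ ⊗ a_n)`. -/
def tensorMk (n : ℕ) :
    MultilinearMap k (fun _ : Fin n => A) (M →ₗ[k] M ⊗[k] BarPower k A n) :=
  (TensorProduct.mk k M (BarPower k A n)).flip.compMultilinearMap (barMk k A n)

lemma tensorMk_mem (n : ℕ) : tensorMk k A M n ∈ normalized k A _ n := by
  intro a l hl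
  simp [tensorMk, barMk_mem n a l hl]

/-- The Hochschild differential on chains `M ⊗ (A / k)^{⊗ n}` with coefficients in a bimodule. -/
def bdry (S : Bimod k A M) (n : ℕ) :
    M ⊗[k] BarPower k A (n + 1) →ₗ[k] M ⊗[k] BarPower k A n :=
  TensorProduct.lift
    (barLift ⟨coboundary (homBimod S _) n (tensorMk k A M n), coboundary_mem _ (tensorMk_mem n)⟩).flip

lemma bdry_tmul_mk (S : Bimod k A M) (n : ℕ) (m : M) (a : Fin (n + 1) → A) :
    bdry S n (m ⊗ₜ barMk k A (n + 1) a) = coboundary (homBimod S _) n (tensorMk k A M n) a m := by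
  simp [bdry, barLift_mk]

lemma bdry_seq (S : Bimod k A M) (n : ℕ) (m : M) (w : ℕ → A) :
    bdry S n (m ⊗ₜ barSeq k (n + 1) w) =
      S.r (w 0) m ⊗ₜ barSeq k n (tailSeq w)
      + ∑ i ∈ Finset.range n, (-1 : k) ^ (i + 1) • (m ⊗ₜ[k] barSeq k n (ins (mulMap k A) i w))
      + (-1 : k) ^ (n + 1) • (S.l (w n) m ⊗ₜ[k] barSeq k n w) := by
  rw [barSeq, bdry_tmul_mk, coboundary_seq]
  simp [homBimod, tensorMk, barSeq, tailSeq]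

lemma comp_coboundary_homBimod (S : Bimod k A M) {Y Y' : Type*} [AddCommGroup Y] [Module k Y]
    [AddCommGroup Y'] [Module k Y'] (g : Y →ₗ[k] Y') (n : ℕ)
    (f : MultilinearMap k (fun _ : Fin n => A) (M →ₗ[k] Y)) (w : ℕ → A) :
    g ∘ₗ (coboundary (homBimod S Y) n f fun j => w j) =
      coboundary (homBimod S Y') n ((LinearMap.llcomp k M Y Y' g).compMultilinearMap f)
        fun j => w j := by
  rw [coboundary_seq, coboundary_seq]
  ext m
  simp [homBimod]

/-- The boundary is defined so that composing it with the universal cochain `tensorMk` gives the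
coboundary of the universal cochain one degree below, with values in linear maps out of `M`. Hence
`∂∂ = 0` follows from `δδ = 0`. -/
lemma bdry_bdry (S : Bimod k A M) (n : ℕ) : bdry S n ∘ₗ bdry S (n + 1) = 0 := by
  refine tensor_bar_hom_ext fun m w => ?_
  rw [LinearMap.comp_apply, barSeq, bdry_tmul_mk, ← LinearMap.comp_apply,
    comp_coboundary_homBimod S (bdry S n)]
  have : (LinearMap.llcomp k M _ _ (bdry S n)).compMultilinearMap (tensorMk k A M (n + 1)) =
      coboundary (homBimod S _) n (tensorMk k A M n) := by
    ext a m
    simp [tensorMk, bdry_tmul_mk]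
  rw [this, coboundary_coboundary]
  simp

/-- The cap product as a multilinear map:
`(a_0, …, a_n) ↦ a_0 x (a_1, …, a_p) ⊗ a_{p+1} ⊗ ⋯ ⊗ a_n` (zero unless `n = p + q`). -/
def capMulti (S : Bimod k A M) {p : ℕ} (x : MultilinearMap k (fun _ : Fin p => A) M) (n q : ℕ) :
    MultilinearMap k (fun _ : Fin (n + 1) => A) (M ⊗[k] BarPower k A q) :=
  if h : n = p + q then
    ((actLeft S.l x).domCoprod (barMk k A q)).domDomCongr
      (finSumFinEquiv.trans (finCongr (by omega)))
  else 0

lemma capMulti_seq (S : Bimod k A M) {p : ℕ} (x : MultilinearMap k (fun _ : Fin p => A) M)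
    {n q : ℕ} (h : n = p + q) (w : ℕ → A) :
    capMulti S x n q (fun j => w j) =
      S.l (w 0) (x fun j => w (j + 1)) ⊗ₜ barSeq k q (fun j => w (p + 1 + j)) := by
  simp only [capMulti, h, dif_pos]
  rfl

lemma capMulti_vanish (S : Bimod k A M) {p : ℕ} (x : normalized k A M p) (n q : ℕ)
    (a : Fin (n + 1) → A) (l : Fin (n + 1)) (h0 : (l : ℕ) ≠ 0) (hl : a l = 1) :
    capMulti S x.1 n q a = 0 := by
  by_cases h : n = p + q
  · have ha : a = fun j : Fin (n + 1) => cyclic a j := by funext j; rw [cyclic_val]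
    have hl' : cyclic a l = 1 := by rw [cyclic_val, hl]
    have := l.isLt
    rw [ha, capMulti_seq S x.1 h]
    by_cases h1 : (l : ℕ) < p + 1
    · rw [x.2 _ ⟨l - 1, by omega⟩ (by rw [← hl']; congr 1; simp only; omega), map_zero,
        TensorProduct.zero_tmul]
    · rw [barSeq, barMk_mem q _ ⟨l - (p + 1), by omega⟩ (by rw [← hl']; congr 1; simp only; omega),
        TensorProduct.tmul_zero]
  · simp [capMulti, h]

/-- The cap product with a Hochschild chain. -/
def cap (S : Bimod k A M) {p : ℕ} (n q : ℕ) :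
    normalized k A M p →ₗ[k] Chain k A n →ₗ[k] M ⊗[k] BarPower k A q where
  toFun x := chainLift (capMulti S x.1 n q) fun a l h0 hl => capMulti_vanish S x n q a l h0 hl
  map_add' x y := chain_hom_ext_seq fun w => by
    by_cases h : n = p + q
    · simp only [chainSeq, chainLift_mk, LinearMap.add_apply]
      rw [capMulti_seq _ _ h, capMulti_seq _ _ h, capMulti_seq _ _ h, ← TensorProduct.add_tmul,
        ← map_add]
      rfl
    · simp [chainSeq, chainLift_mk, capMulti, h]
  map_smul' c x := chain_hom_ext_seq fun w => by
    by_cases h : n = p + q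
    · simp only [chainSeq, chainLift_mk, LinearMap.smul_apply]
      rw [capMulti_seq _ _ h, capMulti_seq _ _ h, TensorProduct.smul_tmul', ← map_smul]
      rfl
    · simp [chainSeq, chainLift_mk, capMulti, h]

lemma cap_seq (S : Bimod k A M) {p n q : ℕ} (x : normalized k A M p) (h : n = p + q)
    (w : ℕ → A) : cap S n q x (chainSeq k n w) =
      S.l (w 0) (x.1 fun j => w (j + 1)) ⊗ₜ barSeq k q (fun j => w (p + 1 + j)) := by
  rw [← capMulti_seq S x.1 h]
  exact chainLift_mk _ (fun a l h0 hl => capMulti_vanish S x n q a l h0 hl) _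

lemma hochschildB_seq (n : ℕ) (w : ℕ → A) :
    hochschildB k A (n + 1) n (chainSeq k (n + 1) w) =
      ∑ c ∈ Finset.range (n + 1), (-1 : k) ^ c • chainSeq k n (ins (mulMap k A) c w)
      + (-1 : k) ^ (n + 1) • chainSeq k n (ins (mulMap k A) 0 (rot (n + 2) w)) := by
  rw [chainSeq, hochschildB, chainLift_mk, hochschildMulti]
  simp only [_root_.add_apply, _root_.smul_apply, _root_.sum_apply]
  congr 1
  · refine Finset.sum_congr rfl fun c hc => ?_
    rw [Finset.mem_range] at hc
    rw [chainSeq, plug_seq_zero _ _ (by omega) hc]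
  · rw [chainSeq, plug_seq _ _ (by omega) (by omega) (by omega),
      show n + 1 + 1 - (n + 1) = 1 by omega, ← rot_eq_rotBy]

lemma tmul_barSeq_congr {n : ℕ} {m m' : M} {w w' : ℕ → A} (h : m = m')
    (hw : ∀ j < n, w j = w' j) : m ⊗ₜ[k] barSeq k n w = m' ⊗ₜ barSeq k n w' := by
  rw [h, barSeq_congr hw]

/-- The cap product is compatible with the differentials. -/
lemma bdry_cap (S : Bimod k A M) {p n q : ℕ} (x : normalized k A M p) (h : n = p + q) :
    bdry S q ∘ₗ cap S (n + 1) (q + 1) x =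
      (-1 : k) ^ p • (cap S n q x ∘ₗ hochschildB k A (n + 1) n
        - cap S (n + 1) q ⟨coboundary S p x.1, coboundary_mem S x.2⟩) := by
  subst h
  refine chain_hom_ext_seq fun w => ?_
  simp only [LinearMap.comp_apply, LinearMap.smul_apply, LinearMap.sub_apply]
  rw [hochschildB_seq, cap_seq S x (by omega), bdry_seq,
    cap_seq S (⟨coboundary S p x.1, coboundary_mem S x.2⟩ : normalized k A M (p + 1)) (by omega)]
  simp only [map_add, map_sum, map_smul, cap_seq S x rfl]
  have hc := coboundary_seq S p x.1 (tailSeq w)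
  simp only [tailSeq] at hc
  rw [hc]
  -- The faces are `a_0 a_1`, products among the next letters, and products in the tail. The first
  -- two kinds occur also in the cap product with `δx` and cancel there; what remains of `δx` is `x
  -- (…) a_{p+1}`, the first face of the boundary.
  have e1 : ∑ c ∈ Finset.range (p + q + 1), (-1 : k) ^ c •
        (S.l (ins (mulMap k A) c w 0) (x.1 fun j => ins (mulMap k A) c w (j + 1)) ⊗ₜ[k]
          barSeq k q fun j => ins (mulMap k A) c w (p + 1 + j)) =
      S.l (w 0) (S.l (w 1) (x.1 fun j => w (j + 1 + 1))) ⊗ₜ[k] barSeq k q (fun j => w (p + 2 + j))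
      + ∑ i ∈ Finset.range p, (-1 : k) ^ (i + 1) •
        (S.l (w 0) (x.1 fun j => ins (mulMap k A) i (tailSeq w) j) ⊗ₜ[k]
          barSeq k q (fun j => w (p + 2 + j)))
      + ∑ i ∈ Finset.range q, (-1 : k) ^ (p + 1 + i) •
        (S.l (w 0) (x.1 fun j => w (j + 1)) ⊗ₜ[k]
          barSeq k q (ins (mulMap k A) i fun j => w (p + 1 + j))) := by
    rw [show p + q + 1 = (p + 1) + q by omega, Finset.sum_range_add, Finset.sum_range_succ',
      add_comm (Finset.sum (Finset.range p) _)]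
    congr 1
    · congr 1
      · rw [pow_zero, one_smul]
        refine tmul_barSeq_congr ?_ fun j _ => ?_
        · rw [ins_apply_self, mulMap_apply, S.l_mul]
          congr 3
        · rw [ins_apply_gt _ _ (by omega)]; congr 1; omega
      · refine Finset.sum_congr rfl fun i hi => ?_
        rw [Finset.mem_range] at hi
        congr 1
        refine tmul_barSeq_congr ?_ fun j _ => ?_
        · rw [ins_apply_lt _ _ (by omega), ← tailSeq_ins_succ]
          rfl
        · rw [ins_apply_gt _ _ (by omega)]; congr 1; omega
    · refine Finset.sum_congr rfl fun i hi => ?_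
      rw [Finset.mem_range] at hi
      congr 1
      refine tmul_barSeq_congr ?_ fun j _ => ?_
      · rw [ins_apply_lt _ _ (by omega)]
        congr 2
        funext j
        rw [ins_apply_lt _ _ (by omega)]
      · rcases lt_trichotomy j i with h | h | h
        · rw [ins_apply_lt _ _ (by omega), ins_apply_lt _ _ h]
        · subst h
          rw [ins_apply_self, ins_apply_self]
          congr 1
          funext t
          congr 1; omega
        · rw [ins_apply_gt _ _ (by omega), ins_apply_gt _ _ h]
          congr 1; omega
  have e2 : S.l (ins (mulMap k A) 0 (rot (p + q + 2) w) 0)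
        (x.1 fun j => ins (mulMap k A) 0 (rot (p + q + 2) w) (j + 1)) ⊗ₜ[k]
          barSeq k q (fun j => ins (mulMap k A) 0 (rot (p + q + 2) w) (p + 1 + j)) =
      S.l (w (p + 1 + q)) (S.l (w 0) (x.1 fun j => w (j + 1))) ⊗ₜ[k]
        barSeq k q (fun j => w (p + 1 + j)) := by
    refine tmul_barSeq_congr ?_ fun j _ => ?_
    · rw [ins_apply_self, mulMap_apply, S.l_mul]
      have r0 : rot (p + q + 2) w (0 + ((0 : Fin 2) : ℕ)) = w (p + 1 + q) := by
        simp only [rot]; rw [if_pos (by simp)]; congr 1; omega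
      have r1 : rot (p + q + 2) w (0 + ((1 : Fin 2) : ℕ)) = w 0 := by
        simp [rot]
      rw [r0, r1]
      congr 3
      funext j
      have := j.isLt
      rw [ins_apply_gt _ _ (by omega), rot, if_neg (by omega), if_pos (by omega)]
      congr 1
    · rw [ins_apply_gt _ _ (by omega), rot, if_neg (by omega), if_pos (by omega)]
      congr 1; omega
  have sgn1 : (-1 : k) ^ p * (-1 : k) ^ p = 1 := by
    rw [← pow_add, Even.neg_one_pow ⟨p, rfl⟩]
  have e3 : ∑ i ∈ Finset.range q, (-1 : k) ^ (p + 1 + i) •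
        (S.l (w 0) (x.1 fun j => w (j + 1)) ⊗ₜ[k]
          barSeq k q (ins (mulMap k A) i fun j => w (p + 1 + j))) =
      (-1 : k) ^ p • ∑ i ∈ Finset.range q, (-1 : k) ^ (i + 1) •
        (S.l (w 0) (x.1 fun j => w (j + 1)) ⊗ₜ[k]
          barSeq k q (ins (mulMap k A) i fun j => w (p + 1 + j))) := by
    rw [Finset.smul_sum]
    refine Finset.sum_congr rfl fun i _ => ?_
    rw [smul_smul, ← pow_add, show p + 1 + i = p + (i + 1) by omega]
  have e4 : tailSeq (fun j => w (p + 1 + j)) = fun j => w (p + 2 + j) := by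
    funext j
    simp only [tailSeq]
    congr 1; omega
  rw [e1, e2, e3, e4, S.comm]
  simp only [map_add, map_sum, map_smul, TensorProduct.add_tmul, TensorProduct.sum_tmul,
    ← TensorProduct.smul_tmul', zero_add, add_zero, show p + 1 + 1 = p + 2 from rfl]
  rw [show p + q + 1 = p + (q + 1) by omega, pow_add _ p (q + 1), pow_succ _ p, mul_neg_one,
    neg_smul]
  generalize (∑ i ∈ Finset.range q, (-1 : k) ^ (i + 1) • _ : M ⊗[k] BarPower k A q) = Z
  generalize (∑ i ∈ Finset.range p, (-1 : k) ^ (i + 1) • _ : M ⊗[k] BarPower k A q) = Z'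
  rw [mul_smul]
  simp only [smul_add, smul_sub, smul_smul, smul_neg]
  simp only [← mul_assoc, sgn1, one_mul, one_smul]
  abel

end CoefficientChains

/-! ### The cone of the cap product and its behaviour under change of coefficients. -/

section CapCone

variable {k : Type u} [Field k] {A : Type v} [Ring A] [Algebra k A]
variable {M : Type*} [AddCommGroup M] [Module k M]
variable {M' : Type*} [AddCommGroup M'] [Module k M']
variable {M'' : Type*} [AddCommGroup M''] [Module k M'']

variable (k A M) in
/-- The space underlying the cone of the cap product with a Hochschild chain. -/
abbrev ConeObj := ((p : ℕ) → normalized k A M p) × ((q : ℕ) → M ⊗[k] BarPower k A q)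

/-- The Hochschild coboundary on normalized cochains. -/
def normD (S : Bimod k A M) (p : ℕ) : normalized k A M p →ₗ[k] normalized k A M (p + 1) :=
  (coboundary S p).restrict fun _ => coboundary_mem S

lemma normD_normD (S : Bimod k A M) (p : ℕ) (x : normalized k A M p) :
    normD S (p + 1) (normD S p x) = 0 :=
  Subtype.ext (coboundary_coboundary S p x.1)

lemma cap_eq_zero (S : Bimod k A M) {p n q : ℕ} (h : n ≠ p + q) (x : normalized k A M p) :
    cap S n q x = 0 :=
  chain_hom_ext_seq fun w => by simp [cap, chainSeq, chainLift_mk, capMulti, h]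

/-- The differential on families of cochains, `x ↦ ((-1)^{p} δ x_p)_{p+1}`. -/
def famD (S : Bimod k A M) (x : (p : ℕ) → normalized k A M p) : (p : ℕ) → normalized k A M p
  | 0 => 0
  | p + 1 => (-1 : k) ^ p • normD S p (x p)

/-- The differential of the cone of the cap product with a Hochschild chain. -/
def coneD (S : Bimod k A M) {d : ℕ} (η : Chain k A d) : ConeObj k A M →ₗ[k] ConeObj k A M where
  -- For `q > d` the truncated index `d - q` is `0`, but then the cap product vanishes for reasons
  -- of degree.
  toFun y := (famD S y.1, fun q => cap S d q (y.1 (d - q)) η + bdry S q (y.2 (q + 1)))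
  map_add' y y' := by
    ext1
    · funext p
      rcases p with _ | p <;> simp [famD]
    · funext q
      simp only [Prod.fst_add, Prod.snd_add, Pi.add_apply, map_add, LinearMap.add_apply]
      abel
  map_smul' c y := by
    ext1
    · funext p
      rcases p with _ | p <;> simp [famD, smul_comm c]
    · funext q
      simp

lemma coneD_fst_zero (S : Bimod k A M) {d : ℕ} (η : Chain k A d) (y : ConeObj k A M) :
    (coneD S η y).1 0 = 0 := rfl

lemma coneD_fst_succ (S : Bimod k A M) {d : ℕ} (η : Chain k A d) (y : ConeObj k A M) (p : ℕ) :
    (coneD S η y).1 (p + 1) = (-1 : k) ^ p • normD S p (y.1 p) := rfl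

lemma coneD_snd (S : Bimod k A M) {d : ℕ} (η : Chain k A d) (y : ConeObj k A M) (q : ℕ) :
    (coneD S η y).2 q = cap S d q (y.1 (d - q)) η + bdry S q (y.2 (q + 1)) := rfl

lemma cap_index (S : Bimod k A M) {n q p p' : ℕ} (y : (p : ℕ) → normalized k A M p)
    (h : p = p') : cap S n q (y p) = cap S n q (y p') := by subst h; rfl

/-- For a cycle `η`, `bdry_cap` says that the boundary of `x ∩ η` is `-(-1)^p` times `δx ∩ η`; the
sign in `famD` is chosen to cancel this. -/
lemma coneD_coneD (S : Bimod k A M) {d : ℕ} {η : Chain k A d}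
    (hη : ∀ n, hochschildB k A d n η = 0) (y : ConeObj k A M) :
    coneD S η (coneD S η y) = 0 := by
  ext1
  · funext p
    rcases p with _ | _ | p
    · rfl
    · rw [coneD_fst_succ, coneD_fst_zero]
      simp
    · rw [coneD_fst_succ, coneD_fst_succ, map_smul, normD_normD]
      simp
  · funext q
    rw [coneD_snd, coneD_snd, map_add, ← LinearMap.comp_apply (bdry S q) (bdry S (q + 1)),
      bdry_bdry, LinearMap.zero_apply, add_zero]
    -- For `q ≥ d` the index `d - q` is `0`, where the differential of a family has no component.
    by_cases h : q < d
    · obtain ⟨p, rfl⟩ : ∃ p, d = p + q + 1 := ⟨d - q - 1, by omega⟩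
      rw [cap_index S _ (show p + q + 1 - q = p + 1 by omega), coneD_fst_succ,
        cap_index S y.1 (show p + q + 1 - (q + 1) = p by omega)]
      have := LinearMap.congr_fun (bdry_cap S (y.1 p) (rfl : p + q = p + q)) η
      simp only [LinearMap.comp_apply, LinearMap.smul_apply, LinearMap.sub_apply, hη, map_zero,
        zero_sub] at this
      rw [this, map_smul, LinearMap.smul_apply, smul_neg]
      exact add_neg_cancel _
    · rw [cap_index S _ (show d - q = 0 by omega), coneD_fst_zero,
        cap_eq_zero S (show d ≠ d - (q + 1) + (q + 1) by omega)]
      simp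

/-- Maps of bimodules. -/
structure IsBimodHom (S : Bimod k A M) (S' : Bimod k A M') (f : M →ₗ[k] M') : Prop where
  map_l : ∀ a m, f (S.l a m) = S'.l a (f m)
  map_r : ∀ a m, f (S.r a m) = S'.r a (f m)

variable (A) in
/-- Linear maps act on the cone. -/
def coneMap : (M →ₗ[k] M') →ₗ[k] ConeObj k A M →ₗ[k] ConeObj k A M' where
  toFun f :=
    { toFun := fun y => (fun p => ⟨f.compMultilinearMap (y.1 p).1, fun a l hl => by
          simp [(y.1 p).2 a l hl]⟩, fun q => f.rTensor _ (y.2 q))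
      map_add' := fun y y' => by
        ext1
        · funext p
          apply Subtype.ext
          ext a
          simp
        · funext q
          simp
      map_smul' := fun c y => by
        ext1
        · funext p
          apply Subtype.ext
          ext a
          simp
        · funext q
          simp }
  map_add' f g := by
    refine LinearMap.ext fun y => ?_
    ext1
    · funext p
      apply Subtype.ext
      ext a
      simp
    · funext q
      simp [LinearMap.rTensor_add]
  map_smul' c f := by
    refine LinearMap.ext fun y => ?_
    ext1
    · funext p
      apply Subtype.ext
      ext a
      simp
    · funext q
      simp [LinearMap.rTensor_smul]

lemma coneMap_fst (f : M →ₗ[k] M') (y : ConeObj k A M) (p : ℕ) :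
    ((coneMap A f y).1 p).1 = f.compMultilinearMap (y.1 p).1 := rfl

lemma coneMap_snd (f : M →ₗ[k] M') (y : ConeObj k A M) (q : ℕ) :
    (coneMap A f y).2 q = f.rTensor _ (y.2 q) := rfl

lemma coneMap_comp (g : M' →ₗ[k] M'') (f : M →ₗ[k] M') (y : ConeObj k A M) :
    coneMap A g (coneMap A f y) = coneMap A (g ∘ₗ f) y := by
  ext1
  · rfl
  · funext q
    rw [coneMap_snd, coneMap_snd, coneMap_snd, LinearMap.rTensor_comp, LinearMap.comp_apply]

lemma coneMap_id (y : ConeObj k A M) : coneMap A LinearMap.id y = y := by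
  ext1
  · rfl
  · funext q
    rw [coneMap_snd, LinearMap.rTensor_id, LinearMap.id_apply]

/-- Cap product and boundary use only the two multiplications, so bimodule maps commute with the
differential. `coneMap` is defined for all linear maps because linear splittings are needed in
`CapAcyclic.of_exact`. -/
lemma coneD_coneMap {S : Bimod k A M} {S' : Bimod k A M'} {f : M →ₗ[k] M'}
    (hf : IsBimodHom S S' f) {d : ℕ} (η : Chain k A d) (y : ConeObj k A M) :
    coneD S' η (coneMap A f y) = coneMap A f (coneD S η y) := by
  have hcap : ∀ (p q : ℕ) (x : normalized k A M p) (x' : normalized k A M' p)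
      (_ : x'.1 = f.compMultilinearMap x.1), cap S' d q x' = f.rTensor _ ∘ₗ cap S d q x := by
    intro p q x x' hx
    by_cases h : d = p + q
    · refine chain_hom_ext_seq fun w => ?_
      rw [LinearMap.comp_apply, cap_seq S' x' h, cap_seq S x h, LinearMap.rTensor_tmul, hf.map_l, hx]
      rfl
    · rw [cap_eq_zero _ h, cap_eq_zero _ h, LinearMap.comp_zero]
  have hb : ∀ q, bdry S' q ∘ₗ f.rTensor _ = f.rTensor _ ∘ₗ bdry S q := by
    intro q
    refine tensor_bar_hom_ext fun m w => ?_
    simp only [LinearMap.comp_apply, LinearMap.rTensor_tmul, bdry_seq, map_add, map_sum, map_smul,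
      hf.map_l, hf.map_r]
  ext1
  · funext p
    rcases p with _ | p
    · apply Subtype.ext
      ext a
      simp [coneMap_fst, coneD_fst_zero]
    · rw [coneD_fst_succ]
      apply Subtype.ext
      rw [coneMap_fst, coneD_fst_succ]
      ext a
      have ha : a = fun j : Fin (p + 1) => cyclic a j := by funext j; rw [cyclic_val]
      have e1 : (normD S' p ((coneMap A f y).1 p)).1 a = f ((normD S p (y.1 p)).1 a) := by
        have h1 := coboundary_seq S' p (f.compMultilinearMap (y.1 p).1) (cyclic a)
        have h2 := coboundary_seq S p (y.1 p).1 (cyclic a)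
        rw [← ha] at h1 h2
        refine h1.trans (Eq.trans ?_ (congrArg f h2.symm))
        simp [hf.map_l, hf.map_r]
      simp [e1]
  · funext q
    rw [coneD_snd, coneMap_snd, coneMap_snd, coneD_snd, map_add,
      hcap _ _ (y.1 (d - q)) _ (coneMap_fst f y _), LinearMap.comp_apply,
      ← LinearMap.comp_apply (bdry S' q), hb, LinearMap.comp_apply]

/-- The cap product with `η` is a quasi-isomorphism for coefficients in the bimodule: its cone
is acyclic. -/
def CapAcyclic (S : Bimod k A M) {d : ℕ} (η : Chain k A d) : Prop :=
  ∀ y, coneD S η y = 0 → ∃ y', coneD S η y' = y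

/-- The hypothesis exhibits `M'` as a direct summand of a finite power of `M`. A cycle is pushed to
each copy, bounded there, and the bounding elements are pushed back and added. -/
lemma CapAcyclic.of_sum {S : Bimod k A M} {S' : Bimod k A M'} {d : ℕ} {η : Chain k A d}
    (h : CapAcyclic S η) {ι : Type*} [Fintype ι] (f : ι → M →ₗ[k] M') (g : ι → M' →ₗ[k] M)
    (hf : ∀ j, IsBimodHom S S' (f j)) (hg : ∀ j, IsBimodHom S' S (g j))
    (hfg : ∑ j, f j ∘ₗ g j = LinearMap.id) : CapAcyclic S' η := by
  intro y hy
  have h1 : ∀ j, ∃ z, coneD S η z = coneMap A (g j) y := fun j =>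
    h _ (by rw [coneD_coneMap (hg j), hy, map_zero])
  choose z hz using h1
  refine ⟨∑ j, coneMap A (f j) (z j), ?_⟩
  rw [map_sum]
  simp only [coneD_coneMap (hf _), hz, coneMap_comp]
  rw [← LinearMap.sum_apply, ← map_sum, hfg, coneMap_id]

/-- A short exact sequence of coefficients splits over the field `k`, hence gives a short exact
sequence of cones; acyclicity of the first two terms forces that of the third by the usual diagram
chase. -/
lemma CapAcyclic.of_exact {S' : Bimod k A M'} {S : Bimod k A M} {S'' : Bimod k A M''} {d : ℕ}
    {η : Chain k A d} (hη : ∀ n, hochschildB k A d n η = 0) (h' : CapAcyclic S' η)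
    (h : CapAcyclic S η) {i : M' →ₗ[k] M} {f : M →ₗ[k] M''} (hi : IsBimodHom S' S i)
    (hf : IsBimodHom S S'' f) (hinj : Function.Injective i) (hsurj : Function.Surjective f)
    (hex : ∀ m, f m = 0 ↔ ∃ m', i m' = m) : CapAcyclic S'' η := by
  -- A retraction and a section that are only `k`-linear; they act on the cones without commuting
  -- with the differentials.
  obtain ⟨r, hr⟩ := i.exists_leftInverse_of_injective (LinearMap.ker_eq_bot.mpr hinj)
  obtain ⟨s, hs⟩ := f.exists_rightInverse_of_surjective (LinearMap.range_eq_top.mpr hsurj)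
  have hfi : f ∘ₗ i = 0 := LinearMap.ext fun m => (hex _).mpr ⟨m, rfl⟩
  have hsum : ∀ m, f m = 0 → i (r m) = m := by
    intro m hm
    obtain ⟨m', rfl⟩ := (hex m).mp hm
    rw [← LinearMap.comp_apply r, hr, LinearMap.id_apply]
  have hcone : ∀ z : ConeObj k A M, coneMap A f z = 0 →
      coneMap A i (coneMap A r z) = z := by
    -- The element `m - s (f m)` lies in the kernel of `f`, where `i ∘ r` is the identity. Written
    -- as an equation of linear maps, this passes to cones.
    have hdec : i ∘ₗ r = LinearMap.id - (LinearMap.id - i ∘ₗ r) ∘ₗ s ∘ₗ f := by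
      ext m
      have h1 := hsum (m - s (f m)) (by
        rw [map_sub, sub_eq_zero]; exact (LinearMap.congr_fun hs (f m)).symm)
      simp only [map_sub] at h1
      simp only [LinearMap.comp_apply, LinearMap.sub_apply, LinearMap.id_apply]
      rw [sub_eq_iff_eq_add] at h1
      rw [h1]
      abel
    intro z hz
    rw [coneMap_comp, hdec, map_sub, LinearMap.sub_apply, ← coneMap_comp, ← coneMap_comp, hz,
      map_zero, map_zero, sub_zero, coneMap_id]
  intro y hy
  -- The chase: `y` is lifted along `s`; the differential of the lift comes from `M'`, is a cycle
  -- there, and so is the differential of some `w`.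
  have hy' : coneMap A f (coneMap A s y) = y := by rw [coneMap_comp, hs, coneMap_id]
  have h1 : coneMap A f (coneD S η (coneMap A s y)) = 0 := by
    rw [← coneD_coneMap hf, hy', hy]
  have h2 := hcone _ h1
  have h3 : coneD S' η (coneMap A r (coneD S η (coneMap A s y))) = 0 := by
    have : coneMap A i (coneD S' η (coneMap A r (coneD S η (coneMap A s y)))) = 0 := by
      rw [← coneD_coneMap hi, h2, coneD_coneD S hη]
    have := congrArg (coneMap A r) this
    rwa [coneMap_comp, hr, coneMap_id, map_zero] at this
  obtain ⟨w, hw⟩ := h' _ h3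
  -- The lift corrected by `w` is a cycle over `M` and still maps to `y`, so the image of a bounding
  -- element bounds `y`.
  obtain ⟨v, hv⟩ := h (coneMap A s y - coneMap A i w) (by
    rw [map_sub, coneD_coneMap hi, hw, h2, sub_self])
  refine ⟨coneMap A f v, ?_⟩
  rw [coneD_coneMap hf, hv, map_sub, hy', coneMap_comp, hfi, map_zero, LinearMap.zero_apply,
    sub_zero]

end CapCone

/-! ### Coefficients in `A ⊗ A`: the bar resolution and non-degeneracy. -/

section FreeBimodule

variable (k : Type u) [Field k] (A : Type v) [Ring A] [Algebra k A]

/-- The outer bimodule structure on `A ⊗ A`. -/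
def tensBimod : Bimod k A (A ⊗[k] A) where
  l := LinearMap.rTensorHom A ∘ₗ LinearMap.mul k A
  r := LinearMap.lTensorHom A ∘ₗ (LinearMap.mul k A).flip
  l_one m := by
    have : LinearMap.mul k A 1 = LinearMap.id := by ext; simp
    simp [this]
  r_one m := by
    have : (LinearMap.mul k A).flip 1 = LinearMap.id := by ext; simp
    simp [this]
  l_mul a b m := by
    have : LinearMap.mul k A (a * b) = LinearMap.mul k A a ∘ₗ LinearMap.mul k A b := by
      ext; simp [mul_assoc]
    simp [this, LinearMap.rTensor_comp]
  r_mul a b m := by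
    have : (LinearMap.mul k A).flip (a * b) =
        (LinearMap.mul k A).flip b ∘ₗ (LinearMap.mul k A).flip a := by
      ext; simp [mul_assoc]
    simp [this, LinearMap.lTensor_comp]
  comm a b m := by
    simp only [LinearMap.comp_apply, LinearMap.coe_rTensorHom, LinearMap.coe_lTensorHom]
    rw [← LinearMap.comp_apply, ← LinearMap.comp_apply, LinearMap.lTensor_comp_rTensor,
      LinearMap.rTensor_comp_lTensor]

variable {k A}

lemma tensBimod_l (a x y : A) : (tensBimod k A).l a (x ⊗ₜ y) = (a * x) ⊗ₜ y := rfl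

lemma tensBimod_r (a x y : A) : (tensBimod k A).r a (x ⊗ₜ y) = x ⊗ₜ (y * a) := rfl

variable (k A)

/-- `(y, a_1 ⊗ ⋯ ⊗ a_n) ↦ y ⊗ a_1 ⊗ ⋯ ⊗ a_n` -/
def barCons (n : ℕ) : A →ₗ[k] BarPower k A n →ₗ[k] BarPower k A (n + 1) where
  toFun y := barLift ⟨(barMk k A (n + 1)).curryLeft y, fun a l hl => by
    rw [MultilinearMap.curryLeft_apply]
    exact barMk_mem (n + 1) _ l.succ (by simpa using hl)⟩
  map_add' y y' := bar_hom_ext fun w => by simp [barSeq, barLift_mk]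
  map_smul' c y := bar_hom_ext fun w => by simp [barSeq, barLift_mk]

variable {k A}

/-- Prepend an entry to a sequence. -/
def consSeq (y : A) (w : ℕ → A) : ℕ → A
  | 0 => y
  | j + 1 => w j

lemma barCons_seq (n : ℕ) (y : A) (w : ℕ → A) :
    barCons k A n y (barSeq k n w) = barSeq k (n + 1) (consSeq y w) := by
  simp only [barCons, LinearMap.coe_mk, AddHom.coe_mk, barSeq, barLift_mk]
  rw [MultilinearMap.curryLeft_apply]
  congr 1
  funext j
  refine Fin.cases rfl (fun j => rfl) j

variable (k A)

/-- The contracting homotopy `(x ⊗ y) ⊗ a ↦ (x ⊗ 1) ⊗ y ⊗ a` of the bar resolution. -/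
def barHomotopy (n : ℕ) :
    (A ⊗[k] A) ⊗[k] BarPower k A n →ₗ[k] (A ⊗[k] A) ⊗[k] BarPower k A (n + 1) :=
  TensorProduct.lift (TensorProduct.lift
    { toFun := fun x => (LinearMap.llcomp k _ _ _
        (TensorProduct.mk k (A ⊗[k] A) (BarPower k A (n + 1)) (x ⊗ₜ 1))) ∘ₗ barCons k A n
      map_add' := fun x x' => by
        refine LinearMap.ext fun y => LinearMap.ext fun z => ?_
        simp [TensorProduct.add_tmul]
      map_smul' := fun c x => by
        refine LinearMap.ext fun y => LinearMap.ext fun z => ?_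
        simp [TensorProduct.smul_tmul'] })

/-- The augmentation `(x ⊗ y) ⊗ 1 ↦ y x` of the bar resolution. -/
def barAug : (A ⊗[k] A) ⊗[k] BarPower k A 0 →ₗ[k] A :=
  innerContract k A 1 ∘ₗ (TensorProduct.rid k (A ⊗[k] A)).toLinearMap ∘ₗ
    LinearMap.lTensor _ (barLift ⟨MultilinearMap.constOfIsEmpty k _ 1, fun _ l => l.elim0⟩)

variable {k A}

lemma barHomotopy_seq (n : ℕ) (x y : A) (w : ℕ → A) :
    barHomotopy k A n ((x ⊗ₜ y) ⊗ₜ barSeq k n w) =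
      (x ⊗ₜ 1) ⊗ₜ barSeq k (n + 1) (consSeq y w) := by
  rw [← barCons_seq]
  simp [barHomotopy]

lemma barAug_seq (m : A ⊗[k] A) (w : ℕ → A) :
    barAug k A (m ⊗ₜ barSeq k 0 w) = innerContract k A 1 m := by
  simp [barAug, barSeq, barLift_mk]

lemma tens_bar_hom_ext {E : Type*} [AddCommGroup E] [Module k E] {n : ℕ}
    {f g : (A ⊗[k] A) ⊗[k] BarPower k A n →ₗ[k] E}
    (h : ∀ x y w, f ((x ⊗ₜ y) ⊗ₜ barSeq k n w) = g ((x ⊗ₜ y) ⊗ₜ barSeq k n w)) : f = g := by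
  refine TensorProduct.ext (TensorProduct.ext ?_)
  refine LinearMap.ext fun x => LinearMap.ext fun y => bar_hom_ext fun w => h x y w

lemma add_neg_one_smul {E : Type*} [AddCommGroup E] [Module k E] (a b : E) :
    a + (-1 : k) • b = a - b := by
  rw [neg_one_smul, sub_eq_add_neg]

lemma sub_sub_eq_zero {E : Type*} [AddCommGroup E] {a b c : E} (h : b = a) (hc : c = 0) :
    a - b - c = 0 := by
  rw [h, hc, sub_self, sub_zero]

lemma homotopy_sum_cancel {E : Type*} [AddCommGroup E] [Module k E] (n : ℕ) (X Y W : E)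
    (Z : ℕ → E) :
    X + (∑ i ∈ Finset.range n, (-1 : k) ^ (i + 1 + 1) • Z i + (-1 : k) ^ (0 + 1) • Y)
      + (-1 : k) ^ (n + 1 + 1) • W
      + (Y + ∑ i ∈ Finset.range n, (-1 : k) ^ (i + 1) • Z i + (-1 : k) ^ (n + 1) • W) = X := by
  simp only [pow_succ _ (_ + 1), mul_neg_one, neg_smul, zero_add, Finset.sum_neg_distrib, pow_one,
    one_smul]
  abel

/-- Chains with coefficients in `A ⊗ A` are the bar resolution of `A`. The first face of the
homotopy multiplies `y` back into the coefficient and recovers the element; all other faces cancel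
against the homotopy applied to the boundary. -/
lemma bdry_barHomotopy_succ (n : ℕ) :
    bdry (tensBimod k A) (n + 1) ∘ₗ barHomotopy k A (n + 1)
      + barHomotopy k A n ∘ₗ bdry (tensBimod k A) n = LinearMap.id := by
  refine tens_bar_hom_ext fun x y w => ?_
  simp only [LinearMap.add_apply, LinearMap.comp_apply, LinearMap.id_apply, barHomotopy_seq,
    bdry_seq, map_add, map_sum, map_smul, tensBimod_l, tensBimod_r]
  rw [Finset.sum_range_succ']
  have e1 : barSeq k (n + 1) (tailSeq (consSeq y w)) = barSeq k (n + 1) w := rfl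
  have e2 : barSeq k (n + 1) (ins (mulMap k A) 0 (consSeq y w)) =
      barSeq k (n + 1) (consSeq (y * w 0) (tailSeq w)) := by
    refine barSeq_congr fun j _ => ?_
    rcases j with _ | j
    · rw [ins_apply_self, mulMap_apply]; rfl
    · rw [ins_apply_gt _ _ (by omega)]; rfl
  have e3 : ∀ i, barSeq k (n + 1) (ins (mulMap k A) (i + 1) (consSeq y w)) =
      barSeq k (n + 1) (consSeq y (ins (mulMap k A) i w)) := by
    intro i
    refine barSeq_congr fun j _ => ?_
    rcases j with _ | j
    · rw [ins_apply_lt _ _ (by omega)]; rfl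
    · rcases lt_trichotomy j i with h | h | h
      · rw [ins_apply_lt _ _ (by omega)]
        simp only [consSeq]
        rw [ins_apply_lt _ _ (by omega)]
      · subst h
        rw [ins_apply_self]
        simp only [consSeq]
        rw [ins_apply_self, mulMap_apply, mulMap_apply]
        rfl
      · obtain ⟨j, rfl⟩ : ∃ t, j = t + 1 := ⟨j - 1, by omega⟩
        rw [ins_apply_gt _ _ (by omega)]
        simp only [consSeq]
        rw [ins_apply_gt _ _ (by omega)]
        rfl
  simp only [e1, e2, e3, consSeq, one_mul]
  exact homotopy_sum_cancel n _ _ _ _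

/-- In degree `0` the homotopy identity has the extra term `a ↦ a ⊗ 1` after the augmentation, which
the hypothesis removes. -/
lemma bdry_barHomotopy_zero (z : (A ⊗[k] A) ⊗[k] BarPower k A 0) (hz : barAug k A z = 0) :
    bdry (tensBimod k A) 0 (barHomotopy k A 0 z) = z := by
  have h : bdry (tensBimod k A) 0 ∘ₗ barHomotopy k A 0 = LinearMap.id -
      ((TensorProduct.mk k (A ⊗[k] A) _).flip (barSeq k 0 0) ∘ₗ
        (TensorProduct.mk k A A).flip 1) ∘ₗ barAug k A := by
    refine tens_bar_hom_ext fun x y w => ?_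
    simp only [LinearMap.sub_apply, LinearMap.comp_apply, LinearMap.id_apply, barHomotopy_seq,
      bdry_seq, tensBimod_l, tensBimod_r, barAug_seq]
    have : ∀ w : ℕ → A, barSeq k 0 w = barSeq k 0 0 := fun w =>
      barSeq_congr fun j h => absurd h (by omega)
    rw [this w, this (consSeq y w), this (tailSeq _)]
    simp only [consSeq, one_mul, mul_one, Finset.range_zero, Finset.sum_empty, add_zero, zero_add,
      pow_one, innerContract, LinearMap.coe_mk, AddHom.coe_mk, TensorProduct.lift.tmul,
      LinearMap.mk₂_apply, LinearMap.flip_apply, TensorProduct.mk_apply]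
    exact add_neg_one_smul (k := k) (E := (A ⊗[k] A) ⊗[k] BarPower k A 0) _ _
  have := LinearMap.congr_fun h z
  simpa [hz] using this

lemma barAug_bdry (z : (A ⊗[k] A) ⊗[k] BarPower k A 1) :
    barAug k A (bdry (tensBimod k A) 0 z) = 0 := by
  have h : barAug k A ∘ₗ bdry (tensBimod k A) 0 = 0 := by
    refine tens_bar_hom_ext fun x y w => ?_
    simp [bdry_seq, tensBimod_l, tensBimod_r, barAug_seq, innerContract, mul_assoc]
  exact LinearMap.congr_fun h z

/-- The augmentation turns the degree `0` part of the cap product into the evaluation by which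
non-degeneracy is formulated. -/
lemma barAug_cap {d : ℕ} (x : normalized k A (A ⊗[k] A) d) (η : Chain k A d) :
    barAug k A (cap (tensBimod k A) d 0 x η) = evalChain x η := by
  have h : barAug k A ∘ₗ cap (tensBimod k A) d 0 x = evalChain x := by
    refine chain_hom_ext_seq fun w => ?_
    rw [LinearMap.comp_apply, cap_seq _ _ (by omega), barAug_seq, evalChain, chainSeq, chainLift_mk]
    have : ∀ m : A ⊗[k] A, innerContract k A 1 ((tensBimod k A).l (w 0) m) =
        innerContract k A (w 0) m := by
      intro m
      induction m with
      | zero => simp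
      | tmul x y => simp [tensBimod_l, innerContract, mul_assoc]
      | add a b ha hb => simp only [map_add, ha, hb]
    rw [this]
    rfl
  exact LinearMap.congr_fun h η

/-- For a non-degenerate Hochschild cycle, the cap product is a quasi-isomorphism with
coefficients in the bimodule `A ⊗ A`. -/
lemma IsNondegenerate.capAcyclic {d : ℕ} {η : Chain k A d} (h : IsNondegenerate η)
    (hη : ∀ n, hochschildB k A d n η = 0) : CapAcyclic (tensBimod k A) η := by
  set S := tensBimod k A
  intro y hy
  have hx : ∀ p, (y.1 p).1 ∈ biCocycles k A p := by
    intro p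
    refine ⟨(y.1 p).2, ?_⟩
    have := congrArg (fun z : ConeObj k A (A ⊗[k] A) => z.1 (p + 1)) hy
    simp only [coneD_fst_succ, Prod.fst_zero, Pi.zero_apply] at this
    rw [smul_eq_zero_iff_right (pow_ne_zero _ (by simp))] at this
    exact congrArg Subtype.val this
  have hb : ∀ p, (y.1 p).1 ∈ biCoboundaries k A p := by
    intro p
    by_cases hp : p = d
    · subst hp
      refine h.injective _ (hx p) ?_
      -- In the cone `y_d ∩ η` is minus a boundary, and the augmentation kills boundaries; so the
      -- evaluation of `y_d` on `η` is zero.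
      have := congrArg (fun z : ConeObj k A (A ⊗[k] A) => barAug k A (z.2 0)) hy
      simpa [coneD_snd, S, barAug_bdry, barAug_cap] using this
    · exact h.acyclic p hp (hx p)
  -- There are no nonzero coboundaries in degree `0`.
  have h0 : y.1 0 = 0 := Subtype.ext (by simpa [biCoboundaries] using hb 0)
  have hs : ∀ p, ∃ x : normalized k A (A ⊗[k] A) p, normD S p x = y.1 (p + 1) := by
    intro p
    obtain ⟨x, hx, hxy⟩ := hb (p + 1)
    exact ⟨⟨x, hx⟩, Subtype.ext hxy⟩
  choose x hx' using hs
  have hsg : ∀ p, (-1 : k) ^ p * (-1) ^ p = 1 := fun p => by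
    rw [← pow_add, Even.neg_one_pow ⟨p, rfl⟩]
  -- A cocycle whose evaluation equals the augmentation left over after the cochain part has been
  -- bounded; subtracting its cap product makes the remainder exact in the bar resolution.
  obtain ⟨f, hf, hfe⟩ := h.surjective
    (barAug k A ((y - coneD S η (fun p => (-1 : k) ^ p • x p, 0)).2 0))
  let g : (p : ℕ) → normalized k A (A ⊗[k] A) p := Pi.single d ⟨f, hf.1⟩
  have hg : ∀ p, normD S p (g p) = 0 := by
    intro p
    by_cases hp : p = d
    · subst hp
      simp only [g, Pi.single_eq_same]
      exact Subtype.ext hf.2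
    · simp [g, Pi.single_eq_of_ne hp]
  -- The remainder `v` has no cochain part, is a cycle of the bar resolution and has augmentation
  -- zero, so the contracting homotopy bounds it. The signs `(-1)^p` on `x p` undo those of `famD`.
  obtain ⟨v, hv⟩ : ∃ v, v = y - coneD S η (fun p => (-1 : k) ^ p • x p, 0) - coneD S η (g, 0) :=
    ⟨_, rfl⟩
  have hv1 : v.1 = 0 := by
    rw [hv]
    funext p
    rcases p with _ | p
    · exact sub_sub_eq_zero h0.symm rfl
    · refine sub_sub_eq_zero (b := (-1 : k) ^ p • normD S p ((-1 : k) ^ p • x p))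
        (c := (-1 : k) ^ p • normD S p (g p)) ?_ ?_
      · rw [map_smul, hx', smul_smul, hsg, one_smul]
      · rw [hg, smul_zero]
  have hv2 : barAug k A (v.2 0) = 0 := by
    rw [hv]
    simp only [Prod.snd_sub, Pi.sub_apply, map_sub] at hfe ⊢
    rw [← hfe, coneD_snd]
    simp [g, S, barAug_cap]
  have hv3 : ∀ q, bdry S q (v.2 (q + 1)) = 0 := by
    intro q
    have : coneD S η v = 0 := by
      rw [hv, map_sub, map_sub, coneD_coneD S hη, coneD_coneD S hη, hy]
      simp
    have := congrArg (fun z : ConeObj k A (A ⊗[k] A) => z.2 q) this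
    simpa [coneD_snd, hv1] using this
  let t : (q : ℕ) → (A ⊗[k] A) ⊗[k] BarPower k A q
    | 0 => 0
    | q + 1 => barHomotopy k A q (v.2 q)
  have ht : coneD S η (0, t) = v := by
    ext1
    · rw [hv1]
      funext p
      rcases p with _ | p
      · rfl
      · simp [coneD_fst_succ]
    · funext q
      simp only [coneD_snd, Pi.zero_apply, map_zero, LinearMap.zero_apply, zero_add, t]
      rcases q with _ | q
      · exact bdry_barHomotopy_zero _ hv2
      · have := LinearMap.congr_fun (bdry_barHomotopy_succ (k := k) (A := A) q) (v.2 (q + 1))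
        simpa [S, hv3] using this
  refine ⟨(fun p => (-1 : k) ^ p • x p, 0) + (g, 0) + (0, t), ?_⟩
  rw [map_add, map_add, ht, hv]
  abel

end FreeBimodule

/-! ### Extension of the duality from `A ⊗ A` to projective bimodules and to `A`. -/

section Resolutions

variable {k : Type u} [Field k] {A : Type v} [Ring A] [Algebra k A]

variable (k A) in
/-- The bimodule underlying a module over `A ⊗ A^op`. -/
def bimodOfModule (M : Type*) [AddCommGroup M] [Module k M] [Module (A ⊗[k] Aᵐᵒᵖ) M]
    [IsScalarTower k (A ⊗[k] Aᵐᵒᵖ) M] : Bimod k A M where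
  l := LinearMap.mk₂ k (fun a m => (a ⊗ₜ[k] (1 : Aᵐᵒᵖ)) • m)
    (fun a b m => by rw [TensorProduct.add_tmul, add_smul])
    (fun c a m => by rw [← TensorProduct.smul_tmul', smul_assoc])
    (fun a m m' => smul_add _ m m')
    (fun c a m => by rw [← algebraMap_smul (A ⊗[k] Aᵐᵒᵖ) c m, ← smul_assoc, ← algebraMap_smul (A ⊗[k] Aᵐᵒᵖ) c (_ • m), ← smul_assoc, smul_eq_mul, smul_eq_mul, Algebra.commutes])
  r := LinearMap.mk₂ k (fun a m => ((1 : A) ⊗ₜ[k] MulOpposite.op a) • m)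
    (fun a b m => by rw [MulOpposite.op_add, TensorProduct.tmul_add, add_smul])
    (fun c a m => by rw [MulOpposite.op_smul, TensorProduct.tmul_smul, smul_assoc])
    (fun a m m' => smul_add _ m m')
    (fun c a m => by rw [← algebraMap_smul (A ⊗[k] Aᵐᵒᵖ) c m, ← smul_assoc, ← algebraMap_smul (A ⊗[k] Aᵐᵒᵖ) c (_ • m), ← smul_assoc, smul_eq_mul, smul_eq_mul, Algebra.commutes])
  l_one m := by
    simp only [LinearMap.mk₂_apply]
    rw [← Algebra.TensorProduct.one_def, one_smul]
  r_one m := by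
    simp only [LinearMap.mk₂_apply]
    rw [MulOpposite.op_one, ← Algebra.TensorProduct.one_def, one_smul]
  l_mul a b m := by
    simp only [LinearMap.mk₂_apply]
    rw [smul_smul, Algebra.TensorProduct.tmul_mul_tmul, one_mul]
  r_mul a b m := by
    simp only [LinearMap.mk₂_apply]
    rw [smul_smul, Algebra.TensorProduct.tmul_mul_tmul, one_mul, MulOpposite.op_mul]
  comm a b m := by
    simp only [LinearMap.mk₂_apply]
    rw [smul_smul, smul_smul, Algebra.TensorProduct.tmul_mul_tmul,
      Algebra.TensorProduct.tmul_mul_tmul, one_mul, one_mul, mul_one, mul_one]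

variable {M : Type*} [AddCommGroup M] [Module k M] [Module (A ⊗[k] Aᵐᵒᵖ) M]
  [IsScalarTower k (A ⊗[k] Aᵐᵒᵖ) M]
variable {M' : Type*} [AddCommGroup M'] [Module k M'] [Module (A ⊗[k] Aᵐᵒᵖ) M']
  [IsScalarTower k (A ⊗[k] Aᵐᵒᵖ) M']

lemma isBimodHom_restrictScalars (f : M →ₗ[A ⊗[k] Aᵐᵒᵖ] M') :
    IsBimodHom (bimodOfModule k A M) (bimodOfModule k A M') (f.restrictScalars k) where
  map_l a m := f.map_smul (a ⊗ₜ[k] (1 : Aᵐᵒᵖ)) m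
  map_r a m := f.map_smul ((1 : A) ⊗ₜ[k] MulOpposite.op a) m

variable (k A) in
/-- The isomorphism of `A ⊗ A` with the free module of rank one over `A ⊗ A^op`. -/
def tensToEnv : (A ⊗[k] A) ≃ₗ[k] (A ⊗[k] Aᵐᵒᵖ) :=
  LinearEquiv.lTensor A (MulOpposite.opLinearEquiv k)

lemma isBimodHom_tensToEnv : IsBimodHom (tensBimod k A) (bimodOfModule k A (A ⊗[k] Aᵐᵒᵖ))
    (tensToEnv k A).toLinearMap where
  map_l a m := by
    induction m with
    | zero => simp
    | add x y hx hy => simp only [map_add, hx, hy]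
    | tmul x y =>
      rw [tensBimod_l]
      change (a * x) ⊗ₜ[k] MulOpposite.op y =
        (a ⊗ₜ[k] (1 : Aᵐᵒᵖ)) * (x ⊗ₜ[k] MulOpposite.op y)
      rw [Algebra.TensorProduct.tmul_mul_tmul, one_mul]
  map_r a m := by
    induction m with
    | zero => simp
    | add x y hx hy => simp only [map_add, hx, hy]
    | tmul x y =>
      rw [tensBimod_r]
      change x ⊗ₜ[k] MulOpposite.op (y * a) =
        ((1 : A) ⊗ₜ[k] MulOpposite.op a) * (x ⊗ₜ[k] MulOpposite.op y)
      rw [Algebra.TensorProduct.tmul_mul_tmul, one_mul, MulOpposite.op_mul]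

variable {N N' : Type*} [AddCommGroup N] [Module k N] [AddCommGroup N'] [Module k N']

lemma IsBimodHom.symm {S : Bimod k A N} {S' : Bimod k A N'} {f : N ≃ₗ[k] N'}
    (hf : IsBimodHom S S' f.toLinearMap) : IsBimodHom S' S f.symm.toLinearMap where
  map_l a m := f.injective (by
    have := hf.map_l a (f.symm m)
    simp only [LinearEquiv.coe_coe, LinearEquiv.apply_symm_apply] at this ⊢
    exact this.symm)
  map_r a m := f.injective (by
    have := hf.map_r a (f.symm m)
    simp only [LinearEquiv.coe_coe, LinearEquiv.apply_symm_apply] at this ⊢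
    exact this.symm)

lemma CapAcyclic.of_equiv {S : Bimod k A N} {S' : Bimod k A N'} {f : N ≃ₗ[k] N'}
    (hf : IsBimodHom S S' f.toLinearMap) {d : ℕ} {η : Chain k A d} (h : CapAcyclic S η) :
    CapAcyclic S' η :=
  h.of_sum (ι := Unit) (fun _ => f.toLinearMap) (fun _ => f.symm.toLinearMap) (fun _ => hf)
    (fun _ => hf.symm) (by ext; simp)

/-- On a zero space the identity is the empty sum. This starts the induction along a finite
resolution. -/
lemma CapAcyclic.of_subsingleton {S : Bimod k A N} {d : ℕ} {η : Chain k A d} (h : CapAcyclic S η)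
    [Subsingleton N'] (S' : Bimod k A N') : CapAcyclic S' η :=
  h.of_sum (ι := Empty) Empty.elim Empty.elim (fun j => j.elim) (fun j => j.elim)
    (Subsingleton.elim _ _)

/-- A finitely generated projective is a summand of a free module of finite rank; the coordinates of
a splitting supply the maps required by `CapAcyclic.of_sum`. -/
lemma CapAcyclic.of_projective {d : ℕ} {η : Chain k A d} (h : CapAcyclic (tensBimod k A) η)
    [Module.Finite (A ⊗[k] Aᵐᵒᵖ) M] [Module.Projective (A ⊗[k] Aᵐᵒᵖ) M] :
    CapAcyclic (bimodOfModule k A M) η := by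
  have h' := h.of_equiv isBimodHom_tensToEnv
  obtain ⟨n, f, hf⟩ := Module.Finite.exists_fin' (A ⊗[k] Aᵐᵒᵖ) M
  obtain ⟨s, hs⟩ := Module.projective_lifting_property f LinearMap.id hf
  refine h'.of_sum (ι := Fin n)
    (fun j => (f ∘ₗ LinearMap.single (A ⊗[k] Aᵐᵒᵖ) (fun _ => A ⊗[k] Aᵐᵒᵖ) j).restrictScalars k)
    (fun j => ((LinearMap.proj j : (Fin n → A ⊗[k] Aᵐᵒᵖ) →ₗ[A ⊗[k] Aᵐᵒᵖ] _) ∘ₗ s).restrictScalars k)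
    (fun j => isBimodHom_restrictScalars _) (fun j => isBimodHom_restrictScalars _) ?_
  ext m
  have hm := LinearMap.congr_fun hs m
  rw [LinearMap.comp_apply, LinearMap.id_apply] at hm
  rw [LinearMap.sum_apply, LinearMap.id_apply]
  refine Eq.trans ?_ hm
  change ∑ j, f (Pi.single j (s m j)) = _
  rw [← map_sum, Finset.univ_sum_single]

/-- If the cap product is a quasi-isomorphism with coefficients in the terms of a finite
resolution, then also with coefficients in the resolved module. -/
lemma capAcyclic_of_resolution {d : ℕ} {η : Chain k A d} (hη : ∀ n, hochschildB k A d n η = 0)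
    (X : ℕ → Type*) [∀ n, AddCommGroup (X n)] [∀ n, Module k (X n)]
    [∀ n, Module (A ⊗[k] Aᵐᵒᵖ) (X n)] [∀ n, IsScalarTower k (A ⊗[k] Aᵐᵒᵖ) (X n)]
    (δ : ∀ n, X (n + 1) →ₗ[A ⊗[k] Aᵐᵒᵖ] X n)
    (hδ : ∀ n, LinearMap.range (δ (n + 1)) = LinearMap.ker (δ n))
    (π : X 0 →ₗ[A ⊗[k] Aᵐᵒᵖ] M) (hπ : LinearMap.range (δ 0) = LinearMap.ker π)
    (hsurj : Function.Surjective π) (hX : ∀ n, CapAcyclic (bimodOfModule k A (X n)) η)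
    (N : ℕ) (hN : ∀ n ≥ N, Subsingleton (X n)) : CapAcyclic (bimodOfModule k A M) η := by
  -- Descending induction on `n`, with `m` measuring the distance to the end of the resolution,
  -- where the terms and so the images vanish.
  have hr : ∀ m n, N ≤ n + m →
      CapAcyclic (bimodOfModule k A (LinearMap.range (δ n))) η := by
    intro m
    induction m with
    | zero =>
      intro n hn
      have := hN n hn
      exact (hX n).of_subsingleton _
    | succ m ih =>
      intro n hn
      -- The exact sequence is `0 → im δ_{n+1} → X_{n+1} → im δ_n → 0`.
      refine (ih (n + 1) (by omega)).of_exact hη (hX (n + 1))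
        (i := (LinearMap.range (δ (n + 1))).subtype.restrictScalars k)
        (f := (δ n).rangeRestrict.restrictScalars k)
        (isBimodHom_restrictScalars _) (isBimodHom_restrictScalars _) Subtype.val_injective
        (δ n).surjective_rangeRestrict fun y => ?_
      have : δ n y = 0 ↔ y ∈ LinearMap.range (δ (n + 1)) := by rw [hδ, LinearMap.mem_ker]
      constructor
      · intro h
        exact ⟨⟨y, this.mp (congrArg Subtype.val h)⟩, rfl⟩
      · rintro ⟨z, rfl⟩
        exact Subtype.ext (this.mpr z.2)
  refine (hr N 0 (by omega)).of_exact hη (hX 0)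
    (i := (LinearMap.range (δ 0)).subtype.restrictScalars k) (f := π.restrictScalars k)
    (isBimodHom_restrictScalars _) (isBimodHom_restrictScalars _) Subtype.val_injective hsurj
    fun y => ?_
  have : π y = 0 ↔ y ∈ LinearMap.range (δ 0) := by rw [hπ, LinearMap.mem_ker]
  constructor
  · intro h
    exact ⟨⟨y, this.mp h⟩, rfl⟩
  · rintro ⟨z, rfl⟩
    exact this.mpr z.2

variable (k A) in
/-- The bimodule `A`. -/
def regBimod : Bimod k A A where
  l := LinearMap.mul k A
  r := (LinearMap.mul k A).flip
  l_one m := by simp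
  r_one m := by simp
  l_mul a b m := by simp [mul_assoc]
  r_mul a b m := by simp [mul_assoc]
  comm a b m := by simp [mul_assoc]

/-- Van den Bergh's argument: duality for the free bimodule extends to finitely generated
projectives and then, through a finite resolution, to `A`. -/
lemma HomologicallySmooth.capAcyclic (hs : HomologicallySmooth k A) {d : ℕ} {η : Chain k A d}
    (hη : ∀ n, hochschildB k A d n η = 0) (h : CapAcyclic (tensBimod k A) η) :
    CapAcyclic (regBimod k A) η := by
  let : Module (A ⊗[k] Aᵐᵒᵖ) A := instModuleTensorProductMop k A
  have : IsScalarTower k (A ⊗[k] Aᵐᵒᵖ) A := ⟨fun c x m => by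
    induction x with
    | zero =>
      have h0 : (0 : A ⊗[k] Aᵐᵒᵖ) • m = 0 := Module.zero_smul (R := A ⊗[k] Aᵐᵒᵖ) m
      rw [smul_zero, h0, smul_zero]
    | add x y hx hy => rw [smul_add, add_smul, add_smul, hx, hy, smul_add]
    | tmul x y =>
      rw [TensorProduct.smul_tmul', TensorProduct.Algebra.smul_def, TensorProduct.Algebra.smul_def,
        smul_assoc]⟩
  obtain ⟨P, hfin, N, hN⟩ := hs
  -- The terms of the resolution are only modules over `A ⊗ A^op`; their `k`-structure is the one
  -- induced by the structure map.
  let (n : ℕ) : Module k (P.complex.X n) := Module.compHom _ (algebraMap k (A ⊗[k] Aᵐᵒᵖ))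
  have (n : ℕ) : IsScalarTower k (A ⊗[k] Aᵐᵒᵖ) (P.complex.X n) :=
    ⟨fun c x m => by
      have hc : c • x = algebraMap k (A ⊗[k] Aᵐᵒᵖ) c * x := Algebra.smul_def c x
      rw [hc]
      exact mul_smul _ _ _⟩
  have hA : CapAcyclic (bimodOfModule k A A) η := by
    refine capAcyclic_of_resolution hη (fun n => P.complex.X n)
      (fun n => (P.complex.d (n + 1) n).hom)
      (fun n => (ShortComplex.moduleCat_exact_iff_range_eq_ker _).mp (P.exact_succ n))
      (P.π.f 0).hom
      ((ShortComplex.moduleCat_exact_iff_range_eq_ker _).mp P.exact₀)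
      ((ModuleCat.epi_iff_surjective _).mp inferInstance) (fun n => ?_) N (fun n hn => ?_)
    · have := hfin n
      have : Module.Projective (A ⊗[k] Aᵐᵒᵖ) (P.complex.X n) :=
        (IsProjective.iff_projective _).mpr (P.projective n)
      exact h.of_projective
    · exact ModuleCat.subsingleton_of_isZero (hN n hn)
  -- It remains to see that the module structure over `A ⊗ A^op` on `A` gives back the usual
  -- multiplications.
  refine hA.of_equiv (f := LinearEquiv.refl k A) ⟨fun a m => ?_, fun a m => ?_⟩
  · change (a ⊗ₜ[k] (1 : Aᵐᵒᵖ)) • m = a * m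
    rw [TensorProduct.Algebra.smul_def, one_smul, smul_eq_mul]
  · change ((1 : A) ⊗ₜ[k] MulOpposite.op a) • m = m * a
    rw [TensorProduct.Algebra.smul_def, one_smul, op_smul_eq_mul]

end Resolutions

/-! ### Coefficients in `A`: the cap product is the contraction of Hochschild chains. -/

section RegularCoefficients

variable {k : Type u} [Field k] {A : Type v} [Ring A] [Algebra k A]

variable (k A) in
/-- `a_0 ⊗ (a_1 ⊗ ⋯ ⊗ a_n) ↦ a_0 ⊗ a_1 ⊗ ⋯ ⊗ a_n` -/
def toChain (n : ℕ) : A ⊗[k] BarPower k A n →ₗ[k] Chain k A n :=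
  TensorProduct.lift
    { toFun := fun a => barLift ⟨(chainMk k A n).curryLeft a, fun b l hl => by
        rw [MultilinearMap.curryLeft_apply]
        exact chainMk_eq_zero _ l.succ (by simpa using hl) (by simp)⟩
      map_add' := fun a a' => bar_hom_ext fun w => by simp [barSeq, barLift_mk]
      map_smul' := fun c a => bar_hom_ext fun w => by simp [barSeq, barLift_mk] }

lemma toChain_seq (n : ℕ) (a : A) (w : ℕ → A) :
    toChain k A n (a ⊗ₜ barSeq k n w) = chainSeq k n (consSeq a w) := by
  simp only [toChain, TensorProduct.lift.tmul, LinearMap.coe_mk, AddHom.coe_mk, barSeq, barLift_mk]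
  rw [MultilinearMap.curryLeft_apply, chainSeq]
  congr 1
  funext j
  refine Fin.cases rfl (fun j => rfl) j

variable (k A) in
/-- The inverse of `toChain`. -/
def ofChain (n : ℕ) : Chain k A n →ₗ[k] A ⊗[k] BarPower k A n :=
  -- Capping with the `0`-cochain `1` just separates `a_0` from the other entries.
  cap (regBimod k A) n n (p := 0) ⟨MultilinearMap.constOfIsEmpty k _ 1, fun _ l => l.elim0⟩

lemma ofChain_seq (n : ℕ) (w : ℕ → A) :
    ofChain k A n (chainSeq k n w) = w 0 ⊗ₜ barSeq k n (tailSeq w) := by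
  rw [ofChain, cap_seq _ _ (by omega)]
  refine tmul_barSeq_congr ?_ fun j _ => ?_
  · simp [regBimod]
  · simp only [tailSeq]; congr 1; omega

lemma chainSeq_congr {n : ℕ} {w w' : ℕ → A} (h : ∀ j ≤ n, w j = w' j) :
    chainSeq k n w = chainSeq k n w' := by
  rw [chainSeq, chainSeq]
  congr 1
  funext j
  exact h j (by omega)

lemma toChain_ofChain (n : ℕ) (c : Chain k A n) : toChain k A n (ofChain k A n c) = c := by
  have : toChain k A n ∘ₗ ofChain k A n = LinearMap.id := chain_hom_ext_seq fun w => by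
    rw [LinearMap.comp_apply, ofChain_seq, toChain_seq, LinearMap.id_apply]
    refine chainSeq_congr fun j _ => ?_
    rcases j with _ | j <;> rfl
  exact LinearMap.congr_fun this c

lemma ofChain_toChain (n : ℕ) (z : A ⊗[k] BarPower k A n) :
    ofChain k A n (toChain k A n z) = z := by
  have : ofChain k A n ∘ₗ toChain k A n = LinearMap.id := tensor_bar_hom_ext fun m w => by
    rw [LinearMap.comp_apply, toChain_seq, ofChain_seq, LinearMap.id_apply]
    rfl
  exact LinearMap.congr_fun this z

lemma toChain_cap {p n q : ℕ} (x : normalized k A A p) (c : Chain k A n) :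
    toChain k A q (cap (regBimod k A) n q x c) = contraction x n q c := by
  by_cases h : n = p + q
  · have : toChain k A q ∘ₗ cap (regBimod k A) n q x = contraction x n q :=
      chain_hom_ext_seq fun w => by
        have h0 : contraction x n q (chainSeq k n w) =
            plug (n + 1) (chainMk k A q) (actLeft (LinearMap.mul k A) x.1) 0 0 fun j => w j :=
          chainLift_mk _ _ _
        rw [h0, plug_seq_zero _ _ (by omega) (by omega), LinearMap.comp_apply, cap_seq _ _ h,
          toChain_seq]
        refine chainSeq_congr fun j _ => ?_
        rcases j with _ | j
        · rw [ins_apply_self]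
          simp only [consSeq, zero_add]
          rfl
        · rw [ins_apply_gt _ _ (by omega)]
          simp only [consSeq]
          congr 1; omega
    exact LinearMap.congr_fun this c
  · rw [cap_eq_zero _ h, contraction_eq_zero x (by omega)]
    simp

lemma toChain_bdry (n : ℕ) (z : A ⊗[k] BarPower k A (n + 1)) :
    toChain k A n (bdry (regBimod k A) n z) = hochschildB k A (n + 1) n (toChain k A (n + 1) z) := by
  have : toChain k A n ∘ₗ bdry (regBimod k A) n = hochschildB k A (n + 1) n ∘ₗ toChain k A (n + 1) :=
    tensor_bar_hom_ext fun m w => by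
      rw [LinearMap.comp_apply, LinearMap.comp_apply, bdry_seq, toChain_seq, hochschildB_seq,
        Finset.sum_range_succ']
      simp only [map_add, map_sum, map_smul, toChain_seq]
      rw [add_comm (Finset.sum _ _)]
      congr 1
      · congr 1
        · rw [pow_zero, one_smul]
          refine chainSeq_congr fun j _ => ?_
          rcases j with _ | j
          · rw [ins_apply_self, mulMap_apply]; rfl
          · rw [ins_apply_gt _ _ (by omega)]; rfl
        · refine Finset.sum_congr rfl fun i _ => ?_
          congr 1
          refine chainSeq_congr fun j _ => ?_
          rcases j with _ | j
          · rw [ins_apply_lt _ _ (by omega)]; rfl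
          · rcases lt_trichotomy j i with h | h | h
            · rw [ins_apply_lt _ _ (by omega)]
              simp only [consSeq]
              rw [ins_apply_lt _ _ (by omega)]
            · subst h
              rw [ins_apply_self]
              simp only [consSeq]
              rw [ins_apply_self, mulMap_apply, mulMap_apply]
              rfl
            · obtain ⟨j, rfl⟩ : ∃ t, j = t + 1 := ⟨j - 1, by omega⟩
              rw [ins_apply_gt _ _ (by omega)]
              simp only [consSeq]
              rw [ins_apply_gt _ _ (by omega)]
              rfl
      · congr 1
        refine chainSeq_congr fun j hj => ?_
        rcases j with _ | j
        · rw [ins_apply_self, mulMap_apply]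
          simp [rot, consSeq, regBimod]
        · rw [ins_apply_gt _ _ (by omega), rot, if_neg (by omega), if_pos (by omega)]
          simp only [consSeq]
          rfl
  exact LinearMap.congr_fun this z

lemma hochschildB_hochschildB (n : ℕ) (c : Chain k A (n + 2)) :
    hochschildB k A (n + 1) n (hochschildB k A (n + 2) (n + 1) c) = 0 := by
  rw [← toChain_ofChain (n + 2) c, ← toChain_bdry, ← toChain_bdry, ← LinearMap.comp_apply (bdry _ n),
    bdry_bdry, LinearMap.zero_apply, map_zero]

/-- Identifies the differential `[μ₀, x]` with the classical coboundary, so that `d² = 0` and the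
formula for `[b, i_x]` follow from the statements with coefficients. The sign is the one built into
`famD`. -/
lemma gerstenhaber_mu_eq_coboundary {p : ℕ} (x : Cochain k A p) :
    gerstenhaber (p + 1) (mu k A) x = (-1 : k) ^ p • coboundary (regBimod k A) p x := by
  rw [gerstenhaber_mu_eq]
  ext a
  have ha : a = fun j : Fin (p + 1) => cyclic a j := by funext j; rw [cyclic_val]
  rw [ha]
  generalize cyclic a = w
  rw [_root_.smul_apply, coboundary_seq]
  simp only [_root_.add_apply, _root_.smul_apply, _root_.sum_apply]
  rw [plug_seq_zero _ _ (by omega) (by omega), plug_seq_zero _ _ (by omega) (by omega),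
    mulMap_apply, mulMap_apply, smul_add, smul_add, Finset.smul_sum, smul_smul, ← pow_add,
    Odd.neg_one_pow (n := p + (p + 1)) ⟨p, by omega⟩]
  have e1 : ∀ i ∈ Finset.range p, (-1 : k) ^ (p + 1 + i) •
      plug (p + 1) x (mulMap k A) 0 i (fun j => w j) =
      (-1 : k) ^ p • (-1 : k) ^ (i + 1) • x fun j => ins (mulMap k A) i w j := by
    intro i hi
    rw [Finset.mem_range] at hi
    rw [plug_seq_zero _ _ (by omega) hi, smul_smul, ← pow_add, show p + 1 + i = p + (i + 1) by omega]
  rw [Finset.sum_congr rfl e1]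
  have e2 : ins x 0 w ((0 : Fin 2) : ℕ) * ins x 0 w ((1 : Fin 2) : ℕ) =
      (regBimod k A).r (w p) (x fun j => w j) := by
    simp [ins, regBimod]
  have e3 : ins x 1 w ((0 : Fin 2) : ℕ) * ins x 1 w ((1 : Fin 2) : ℕ) =
      (regBimod k A).l (w 0) (x fun j => w (j + 1)) := by
    simp [ins, regBimod, add_comm]
  rw [e2, e3]
  abel

lemma normalized_gerstenhaber_mu {p : ℕ} (x : normalized k A A p)
    (hx : gerstenhaber (p + 1) (mu k A) x.1 ∈ normalized k A A (p + 1)) :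
    (⟨gerstenhaber (p + 1) (mu k A) x.1, hx⟩ : normalized k A A (p + 1)) =
      (-1 : k) ^ p • normD (regBimod k A) p x :=
  Subtype.ext (gerstenhaber_mu_eq_coboundary x.1)

lemma gerstenhaber_mu_mu {p p' p'' : ℕ} (hp : p' = p + 1) (hp' : p'' = p' + 1)
    (x : Cochain k A p) : gerstenhaber p'' (mu k A) (gerstenhaber p' (mu k A) x) = 0 := by
  subst hp hp'
  rw [gerstenhaber_mu_eq_coboundary, gerstenhaber_mu_eq_coboundary, map_smul, coboundary_coboundary,
    smul_zero, smul_zero]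

/-- The formula `[b, i_x] = - i_{dx}`. -/
lemma hochschildB_contraction {p p' : ℕ} (hp : p' = p + 1) (x : normalized k A A p)
    (hx : gerstenhaber p' (mu k A) x.1 ∈ normalized k A A p') {n m : ℕ} (h : n = m + p)
    (c : Chain k A (n + 1)) :
    hochschildB k A (m + 1) m (contraction x (n + 1) (m + 1) c)
      + (-1 : k) ^ (p + 1) • contraction x n m (hochschildB k A (n + 1) n c) =
    -contraction ⟨gerstenhaber p' (mu k A) x.1, hx⟩ (n + 1) m c := by
  subst hp
  have h1 := LinearMap.congr_fun (bdry_cap (regBimod k A) x (show n = p + m by omega)) c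
  rw [← toChain_cap, ← toChain_bdry, ← LinearMap.comp_apply (bdry _ _), h1, ← toChain_cap,
    ← toChain_cap, normalized_gerstenhaber_mu]
  simp only [LinearMap.comp_apply, LinearMap.smul_apply, LinearMap.sub_apply, map_sub, map_smul,
    smul_sub, pow_succ, mul_neg_one, neg_smul]
  rw [normD]
  simp only [LinearMap.restrict_apply]
  abel

/-- The acyclicity of the cone of the cap product, in terms of contractions. -/
lemma CapAcyclic.exists_contraction {d : ℕ} {η : Chain k A d} (h : CapAcyclic (regBimod k A) η)
    (x : (p : ℕ) → normalized k A A p) (hx : ∀ p, gerstenhaber (p + 1) (mu k A) (x p).1 = 0)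
    (z : (q : ℕ) → Chain k A q)
    (hz : ∀ q, contraction (x (d - q)) d q η + hochschildB k A (q + 1) q (z (q + 1)) = 0) :
    ∃ (w : (p : ℕ) → normalized k A A p) (t : (q : ℕ) → Chain k A q),
      x 0 = 0 ∧ (∀ p, gerstenhaber (p + 1) (mu k A) (w p).1 = (x (p + 1)).1) ∧
      ∀ q, contraction (w (d - q)) d q η + hochschildB k A (q + 1) q (t (q + 1)) = z q := by
  -- Because of the sign in `famD`, the cochain part of the cone differential is exactly `[μ₀, ·]`.
  obtain ⟨y, hy⟩ := h (x, fun q => ofChain k A q (z q)) (by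
    ext1
    · funext p
      rcases p with _ | p
      · rfl
      · exact Subtype.ext ((gerstenhaber_mu_eq_coboundary (x p).1).symm.trans (hx p))
    · funext q
      rw [← ofChain_toChain q ((coneD _ η _).2 q), coneD_snd, map_add, toChain_cap, toChain_bdry,
        toChain_ofChain, hz]
      simp)
  have h1 : ∀ p, (coneD (regBimod k A) η y).1 p = x p := fun p => by rw [hy]
  have h2 : ∀ q, (coneD (regBimod k A) η y).2 q = ofChain k A q (z q) := fun q => by rw [hy]
  refine ⟨y.1, fun q => toChain k A q (y.2 q), (h1 0).symm, fun p => ?_, fun q => ?_⟩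
  · rw [← h1 (p + 1)]
    exact gerstenhaber_mu_eq_coboundary (y.1 p).1
  · rw [← toChain_cap, ← toChain_bdry, ← map_add, ← coneD_snd, h2, toChain_ofChain]

end RegularCoefficients

/-! ### The Cartan formula on the negative cyclic complex. -/

section NegativeCyclicIdentities

variable {k : Type u} [Field k] {A : Type v} [Ring A] [Algebra k A]

lemma mulU_zero (η : CycTotal k A) (n : ℕ) : mulU k A η n 0 = 0 := rfl

lemma uLinear_apply (s : ℕ → ℕ) (T : ∀ n, Chain k A (s n) →ₗ[k] Chain k A n) (η : CycTotal k A)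
    (n j : ℕ) : uLinear s T η n j = T n (η (s n) j) := rfl

lemma uLinear_mulU (s : ℕ → ℕ) (T : ∀ n, Chain k A (s n) →ₗ[k] Chain k A n) (η : CycTotal k A) :
    uLinear s T (mulU k A η) = mulU k A (uLinear s T η) := by
  funext n j
  cases j with
  | zero => rw [uLinear_apply, mulU_zero, mulU_zero, map_zero]
  | succ j => rfl

lemma mulU_injective : Function.Injective (mulU k A) := fun η ζ h => by
  funext n j
  exact congrFun (congrFun h n) (j + 1)

/-- A series without constant term is divisible by `u`; the degree drops by two. This is the
exactness of `CC^- → CC^- → C` at the middle term. -/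
lemma exists_mulU_eq {e e' : ℤ} (he : e' + 2 = e) {η : CycTotal k A} (hη : η ∈ negCyclic k A e)
    (h0 : ∀ n, η n 0 = 0) : ∃ θ ∈ negCyclic k A e', mulU k A θ = η := by
  refine ⟨fun n j => η n (j + 1), fun n j h => hη _ _ (by push_cast; omega), ?_⟩
  funext n j
  cases j with
  | zero => exact (h0 n).symm
  | succ j => rfl

lemma mulU_mem {e e' : ℤ} (he : e + 2 = e') {η : CycTotal k A} (hη : η ∈ negCyclic k A e) :
    mulU k A η ∈ negCyclic k A e' := by
  intro n j h
  cases j with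
  | zero => rfl
  | succ j => exact hη _ _ (by push_cast at h; omega)

lemma cyclicD_zero (η : CycTotal k A) (n : ℕ) :
    cyclicD k A η n 0 = hochschildB k A (n + 1) n (η (n + 1) 0) :=
  add_zero _

lemma cyclicD_succ (η : CycTotal k A) (n j : ℕ) :
    cyclicD k A η n (j + 1) = hochschildB k A (n + 1) n (η (n + 1) (j + 1))
      + connesB k A (n - 1) n (η (n - 1) j) := rfl

lemma cyclicD_mulU (η : CycTotal k A) : cyclicD k A (mulU k A η) = mulU k A (cyclicD k A η) := by
  simp only [cyclicD, LinearMap.add_apply, LinearMap.comp_apply, uLinear_mulU, map_add]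

/-- The powers of `u` separate the statement into `bb = 0`, `bB + Bb = 0` and `BB = 0`. -/
lemma cyclicD_cyclicD (η : CycTotal k A) : cyclicD k A (cyclicD k A η) = 0 := by
  funext n j
  have hB : ∀ (c : Chain k A n), hochschildB k A (n + 1) n (connesB k A n (n + 1) c)
      + connesB k A (n - 1) n (hochschildB k A n (n - 1) c) = 0 := fun c =>
    LinearMap.congr_fun (hochschildB_comp_connesB n) c
  have hBB : ∀ (l m : ℕ) (c : Chain k A l), connesB k A m n (connesB k A l m c) = 0 :=
    fun l m c => LinearMap.congr_fun
      (comp_connesB_eq_zero (fun w => connesB_chainSeq_consOne m n w)) c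
  -- The index `n - 1 + 1` differs from `n` only for `n = 0`, where `B` with values in `0`-chains is
  -- zero.
  have hidx : ∀ j, connesB k A (n - 1) n (hochschildB k A (n - 1 + 1) (n - 1) (η (n - 1 + 1) j)) =
      connesB k A (n - 1) n (hochschildB k A n (n - 1) (η n j)) := by
    intro j
    rcases n with _ | n
    · rw [connesB_eq_zero (by omega)]; rfl
    · rfl
  match j with
  | 0 =>
    rw [cyclicD_zero, cyclicD_zero, hochschildB_hochschildB]
    rfl
  | 1 =>
    rw [cyclicD_succ, cyclicD_succ, cyclicD_zero, hidx, map_add, hochschildB_hochschildB, zero_add]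
    exact hB _
  | j + 2 =>
    rw [cyclicD_succ, cyclicD_succ, cyclicD_succ, map_add, map_add, hidx, hBB,
      hochschildB_hochschildB, zero_add, add_zero]
    exact hB _

/-- The operator `i_x + u S_x`. -/
def cartanU {i : ℤ} (x : cochains k A i) : CycTotal k A →ₗ[k] CycTotal k A :=
  contractionU x + mulU k A ∘ₗ sOperatorU x

lemma cartanU_zero_apply {i : ℤ} (x : cochains k A i) (η : CycTotal k A) (n : ℕ) :
    cartanU x η n 0 = contraction ⟨x.1, x.2.1⟩ (n + (i + 1).toNat) n (η (n + (i + 1).toNat) 0) :=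
  add_zero _

lemma cartanU_succ_apply {i : ℤ} (x : cochains k A i) (η : CycTotal k A) (n j : ℕ) :
    cartanU x η n (j + 1) =
      contraction ⟨x.1, x.2.1⟩ (n + (i + 1).toNat) n (η (n + (i + 1).toNat) (j + 1))
      + sOperator ⟨x.1, x.2.1⟩ (n + (i + 1).toNat - 2) n (η (n + (i + 1).toNat - 2) j) := rfl

/-- The degree of a component occurs in its type, so equal but differently written degrees are
exchanged for the operator and the chain at once. -/
lemma component_congr {m : ℕ} (T : ∀ n, Chain k A n →ₗ[k] Chain k A m) (η : CycTotal k A) (j : ℕ)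
    {a b : ℕ} (h : a = b) : T a (η a j) = T b (η b j) := by
  subst h; rfl

lemma cochains_eq_zero {i : ℤ} (h : i < -1) (x : cochains k A i) : x = 0 :=
  Subtype.ext (x.2.2 h)

lemma contraction_add {p n m : ℕ} (x y : normalized k A A p) :
    contraction (x + y) n m = contraction x n m + contraction y n m :=
  LinearMap.ext fun c => by
    rw [LinearMap.add_apply, ← toChain_cap, ← toChain_cap, ← toChain_cap, map_add,
      LinearMap.add_apply, map_add]

lemma contraction_smul {p n m : ℕ} (c : k) (x : normalized k A A p) :
    contraction (c • x) n m = c • contraction x n m :=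
  LinearMap.ext fun z => by
    rw [LinearMap.smul_apply, ← toChain_cap, ← toChain_cap, map_smul, LinearMap.smul_apply,
      map_smul]

lemma sOperator_add {p n m : ℕ} (x y : normalized k A A p) :
    sOperator (x + y) n m = sOperator x n m + sOperator y n m :=
  chain_hom_ext fun a => by
    simp [sOperator, chainLift_mk, plug_add, smul_add, Finset.sum_add_distrib]

lemma sOperator_smul {p n m : ℕ} (c : k) (x : normalized k A A p) :
    sOperator (c • x) n m = c • sOperator x n m :=
  chain_hom_ext fun a => by
    simp [sOperator, chainLift_mk, plug_smul, Finset.smul_sum, smul_comm c]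

lemma cartanU_add {i : ℤ} (x y : cochains k A i) : cartanU (x + y) = cartanU x + cartanU y := by
  refine LinearMap.ext fun η => ?_
  have h1 := fun n m => contraction_add (n := n) (m := m) (⟨x.1, x.2.1⟩ : normalized k A A _)
    ⟨y.1, y.2.1⟩
  have h2 := fun n m => sOperator_add (n := n) (m := m) (⟨x.1, x.2.1⟩ : normalized k A A _)
    ⟨y.1, y.2.1⟩
  funext n j
  cases j with
  | zero =>
    refine (cartanU_zero_apply _ _ _).trans ((LinearMap.congr_fun (h1 _ _) _).trans ?_)
    rw [LinearMap.add_apply, LinearMap.add_apply, Pi.add_apply, Pi.add_apply, cartanU_zero_apply,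
      cartanU_zero_apply]
  | succ j =>
    refine (cartanU_succ_apply _ _ _ _).trans ((congrArg₂ (· + ·) (LinearMap.congr_fun (h1 _ _) _)
      (LinearMap.congr_fun (h2 _ _) _)).trans ?_)
    rw [LinearMap.add_apply, LinearMap.add_apply, LinearMap.add_apply, Pi.add_apply, Pi.add_apply,
      cartanU_succ_apply, cartanU_succ_apply]
    abel

lemma cartanU_smul {i : ℤ} (c : k) (x : cochains k A i) : cartanU (c • x) = c • cartanU x := by
  refine LinearMap.ext fun η => ?_
  have h1 := fun n m => contraction_smul (n := n) (m := m) c (⟨x.1, x.2.1⟩ : normalized k A A _)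
  have h2 := fun n m => sOperator_smul (n := n) (m := m) c (⟨x.1, x.2.1⟩ : normalized k A A _)
  funext n j
  cases j with
  | zero =>
    refine (cartanU_zero_apply _ _ _).trans ((LinearMap.congr_fun (h1 _ _) _).trans ?_)
    rw [LinearMap.smul_apply, LinearMap.smul_apply, Pi.smul_apply, Pi.smul_apply,
      cartanU_zero_apply]
  | succ j =>
    refine (cartanU_succ_apply _ _ _ _).trans ((congrArg₂ (· + ·) (LinearMap.congr_fun (h1 _ _) _)
      (LinearMap.congr_fun (h2 _ _) _)).trans ?_)
    rw [LinearMap.smul_apply, LinearMap.smul_apply, LinearMap.smul_apply, Pi.smul_apply,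
      Pi.smul_apply, cartanU_succ_apply, smul_add]

lemma cartanU_zero {i : ℤ} : cartanU (0 : cochains k A i) = 0 := by
  simpa using cartanU_smul (0 : k) (0 : cochains k A i)

lemma lieU_zero {i : ℤ} : lieU (0 : cochains k A i) = 0 := by
  refine LinearMap.ext fun η => ?_
  funext n j
  exact LinearMap.congr_fun (map_zero (lieDerivative (k := k) (A := A) (p := (i + 1).toNat)
    (n + (i + 1).toNat - 1) n)) _

lemma sgn_eq (i : ℤ) (h : ¬ i < -1) : sgn k i = (-1 : k) ^ ((i + 1).toNat + 1) := by
  obtain ⟨n, rfl⟩ : ∃ n : ℕ, i = (n : ℤ) - 1 := ⟨(i + 1).toNat, by omega⟩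
  rw [show ((n : ℤ) - 1 + 1).toNat = n by omega, sgn, pow_succ, Int.negOnePow_sub]
  simp

lemma cartan_component_zero {p p' : ℕ} (hp : p' = p + 1) (x : normalized k A A p)
    (hx : gerstenhaber p' (mu k A) x.1 ∈ normalized k A A p') (η : CycTotal k A) (n j : ℕ) :
    hochschildB k A (n + 1) n (contraction x (n + 1 + p) (n + 1) (η (n + 1 + p) j))
      + (-1 : k) ^ (p + 1) •
        contraction x (n + p) n (hochschildB k A (n + p + 1) (n + p) (η (n + p + 1) j)) =
    -contraction ⟨gerstenhaber p' (mu k A) x.1, hx⟩ (n + p') n (η (n + p') j) := by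
  have h := hochschildB_contraction hp x hx (rfl : n + p = n + p) (η (n + p + 1) j)
  rw [component_congr (fun N => contraction x N (n + 1)) η j (show n + 1 + p = n + p + 1 by omega),
    h, component_congr (fun N => contraction (⟨gerstenhaber p' (mu k A) x.1, hx⟩) N n) η j
      (show n + p + 1 = n + p' by omega)]

/-- This is `cartan_homotopy` with source degrees written as in `uLinear`. Truncated subtraction
changes a degree only where the operator concerned is zero. -/
lemma cartan_component_succ {p p' : ℕ} (hp : p' = p + 1) (x : normalized k A A p)
    (hx : gerstenhaber p' (mu k A) x.1 ∈ normalized k A A p') (η : CycTotal k A) (n j : ℕ) :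
    hochschildB k A (n + 1) n (sOperator x (n + 1 + p - 2) (n + 1) (η (n + 1 + p - 2) j))
      + (-1 : k) ^ (p + 1) • sOperator x (n + p - 2) n
        (hochschildB k A (n + p - 2 + 1) (n + p - 2) (η (n + p - 2 + 1) j))
      + connesB k A (n - 1) n (contraction x (n - 1 + p) (n - 1) (η (n - 1 + p) j))
      + (-1 : k) ^ (p + 1) • contraction x (n + p) n
        (connesB k A (n + p - 1) (n + p) (η (n + p - 1) j)) =
    lieDerivative (n + p - 1) n x (η (n + p - 1) j)
      - sOperator ⟨gerstenhaber p' (mu k A) x.1, hx⟩ (n + p' - 2) n (η (n + p' - 2) j) := by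
  -- For `n + p = 0` there is no source degree, and every term vanishes.
  rcases Nat.eq_zero_or_pos (n + p) with h0 | h0
  · rw [sOperator_eq_zero x (n := n + 1 + p - 2) (by omega),
      sOperator_eq_zero x (n := n + p - 2) (by omega), sOperator_eq_zero _ (n := n + p' - 2)
        (by omega), connesB_eq_zero (n := n - 1) (by omega),
      connesB_eq_zero (n := n + p - 1) (by omega), lieDerivative_eq_zero (by omega)]
    simp
  obtain ⟨N, hN⟩ : ∃ N, N + 1 = n + p := ⟨n + p - 1, by omega⟩
  have h := LinearMap.congr_fun (cartan_homotopy hp x hx hN) (η N j)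
  simp only [LinearMap.add_apply, LinearMap.sub_apply, LinearMap.smul_apply,
    LinearMap.comp_apply] at h
  rw [component_congr (fun N => sOperator x N (n + 1)) η j (show n + 1 + p - 2 = N by omega),
    component_congr (fun N => lieDerivative N n x) η j (show n + p - 1 = N by omega),
    component_congr (fun N => sOperator (⟨gerstenhaber p' (mu k A) x.1, hx⟩) N n) η j
      (show n + p' - 2 = N by omega), ← h]
  congr 1
  · congr 1
    · congr 2
      -- Here `n + p - 2` is truncated to `0`, and `S_x` between these degrees is zero on both
      -- sides.
      by_cases h1 : n + p = 1
      · rw [sOperator_eq_zero x (n := n + p - 2) (by omega),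
          sOperator_eq_zero x (n := N - 1) (by omega)]
        simp
      · obtain ⟨M, rfl⟩ : ∃ M, N = M + 1 := ⟨N - 1, by omega⟩
        exact component_congr (fun N => sOperator x (N - 1) n ∘ₗ hochschildB k A N (N - 1)) η j
          (show n + p - 2 + 1 = M + 1 by omega)
    · rcases n with _ | n
      · rw [connesB_eq_zero (by omega)]; simp
      · rw [component_congr (fun N => contraction x N (n + 1 - 1)) η j
          (show n + 1 - 1 + p = N by omega)]
  · congr 1
    have e := component_congr
      (fun M => contraction x (M + 1) n ∘ₗ connesB k A M (M + 1)) η j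
      (show n + p - 1 = N by omega)
    simp only [LinearMap.comp_apply] at e
    rw [← e, show n + p - 1 + 1 = n + p by omega]

lemma add_cartan_components {E : Type*} [AddCommGroup E] [Module k E] {r : k}
    {a a' b b' c c' e l y : E} (h : a + r • a' = -c) (h' : b + r • b' + e + r • c' = l - y) :
    a + b + e + r • (a' + c' + b') = l - (c + y) := by
  rw [sub_add_eq_sub_sub_swap, ← h', sub_eq_add_neg, ← h]
  simp only [smul_add]
  abel

/-- With `connesB_sOperator`, the reason why the Cartan formula has no terms in `u²`. -/
lemma sOperator_connesB {p : ℕ} (x : normalized k A A p) (l m n : ℕ) (c : Chain k A l) :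
    sOperator x m n (connesB k A l m c) = 0 :=
  LinearMap.congr_fun (comp_connesB_eq_zero (fun w => sOperator_chainSeq_consOne x m n w)) c

lemma connesB_sOperator {p : ℕ} (x : normalized k A A p) (l m n : ℕ) (c : Chain k A l) :
    connesB k A m n (sOperator x l m c) = 0 :=
  LinearMap.congr_fun (comp_sOperator_eq_zero x (fun w => connesB_chainSeq_consOne m n w)) c

/-- The Cartan homotopy formula on the negative cyclic complex,
`[b + u B, i_x + u S_x] = u L_x - (i_{dx} + u S_{dx})`. -/
lemma cyclicD_cartanU {i : ℤ} (x : cochains k A i) (η : CycTotal k A) :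
    cyclicD k A (cartanU x η) + sgn k i • cartanU x (cyclicD k A η) =
      mulU k A (lieU x η) - cartanU (cochainD k A i x) η := by
  by_cases hi : i < -1
  · rw [cochains_eq_zero hi x, map_zero, cartanU_zero, cartanU_zero, lieU_zero]
    simp
  rw [sgn_eq i hi]
  have hp : (i + 1 + 1).toNat = (i + 1).toNat + 1 := by omega
  have c0 := cartan_component_zero hp ⟨x.1, x.2.1⟩ (cochainD k A i x).2.1 η
  have c1 := cartan_component_succ hp ⟨x.1, x.2.1⟩ (cochainD k A i x).2.1 η
  have cl : ∀ n j, mulU k A (lieU x η) n (j + 1) =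
      lieDerivative (n + (i + 1).toNat - 1) n ⟨x.1, x.2.1⟩ (η (n + (i + 1).toNat - 1) j) :=
    fun _ _ => rfl
  have cd0 : ∀ n, cartanU (cochainD k A i x) η n 0 =
      contraction ⟨gerstenhaber (i + 1 + 1).toNat (mu k A) x.1, (cochainD k A i x).2.1⟩
        (n + (i + 1 + 1).toNat) n (η (n + (i + 1 + 1).toNat) 0) :=
    fun n => cartanU_zero_apply _ _ _
  have cd1 : ∀ n j, cartanU (cochainD k A i x) η n (j + 1) =
      contraction ⟨gerstenhaber (i + 1 + 1).toNat (mu k A) x.1, (cochainD k A i x).2.1⟩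
        (n + (i + 1 + 1).toNat) n (η (n + (i + 1 + 1).toNat) (j + 1))
      + sOperator ⟨gerstenhaber (i + 1 + 1).toNat (mu k A) x.1, (cochainD k A i x).2.1⟩
        (n + (i + 1 + 1).toNat - 2) n (η (n + (i + 1 + 1).toNat - 2) j) :=
    fun n j => cartanU_succ_apply _ _ _ _
  funext n j
  simp only [Pi.add_apply, Pi.sub_apply, Pi.smul_apply]
  -- In the constant coefficient only `[b, i_x]` is seen. The coefficient of `u` adds `[b, S_x] +
  -- [B, i_x]`; in higher ones `B S_x` and `S_x B` appear too, and vanish.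
  match j with
  | 0 =>
    rw [cyclicD_zero, cartanU_zero_apply, cartanU_zero_apply, cyclicD_zero, mulU_zero, cd0,
      zero_sub]
    exact c0 n 0
  | 1 =>
    rw [cl, cd1, cyclicD_succ, cartanU_succ_apply, cartanU_succ_apply, cartanU_zero_apply,
      cyclicD_succ, cyclicD_zero, map_add, map_add]
    exact add_cartan_components (c0 n 1) (c1 n 0)
  | j + 2 =>
    rw [cl, cd1, cyclicD_succ, cartanU_succ_apply, cartanU_succ_apply, cartanU_succ_apply,
      cyclicD_succ, cyclicD_succ, map_add, map_add, map_add, map_add, connesB_sOperator,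
      sOperator_connesB, add_zero, add_zero]
    exact add_cartan_components (c0 n (j + 2)) (c1 n (j + 1))

end NegativeCyclicIdentities

/-! ### The twisted differential, the map `Ψ`, and its bijectivity on cohomology. -/

section TwistedComplex

variable {k : Type u} [Field k] {A : Type v} [Ring A] [Algebra k A]

lemma sgn_eq_ite (n : ℤ) : sgn k n = if Even n then 1 else -1 := by
  split_ifs with h
  · rw [sgn, Int.negOnePow_even n h]; simp
  · rw [sgn, Int.negOnePow_odd n (Int.not_even_iff_odd.mp h)]; simp

lemma sgn_mul_self (n : ℤ) : sgn k n * sgn k n = 1 := by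
  rw [sgn_eq_ite]; split_ifs <;> simp

lemma sgn_smul_sgn_smul {E : Type*} [AddCommGroup E] [Module k E] (n : ℤ) (v : E) :
    sgn k n • sgn k n • v = v := by
  rw [smul_smul, sgn_mul_self, one_smul]

lemma cochainD_cochainD {i : ℤ} (x : cochains k A i) :
    cochainD k A (i + 1) (cochainD k A i x) = 0 := by
  by_cases hi : i < -1
  · rw [cochains_eq_zero hi x, map_zero, map_zero]
  · exact Subtype.ext (gerstenhaber_mu_mu (by omega) (by omega) x.1)

variable {d : ℕ} (η₀ : negCyclic k A (-d)) {i : ℤ}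

lemma twistedD_fst (y : DObj k A d i) : (twistedD η₀ i y).1 = cochainD k A i y.1 := by
  simp [twistedD, sharpD, sharpBracket, twist]

/-- The bracket with `(0, s^{-d-1} η₀)` is minus `L_x` with sign `(-1)^i` from exchanging the
factors and `(-1)^{(d+1) i}` from the shift, altogether `(-1)^{d i}`. -/
lemma twistedD_snd (y : DObj k A d i) :
    (twistedD η₀ i y).2.1 = sgn k (-d - 1) • cyclicD k A y.2.1 - sgn k (d * i) • lieU y.1 η₀.1 := by
  have hs : sgn k (i * 1) * sgn k ((-d - 1) * i) = sgn k (d * i) := by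
    simp only [sgn_eq_ite]
    generalize (d : ℤ) = e
    by_cases h1 : Even e <;> by_cases h2 : Even i <;>
      simp only [h1, h2, Int.even_sub, Int.even_mul, even_neg, Int.not_even_one] <;>
      simp
  rw [← hs, mul_smul]
  have h0 : shiftedLie d (add_comm 1 i) (0 : cochains k A 1) y.2 = 0 := by
    rw [map_zero, LinearMap.zero_apply]
  change sgn k (-d - 1) • cyclicD k A y.2.1 + ((shiftedLie d (add_comm 1 i) (0 : cochains k A 1) y.2).1
    - sgn k (i * 1) • sgn k ((-d - 1) * i) • lieU y.1 η₀.1) = _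
  rw [h0]
  change _ + (0 - _) = _
  rw [zero_sub, ← sub_eq_add_neg]

/-- The exponents `i - 1` and `(-d + 1)(i + 1)` add up to `d (i + 1)` modulo `2`. -/
lemma psi_eq (y : DObj k A d i) :
    psi η₀ y = sgn k (d * (i + 1)) • cartanU y.1 η₀.1 + mulU k A y.2.1 := by
  have hs : sgn k (i - 1) * sgn k ((-d + 1) * (i + 1)) = sgn k (d * (i + 1)) := by
    simp only [sgn_eq_ite]
    generalize (d : ℤ) = e
    by_cases h1 : Even e <;> by_cases h2 : Even i <;>
      simp only [h1, h2, Int.even_add, Int.even_sub, Int.even_mul, even_neg, Int.not_even_one] <;>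
      simp
  rw [psi, smul_smul, hs]
  rfl

lemma psi_add (y y' : DObj k A d i) : psi η₀ (y + y') = psi η₀ y + psi η₀ y' := by
  simp only [psi_eq, Prod.fst_add, Prod.snd_add, cartanU_add, LinearMap.add_apply, smul_add,
    Submodule.coe_add, map_add]
  abel

lemma psi_smul (c : k) (y : DObj k A d i) : psi η₀ (c • y) = c • psi η₀ y := by
  simp only [psi_eq, Prod.smul_fst, Prod.smul_snd, cartanU_smul, LinearMap.smul_apply, smul_add,
    Submodule.coe_smul, map_smul, smul_comm c]

lemma cartanU_mem {e e' : ℤ} (h : i + 1 + e = e') (x : cochains k A i) {η : CycTotal k A}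
    (hη : η ∈ negCyclic k A e) : cartanU x η ∈ negCyclic k A e' := by
  by_cases hi : i < -1
  · rw [cochains_eq_zero hi x, cartanU_zero]
    exact zero_mem _
  intro n j hn
  cases j with
  | zero => rw [cartanU_zero_apply, hη _ _ (by push_cast at hn ⊢; omega), map_zero]
  | succ j =>
    rw [cartanU_succ_apply, hη _ _ (by push_cast at hn ⊢; omega), map_zero, zero_add]
    -- The source degree `n + p - 2` is truncated here, and `S_x` is zero.
    by_cases h2 : n + (i + 1).toNat < 2
    · rw [sOperator_eq_zero _ (by omega)]; rfl
    · rw [hη _ _ (by push_cast at hn ⊢; omega), map_zero]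

lemma psi_mem (y : DObj k A d i) : psi η₀ y ∈ negCyclic k A (i + (-d + 1)) := by
  rw [psi_eq]
  refine add_mem (Submodule.smul_mem _ _ (cartanU_mem (by ring) _ η₀.2)) (mulU_mem (by ring) y.2.2)

variable {η₀}

lemma cyclicD_cartanU_of_cycle (h : cyclicD k A η₀.1 = 0) (x : cochains k A i) :
    cyclicD k A (cartanU x η₀.1) =
      mulU k A (lieU x η₀.1) - cartanU (cochainD k A i x) η₀.1 := by
  have := cyclicD_cartanU x η₀.1
  rwa [h, map_zero, smul_zero, add_zero] at this

/-- The map `Ψ` commutes with the differentials, up to the sign of the shift. -/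
lemma cyclicD_psi (h : cyclicD k A η₀.1 = 0) (y : DObj k A d i) :
    sgn k (-d + 1) • cyclicD k A (psi η₀ y) = psi η₀ (twistedD η₀ i y) := by
  have h1 : sgn k (d * (i + 1 + 1)) = -(sgn k (-d + 1) * sgn k (d * (i + 1))) := by
    simp only [sgn_eq_ite]
    generalize (d : ℤ) = e
    by_cases h1 : Even e <;> by_cases h2 : Even i <;>
      simp only [h1, h2, Int.even_add, Int.even_mul, even_neg, Int.not_even_one] <;>
      simp
  have h2 : sgn k (d * i) = -(sgn k (-d + 1) * sgn k (d * (i + 1))) := by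
    simp only [sgn_eq_ite]
    generalize (d : ℤ) = e
    by_cases h1 : Even e <;> by_cases h2 : Even i <;>
      simp only [h1, h2, Int.even_add, Int.even_mul, even_neg, Int.not_even_one] <;>
      simp
  have h3 : sgn k (-d - 1) = sgn k (-d + 1) := by
    simp only [sgn_eq_ite]
    generalize (d : ℤ) = e
    simp only [Int.even_add, Int.even_sub]
  -- The term `u L_x η₀` of the Cartan formula matches `u` times the twist of the differential, and
  -- `i_{dx} + u S_{dx}` matches `Ψ` on the cochain part.
  rw [psi_eq, psi_eq, twistedD_fst, twistedD_snd, h1, h2, h3, map_add, map_smul,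
    cyclicD_cartanU_of_cycle h, cyclicD_mulU, map_sub, map_smul, map_smul]
  simp only [smul_add, smul_sub, smul_smul, neg_smul]
  abel

lemma negCyclicD_negCyclicD (i : ℤ) : negCyclicD k A (i + 1) ∘ₗ negCyclicD k A i = 0 :=
  LinearMap.ext fun η => Subtype.ext (cyclicD_cyclicD η.1)

/-- The cochain part is `d² = 0`. By `cyclicD_psi` the map `Ψ` sends the square of the differential
to `(b + uB)² Ψ = 0` up to sign, and on elements `(0, η)` it is the injective multiplication by `u`.
-/
lemma twistedD_twistedD (h : cyclicD k A η₀.1 = 0) (i : ℤ) :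
    twistedD η₀ (i + 1) ∘ₗ twistedD η₀ i = 0 := by
  refine LinearMap.ext fun y => ?_
  rw [LinearMap.comp_apply, LinearMap.zero_apply]
  have h1 : (twistedD η₀ (i + 1) (twistedD η₀ i y)).1 = 0 := by
    rw [twistedD_fst, twistedD_fst, cochainD_cochainD]
  refine Prod.ext h1 (Subtype.ext (mulU_injective ?_))
  have h2 := cyclicD_psi h (twistedD η₀ i y)
  rw [← cyclicD_psi h y, map_smul, cyclicD_cyclicD, smul_zero, smul_zero, psi_eq, h1,
    cartanU_zero, LinearMap.zero_apply, smul_zero, zero_add] at h2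
  rw [← h2]
  exact (map_zero (mulU k A)).symm

lemma constantCoeff_eq_zero (η₀ : negCyclic k A (-d)) {n : ℕ} (h : n ≠ d) : η₀.1 n 0 = 0 :=
  η₀.2 n 0 (by push_cast; omega)

/-- Both sides vanish unless `d = q + p`: the constant coefficient of `η₀` is concentrated in chain
degree `d`. -/
lemma contraction_single {p : ℕ} (x : normalized k A A p) (q : ℕ) :
    contraction (Pi.single (M := fun p => normalized k A A p) p x (d - q)) d q (η₀.1 d 0) =
      contraction x (q + p) q (η₀.1 (q + p) 0) := by
  by_cases h : d = q + p
  · obtain rfl : p = d - q := by omega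
    rw [Pi.single_eq_same]
    exact component_congr (fun N => contraction x N q) η₀.1 0 h
  · rw [constantCoeff_eq_zero η₀ (n := q + p) (by omega), map_zero]
    by_cases hq : q ≤ d
    · rw [Pi.single_eq_of_ne (by omega), ← toChain_cap, map_zero, LinearMap.zero_apply, map_zero]
    · rw [contraction_eq_zero _ (by omega), LinearMap.zero_apply]

/-- Lifting in the cone of the cap product with the constant coefficient. -/
lemma exists_cartanU_lift (hc : CapAcyclic (regBimod k A) (η₀.1 d 0)) (x : cochains k A (i + 1))
    (hx : cochainD k A (i + 1) x = 0) {ζ : CycTotal k A} (hζ : ζ ∈ negCyclic k A (i + 1 - d))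
    (h0 : ∀ n, (cartanU x η₀.1 + cyclicD k A ζ) n 0 = 0) :
    ∃ (w : cochains k A i) (t : CycTotal k A), t ∈ negCyclic k A (i - d) ∧ cochainD k A i w = x ∧
      ∀ n, (cartanU w η₀.1 + cyclicD k A t) n 0 = ζ n 0 := by
  -- The cone consists of families in all degrees at once, so the homogeneous cochain `x` enters as
  -- a family with one nonzero member.
  let X : (p : ℕ) → normalized k A A p := Pi.single (i + 1 + 1).toNat ⟨x.1, x.2.1⟩
  have hXs : X (i + 1 + 1).toNat = ⟨x.1, x.2.1⟩ := Pi.single_eq_same _ _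
  have hX : ∀ p, gerstenhaber (p + 1) (mu k A) (X p).1 = 0 := by
    intro p
    by_cases hp : p = (i + 1 + 1).toNat
    · subst hp
      rw [hXs]
      by_cases hi : i + 1 < -1
      · have : x.1 = 0 := x.2.2 hi
        simp only [this]
        exact gerstenhaber_zero_right _ _
      · have h1 : gerstenhaber (i + 1 + 1 + 1).toNat (mu k A) x.1 = 0 := congrArg Subtype.val hx
        rwa [show (i + 1 + 1 + 1).toNat = (i + 1 + 1).toNat + 1 by omega] at h1
    · rw [show X p = 0 from Pi.single_eq_of_ne hp _]
      exact gerstenhaber_zero_right _ _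
  obtain ⟨W, T, hX0, hW, hT⟩ := hc.exists_contraction X hX (fun q => ζ q 0) (fun q => by
    have := h0 q
    rw [Pi.add_apply, Pi.add_apply, cartanU_zero_apply, cyclicD_zero] at this
    rw [← this]
    congr 1
    exact contraction_single _ q)
  -- The solution `T` may have members in every degree; only the one of cohomological degree `i - d`
  -- at `u^0`, in chain degree `d - i`, is kept. The others play no role in the homogeneous
  -- equation.
  let t : CycTotal k A := fun n j => if j = 0 ∧ (n : ℤ) = d - i then T n else 0
  have htm : t ∈ negCyclic k A (i - d) := by
    intro n j hn
    refine if_neg ?_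
    rintro ⟨rfl, h⟩
    exact hn (by push_cast; omega)
  have ht : ∀ n : ℕ, ((n : ℤ) + 1 = d - i) → t (n + 1) 0 = T (n + 1) := fun n h =>
    if_pos ⟨rfl, by push_cast; omega⟩
  have ht' : ∀ n : ℕ, ((n : ℤ) + 1 ≠ d - i) → t (n + 1) 0 = 0 := fun n h =>
    if_neg fun h' => h (by have := h'.2; push_cast at this; omega)
  have hζ' : ∀ n : ℕ, ((n : ℤ) + 1 ≠ d - i) → ζ n 0 = 0 := fun n h =>
    hζ n 0 (by push_cast; omega)
  -- There are no cochains of degree `i` here, so `w = 0`. In the boundary case `i = -2` the cochain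
  -- `x` has no arguments, and the cone gives `x = 0`.
  by_cases hi : i < -1
  · refine ⟨0, t, htm, ?_, fun n => ?_⟩
    · rw [map_zero]
      by_cases hi' : i + 1 < -1
      · exact (cochains_eq_zero hi' x).symm
      · have : X (i + 1 + 1).toNat = 0 := by
          rw [show (i + 1 + 1).toNat = 0 by omega]
          exact hX0
        rw [hXs] at this
        exact Subtype.ext (congrArg Subtype.val this).symm
    · rw [Pi.add_apply, Pi.add_apply, cyclicD_zero, cartanU_zero, LinearMap.zero_apply,
        Pi.zero_apply, Pi.zero_apply, zero_add]
      by_cases hn : (n : ℤ) + 1 = d - i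
      · rw [ht n hn, ← hT n, contraction_eq_zero _ (by omega), LinearMap.zero_apply, zero_add]
      · rw [ht' n hn, hζ' n hn, map_zero]
  · have hpp : (i + 1 + 1).toNat = (i + 1).toNat + 1 := by omega
    refine ⟨⟨(W (i + 1).toNat).1, (W (i + 1).toNat).2, fun h => absurd h hi⟩, t, htm, ?_,
      fun n => ?_⟩
    · have h1 : ∀ N, N = (i + 1).toNat + 1 →
          gerstenhaber N (mu k A) (W (i + 1).toNat).1 = (X N).1 := by
        rintro _ rfl
        exact hW _
      have h2 := h1 _ hpp
      rw [hXs] at h2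
      exact Subtype.ext h2
    · rw [Pi.add_apply, Pi.add_apply, cyclicD_zero, cartanU_zero_apply]
      by_cases hn : (n : ℤ) + 1 = d - i
      · rw [ht n hn, ← hT n]
        congr 1
        have h1 : ∀ p, p = (i + 1).toNat → n + p = d →
            contraction (W p) (n + p) n (η₀.1 (n + p) 0) =
              contraction (W (d - n)) d n (η₀.1 d 0) := by
          rintro p _ rfl
          rw [Nat.add_sub_cancel_left]
        exact h1 _ rfl (by omega)
      · rw [ht' n hn, hζ' n hn, constantCoeff_eq_zero η₀ (by omega), map_zero, map_zero, add_zero]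

/-- `Ψ` is injective on cohomology. -/
lemma exists_twistedD_eq (h : cyclicD k A η₀.1 = 0) (hc : CapAcyclic (regBimod k A) (η₀.1 d 0))
    (y : DObj k A d (i + 1)) (hy : twistedD η₀ (i + 1) y = 0) {ζ : CycTotal k A}
    (hζ : ζ ∈ negCyclic k A (i + 1 - d)) (hy' : psi η₀ y = cyclicD k A ζ) :
    ∃ v, twistedD η₀ i v = y := by
  obtain ⟨σ, hσ⟩ : ∃ σ, σ = sgn k (d * (i + 1 + 1)) := ⟨_, rfl⟩
  have hσσ : σ * σ = 1 := by rw [hσ, sgn_mul_self]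
  have hsign : sgn k (-d + 1) * (sgn k (d * (i + 1)) * σ) = -1 := by
    rw [hσ]
    simp only [sgn_eq_ite]
    generalize (d : ℤ) = e
    by_cases h1 : Even e <;> by_cases h2 : Even i <;>
      simp only [h1, h2, Int.even_add, Int.even_mul, even_neg, Int.not_even_one] <;> simp
  have hx : cochainD k A (i + 1) y.1 = 0 := by rw [← twistedD_fst η₀, hy]; rfl
  -- Modulo `u` the relation between `Ψ y` and `ζ` says that `(σ y.1, -ζ)` is closed in the cone of
  -- the contraction; `(w, t)` bounds it.
  obtain ⟨w, t, ht, hw, hwt⟩ := exists_cartanU_lift hc (σ • y.1) (by rw [map_smul, hx, smul_zero])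
    (neg_mem hζ) (fun n => by
      have := congrFun (congrFun hy' n) 0
      rw [psi_eq, ← hσ, Pi.add_apply, Pi.add_apply, mulU_zero, add_zero] at this
      rw [map_neg, cartanU_smul, Pi.add_apply, Pi.add_apply, Pi.neg_apply, Pi.neg_apply,
        LinearMap.smul_apply, this, add_neg_cancel])
  have hv0 : sgn k (-d + 1) • psi η₀ ((σ • w, 0) : DObj k A d i) = -cartanU w η₀.1 := by
    rw [psi_eq, cartanU_smul, LinearMap.smul_apply, Submodule.coe_zero, map_zero, add_zero,
      smul_smul, smul_smul, mul_assoc, hsign, neg_one_smul]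
  -- The constant coefficient of `i_w η₀ + b t` is that of `-ζ`, so this sum is divisible by `u`.
  obtain ⟨θ, hθ, hθ'⟩ := exists_mulU_eq (e' := i + (-d - 1)) (e := i + 1 - d) (by ring)
    (η := ζ + cartanU w η₀.1 + cyclicD k A t)
    (add_mem (add_mem hζ (cartanU_mem (by ring) w η₀.2)) (by
      have := cyclicD_mem k A _ t ht
      rwa [sub_add_eq_add_sub] at this))
    (fun n => by
      have := hwt n
      rw [add_assoc, Pi.add_apply, Pi.add_apply, this]
      simp)
  have hfst : (y - twistedD η₀ i ((σ • w, 0) : DObj k A d i)).1 = 0 := by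
    rw [Prod.fst_sub, twistedD_fst, map_smul, hw, smul_smul, hσσ, one_smul, sub_self]
  -- After removal of the cochain part, `Ψ` of the remainder is `u` times its second component and
  -- also the differential of `u θ`; then `u` is cancelled.
  have hsnd : cyclicD k A θ = (y - twistedD η₀ i ((σ • w, 0) : DObj k A d i)).2.1 := by
    apply mulU_injective
    have h1 : psi η₀ (y - twistedD η₀ i ((σ • w, 0) : DObj k A d i)) =
        psi η₀ y - psi η₀ (twistedD η₀ i ((σ • w, 0) : DObj k A d i)) := by
      rw [eq_sub_iff_add_eq, ← psi_add, sub_add_cancel]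
    rw [psi_eq, hfst, cartanU_zero, LinearMap.zero_apply, smul_zero, zero_add, ← cyclicD_psi h,
      ← map_smul, hv0, hy', map_neg, sub_neg_eq_add] at h1
    rw [h1, ← cyclicD_mulU, hθ', map_add, map_add, cyclicD_cyclicD, add_zero]
  -- The sign in front of `θ` undoes the sign of the differential on the shifted complex.
  refine ⟨(σ • w, 0) + (0, sgn k (-d - 1) • ⟨θ, hθ⟩), ?_⟩
  rw [map_add, ← eq_sub_iff_add_eq']
  refine Prod.ext ?_ (Subtype.ext ?_)
  · rw [hfst, twistedD_fst, map_zero]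
  · rw [← hsnd, twistedD_snd, lieU_zero, LinearMap.zero_apply, smul_zero, sub_zero,
      Submodule.coe_smul, map_smul, sgn_smul_sgn_smul]

/-- `Ψ` is surjective on cohomology. -/
lemma exists_psi_eq (h : cyclicD k A η₀.1 = 0) (hc : CapAcyclic (regBimod k A) (η₀.1 d 0))
    {ζ : CycTotal k A} (hζ : ζ ∈ negCyclic k A (i + 1 - d)) (hζ' : cyclicD k A ζ = 0) :
    ∃ (y : DObj k A d i) (t : CycTotal k A), t ∈ negCyclic k A (i - d) ∧ twistedD η₀ i y = 0 ∧
      psi η₀ y + cyclicD k A t = ζ := by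
  -- With `x = 0` the lift is a Hochschild cocycle `w` whose contraction with `π(η₀)` represents the
  -- constant coefficient of `ζ`.
  obtain ⟨w, t, ht, hw, hwt⟩ := exists_cartanU_lift hc 0 (map_zero _) hζ (fun n => by
    rw [hζ', cartanU_zero]; rfl)
  obtain ⟨θ, hθ, hθ'⟩ := exists_mulU_eq (e' := i + (-d - 1)) (e := i + 1 - d) (by ring)
    (η := ζ - (cartanU w η₀.1 + cyclicD k A t))
    (sub_mem hζ (add_mem (cartanU_mem (by ring) w η₀.2) (by
      have := cyclicD_mem k A _ t ht
      rwa [sub_add_eq_add_sub] at this)))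
    (fun n => by rw [Pi.sub_apply, Pi.sub_apply, hwt, sub_self])
  let y : DObj k A d i := (sgn k (d * (i + 1)) • w, ⟨θ, hθ⟩)
  have hy : psi η₀ y + cyclicD k A t = ζ := by
    rw [psi_eq, cartanU_smul, LinearMap.smul_apply, sgn_smul_sgn_smul, hθ']
    abel
  have hfst : (twistedD η₀ i y).1 = 0 := by rw [twistedD_fst, map_smul, hw, smul_zero]
  -- The differential of `y` has no cochain part, and `Ψ` maps it to `± (b + uB)(ζ - (b + uB) t) =
  -- 0`; injectivity of `u` finishes.
  refine ⟨y, t, ht, Prod.ext hfst (Subtype.ext (mulU_injective ?_)), hy⟩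
  have h1 := cyclicD_psi h y
  rw [eq_sub_of_add_eq hy, map_sub, cyclicD_cyclicD, hζ', sub_zero, smul_zero, psi_eq, hfst,
    cartanU_zero, LinearMap.zero_apply, smul_zero, zero_add] at h1
  exact h1.symm.trans (map_zero (mulU k A)).symm

end TwistedComplex

/-! ### Homology of complexes of modules in terms of elements. -/

section ModuleComplexes

variable {R : Type u} [Ring R] (K : CochainComplex (ModuleCat.{v} R) ℤ)

lemma d_iCycles_apply (i j : ℤ) (z : K.cycles i) : (K.d i j).hom ((K.iCycles i).hom z) = 0 := by
  rw [← LinearMap.comp_apply, ← ModuleCat.hom_comp, HomologicalComplex.iCycles_d]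
  rfl

lemma iCycles_injective (i : ℤ) : Function.Injective (K.iCycles i).hom :=
  (ModuleCat.mono_iff_injective _).mp inferInstance

lemma homologyπ_surjective (i : ℤ) : Function.Surjective (K.homologyπ i).hom :=
  (ModuleCat.epi_iff_surjective _).mp inferInstance

variable {K}

lemma exists_cycle {i j : ℤ} (h : i + 1 = j) (x : K.X i) (hx : (K.d i j).hom x = 0) :
    ∃ z : K.cycles i, (K.iCycles i).hom z = x := by
  let f : ModuleCat.of R (LinearMap.ker (K.d i j).hom) ⟶ K.X i :=
    ModuleCat.ofHom (LinearMap.ker (K.d i j).hom).subtype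
  have hf : f ≫ K.d i j = 0 := ModuleCat.hom_ext (LinearMap.ext fun y => y.2)
  refine ⟨(K.liftCycles f j (by simp [← h]) hf).hom ⟨x, hx⟩, ?_⟩
  exact LinearMap.congr_fun (congrArg ModuleCat.Hom.hom (K.liftCycles_i f j (by simp [← h]) hf))
    ⟨x, hx⟩

lemma homologyπ_eq_iff {i j : ℤ} (h : i + 1 = j) (z z' : K.cycles j) :
    (K.homologyπ j).hom z = (K.homologyπ j).hom z' ↔
      ∃ v, (K.d i j).hom v = (K.iCycles j).hom z - (K.iCycles j).hom z' := by
  have hex : (ShortComplex.mk _ _ (K.toCycles_comp_homologyπ i j)).Exact :=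
    ShortComplex.exact_of_g_is_cokernel _ (K.homologyIsCokernel i j (by simp [← h]))
  rw [ShortComplex.moduleCat_exact_iff] at hex
  constructor
  · intro e
    obtain ⟨v, hv⟩ := hex (z - z') (by
      change (K.homologyπ j).hom (z - z') = 0
      rw [map_sub, e, sub_self])
    refine ⟨v, ?_⟩
    rw [← map_sub, ← K.toCycles_i i j]
    exact congrArg (K.iCycles j).hom hv
  · rintro ⟨v, hv⟩
    rw [← map_sub, ← K.toCycles_i i j] at hv
    have h1 := iCycles_injective K j hv
    rw [← sub_eq_zero, ← map_sub, ← h1]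
    exact LinearMap.congr_fun (congrArg ModuleCat.Hom.hom (K.toCycles_comp_homologyπ i j)) v

variable {L : CochainComplex (ModuleCat.{v} R) ℤ}

/-- A linear map between terms of two complexes that maps cycles to cycles and induces a bijection
on homology, expressed in terms of elements. -/
structure InducesIso {i₀ i i₁ j₀ j j₁ : ℤ} (φ : K.X i →ₗ[R] L.X j) : Prop where
  prev : i₀ + 1 = i
  next : i + 1 = i₁
  prev' : j₀ + 1 = j
  next' : j + 1 = j₁
  map_cycle : ∀ x, (K.d i i₁).hom x = 0 → (L.d j j₁).hom (φ x) = 0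
  map_boundary : ∀ v, ∃ t, (L.d j₀ j).hom t = φ ((K.d i₀ i).hom v)
  inj : ∀ x, (K.d i i₁).hom x = 0 → ∀ t, (L.d j₀ j).hom t = φ x → ∃ v, (K.d i₀ i).hom v = x
  surj : ∀ y, (L.d j j₁).hom y = 0 →
    ∃ x, (K.d i i₁).hom x = 0 ∧ ∃ t, (L.d j₀ j).hom t = φ x - y

variable {i₀ i i₁ j₀ j j₁ : ℤ} {φ : K.X i →ₗ[R] L.X j}

/-- Source and target degrees are independent, so that the shift of the theorem needs no comparison
of homology groups. The map is defined by chosen representatives; `key` shows independence of the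
choices, and linearity follows from it. -/
lemma InducesIso.exists_linearEquiv (h : InducesIso (i₀ := i₀) (i₁ := i₁) (j₀ := j₀) (j₁ := j₁) φ) :
    ∃ F : K.homology i ≃ₗ[R] L.homology j, ∀ (z : K.cycles i) (w : L.cycles j),
      (L.iCycles j).hom w = φ ((K.iCycles i).hom z) →
      F ((K.homologyπ i).hom z) = (L.homologyπ j).hom w := by
  have hw : ∀ z : K.cycles i, ∃ w : L.cycles j, (L.iCycles j).hom w = φ ((K.iCycles i).hom z) :=
    fun z => exists_cycle h.next' _ (h.map_cycle _ (d_iCycles_apply K i i₁ z))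
  choose W hW using hw
  choose Z hZ using homologyπ_surjective K i
  have key : ∀ (z : K.cycles i) (w : L.cycles j), (L.iCycles j).hom w = φ ((K.iCycles i).hom z) →
      (L.homologyπ j).hom (W (Z ((K.homologyπ i).hom z))) = (L.homologyπ j).hom w := by
    intro z w hzw
    obtain ⟨v, hv⟩ := (homologyπ_eq_iff h.prev _ _).mp (hZ ((K.homologyπ i).hom z))
    obtain ⟨t, ht⟩ := h.map_boundary v
    refine (homologyπ_eq_iff h.prev' _ _).mpr ⟨t, ?_⟩
    rw [ht, hv, map_sub, hW, hzw]
  let F : K.homology i →ₗ[R] L.homology j :=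
    { toFun := fun a => (L.homologyπ j).hom (W (Z a))
      map_add' := fun a b => by
        rw [← map_add]
        have := key (Z a + Z b) (W (Z a) + W (Z b)) (by simp only [map_add, hW])
        rwa [map_add, hZ, hZ] at this
      map_smul' := fun c a => by
        have := key (c • Z a) (c • W (Z a)) (by simp only [map_smul, hW])
        rwa [map_smul, hZ, map_smul] at this }
  refine ⟨LinearEquiv.ofBijective F ⟨?_, ?_⟩, key⟩
  · rw [← LinearMap.ker_eq_bot, LinearMap.ker_eq_bot']
    intro a ha
    have h1 : (L.homologyπ j).hom (W (Z a)) = (L.homologyπ j).hom 0 := by rw [map_zero]; exact ha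
    obtain ⟨t, ht⟩ := (homologyπ_eq_iff h.prev' _ _).mp h1
    rw [map_zero, sub_zero, hW] at ht
    obtain ⟨v, hv⟩ := h.inj _ (d_iCycles_apply K i i₁ _) t ht
    rw [← hZ a, ← map_zero (K.homologyπ i).hom]
    exact (homologyπ_eq_iff h.prev _ _).mpr ⟨v, by rw [hv, map_zero, sub_zero]⟩
  · intro b
    obtain ⟨w, rfl⟩ := homologyπ_surjective L j b
    obtain ⟨x, hx, t, ht⟩ := h.surj _ (d_iCycles_apply L j j₁ w)
    obtain ⟨z, rfl⟩ := exists_cycle h.next x hx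
    refine ⟨(K.homologyπ i).hom z, (key z (W z) (hW z)).trans ?_⟩
    exact (homologyπ_eq_iff h.prev' _ _).mpr ⟨t, by rw [ht, hW]⟩

lemma quasiIsoAt_of_inducesIso (f : K ⟶ L) {i i₀ i₁ : ℤ}
    (h : InducesIso (i₀ := i₀) (i₁ := i₁) (j₀ := i₀) (j₁ := i₁) (f.f i).hom) : QuasiIsoAt f i := by
  obtain ⟨F, hF⟩ := h.exists_linearEquiv
  have : HomologicalComplex.homologyMap f i = F.toModuleIso.hom := by
    rw [← cancel_epi (K.homologyπ i), HomologicalComplex.homologyπ_naturality]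
    refine ModuleCat.hom_ext (LinearMap.ext fun z => ?_)
    refine (hF z ((HomologicalComplex.cyclesMap f i).hom z) ?_).symm
    exact LinearMap.congr_fun (congrArg ModuleCat.Hom.hom (HomologicalComplex.cyclesMap_i f i)) z
  rw [quasiIsoAt_iff_isIso_homologyMap, this]
  infer_instance

end ModuleComplexes

/-! ### `Ψ` as a morphism of complexes. -/

section QuasiIsomorphism

/-- The differential of the shift differs by a global sign, which changes neither cycles nor
boundaries; bounding elements are multiplied by it. -/
lemma InducesIso.shift {R : Type u} [Ring R] {K L : CochainComplex (ModuleCat.{v} R) ℤ}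
    {i₀ i i₁ j₀ j j₁ : ℤ} (n : ℤ) {φ : K.X i →ₗ[R] L.X (j + n)}
    (h : InducesIso (i₀ := i₀) (i₁ := i₁) (j₀ := j₀ + n) (j₁ := j₁ + n) φ) :
    InducesIso (i₀ := i₀) (i := i) (i₁ := i₁) (j₀ := j₀) (j := j) (j₁ := j₁) (L := L⟦n⟧) φ := by
  have hd : ∀ (a b : ℤ) (t : L.X (a + n)),
      ((L⟦n⟧).d a b).hom t = n.negOnePow • (L.d (a + n) (b + n)).hom t := by
    intro a b t
    rw [CochainComplex.shiftFunctor_obj_d']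
    rfl
  have hs : ∀ (a : ℤ) (t : L.X a), n.negOnePow • n.negOnePow • t = t := fun a t => by
    rw [smul_smul, Int.units_mul_self, one_smul]
  have hl : ∀ (a b : ℤ) (t : L.X a), (L.d a b).hom (n.negOnePow • t) = n.negOnePow • (L.d a b).hom t := by
    intro a b t
    rcases Int.units_eq_one_or n.negOnePow with h | h <;> simp [h]
  refine ⟨h.prev, h.next, by have := h.prev'; omega, by have := h.next'; omega, fun x hx => ?_,
    fun v => ?_, fun x hx t ht => ?_, fun y hy => ?_⟩
  · have e : n.negOnePow • (L.d (j + n) (j₁ + n)).hom (φ x) = 0 := by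
      rw [h.map_cycle x hx, smul_zero]
    exact (hd j j₁ (φ x)).trans e
  · obtain ⟨t, ht⟩ := h.map_boundary v
    exact ⟨(n.negOnePow • t : L.X (j₀ + n)), (hd _ _ _).trans (by rw [hl, hs]; exact ht)⟩
  · have ht' := (hl _ _ _).trans ((hd _ _ _).symm.trans ht)
    exact h.inj x hx _ ht'
  · have hy' : n.negOnePow • (L.d (j + n) (j₁ + n)).hom y = 0 := (hd _ _ _).symm.trans hy
    have hy'' : (L.d (j + n) (j₁ + n)).hom y = 0 := by
      rw [← hs _ ((L.d (j + n) (j₁ + n)).hom y), hy', smul_zero]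
    obtain ⟨x, hx, t, ht⟩ := h.surj y hy''
    exact ⟨x, hx, (n.negOnePow • t : L.X (j₀ + n)), (hd _ _ _).trans (by rw [hl, hs]; exact ht)⟩

variable {k : Type u} [Field k] {A : Type v} [Ring A] [Algebra k A]

lemma negCyclicComplex_d (hC : ∀ i, negCyclicD k A (i + 1) ∘ₗ negCyclicD k A i = 0) {a b : ℤ}
    (h : a + 1 = b) (η : negCyclic k A a) :
    (show negCyclic k A b from ((negCyclicComplex k A hC).d a b).hom η).1 = cyclicD k A η.1 := by
  subst h
  have e : (negCyclicComplex k A hC).d a (a + 1) = ModuleCat.ofHom (negCyclicD k A a) :=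
    CochainComplex.of_d (fun i => ModuleCat.of k (negCyclic k A i))
      (fun i => ModuleCat.ofHom (negCyclicD k A i)) a
  rw [e]
  rfl

variable {d : ℕ} {η₀ : negCyclic k A (-d)}

lemma twistedComplex_d (hD : ∀ i, twistedD η₀ (i + 1) ∘ₗ twistedD η₀ i = 0) (i : ℤ)
    (y : DObj k A d i) :
    (show DObj k A d (i + 1) from ((twistedComplex η₀ hD).d i (i + 1)).hom y) = twistedD η₀ i y := by
  have e : (twistedComplex η₀ hD).d i (i + 1) = ModuleCat.ofHom (twistedD η₀ i) :=
    CochainComplex.of_d (fun i => ModuleCat.of k (DObj k A d i))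
      (fun i => ModuleCat.ofHom (twistedD η₀ i)) i
  rw [e]
  rfl

variable (η₀) in
/-- The degree `i` part of `Ψ`. -/
def psiHom {i e : ℤ} (h : i + (-d + 1) = e) : DObj k A d i →ₗ[k] negCyclic k A e where
  toFun y := ⟨psi η₀ y, h ▸ psi_mem η₀ y⟩
  map_add' y y' := Subtype.ext (psi_add η₀ y y')
  map_smul' c y := Subtype.ext (psi_smul η₀ c y)

/-- The target degrees are given only up to equations, so that the lemma serves both the shifted
complex and the degree `-m` of cyclic homology. -/
lemma inducesIso_psiHom (h : cyclicD k A η₀.1 = 0) (hc : CapAcyclic (regBimod k A) (η₀.1 d 0))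
    (hC : ∀ i, negCyclicD k A (i + 1) ∘ₗ negCyclicD k A i = 0)
    (hD : ∀ i, twistedD η₀ (i + 1) ∘ₗ twistedD η₀ i = 0) {i e₀ e e₁ : ℤ}
    (he : i + 1 + (-d + 1) = e) (h₀ : e₀ + 1 = e) (h₁ : e + 1 = e₁) :
    InducesIso (K := twistedComplex η₀ hD) (L := negCyclicComplex k A hC) (i₀ := i) (i := i + 1)
      (i₁ := i + 1 + 1) (j₀ := e₀) (j := e) (j₁ := e₁) (psiHom η₀ he) := by
  have hpsi0 : ∀ j : ℤ, psi η₀ (0 : DObj k A d j) = 0 := fun j => by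
    simpa using psi_smul η₀ (0 : k) (0 : DObj k A d j)
  refine ⟨rfl, rfl, h₀, h₁, fun x hx => ?_, fun v => ?_, fun x hx t ht => ?_, fun y hy => ?_⟩
  · have hx' : twistedD η₀ (i + 1) x = 0 := (twistedComplex_d hD _ x).symm.trans hx
    refine Subtype.ext ((negCyclicComplex_d hC h₁ _).trans ?_)
    have := cyclicD_psi h (x : DObj k A d (i + 1))
    rw [hx', hpsi0] at this
    change cyclicD k A (psi η₀ x) = 0
    rw [← sgn_smul_sgn_smul (k := k) (-d + 1) (cyclicD k A _), this, smul_zero]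
  -- The sign is that of the differential on the shifted complex in `cyclicD_psi`.
  · refine ⟨(⟨sgn k (-d + 1) • psi η₀ (v : DObj k A d i), Submodule.smul_mem _ _ ?_⟩ :
      negCyclic k A e₀), Subtype.ext ((negCyclicComplex_d hC h₀ _).trans ?_)⟩
    · have := psi_mem η₀ (v : DObj k A d i)
      rwa [show i + (-d + 1) = e₀ by omega] at this
    · rw [map_smul]
      exact (cyclicD_psi h v).trans (congrArg (psi η₀) (twistedComplex_d hD i v).symm)
  · have hx' : twistedD η₀ (i + 1) x = 0 := (twistedComplex_d hD _ x).symm.trans hx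
    have ht' : psi η₀ (x : DObj k A d (i + 1)) = cyclicD k A (t : negCyclic k A e₀).1 :=
      (congrArg Subtype.val ht).symm.trans (negCyclicComplex_d hC h₀ t)
    obtain ⟨v, hv⟩ := exists_twistedD_eq h hc x hx' (by
      rw [show i + 1 - d = e₀ by omega]
      exact (t : negCyclic k A e₀).2) ht'
    exact ⟨v, (twistedComplex_d hD i v).trans hv⟩
  · have hy' : cyclicD k A (y : negCyclic k A e).1 = 0 :=
      (negCyclicComplex_d hC h₁ y).symm.trans (congrArg Subtype.val hy)
    obtain ⟨x, t, ht, hx, hxt⟩ := exists_psi_eq (i := i + 1) h hc (by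
      rw [show i + 1 + 1 - d = e by omega]
      exact (y : negCyclic k A e).2) hy'
    rw [show i + 1 - d = e₀ by omega] at ht
    refine ⟨x, (twistedComplex_d hD _ x).trans hx, (⟨-t, neg_mem ht⟩ : negCyclic k A e₀),
      Subtype.ext ((negCyclicComplex_d hC h₀ _).trans ?_)⟩
    change cyclicD k A (-t) = psi η₀ x - (y : negCyclic k A e).1
    rw [← hxt, map_neg]
    abel

/-- The morphism of complexes `Ψ`. -/
def psiMap (h : cyclicD k A η₀.1 = 0)
    (hC : ∀ i, negCyclicD k A (i + 1) ∘ₗ negCyclicD k A i = 0)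
    (hD : ∀ i, twistedD η₀ (i + 1) ∘ₗ twistedD η₀ i = 0) :
    twistedComplex η₀ hD ⟶ (negCyclicComplex k A hC)⟦(-d + 1 : ℤ)⟧ where
  f i := ModuleCat.ofHom (psiHom η₀ (i := i) rfl)
  comm' i j hij := by
    obtain rfl : i + 1 = j := hij
    refine ModuleCat.hom_ext (LinearMap.ext fun y => Subtype.ext ?_)
    have h1 : psi η₀ (twistedD η₀ i y) = sgn k (-d + 1) • cyclicD k A (psi η₀ (y : DObj k A d i)) :=
      (cyclicD_psi h y).symm
    have h2 : ∀ t : negCyclic k A (i + (-d + 1)),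
        (show negCyclic k A (i + 1 + (-d + 1)) from
          (((negCyclicComplex k A hC)⟦(-d + 1 : ℤ)⟧).d i (i + 1)).hom t).1 =
        sgn k (-d + 1) • cyclicD k A t.1 := by
      intro t
      rw [← negCyclicComplex_d hC (b := i + 1 + (-d + 1)) (by ring), sgn]
      have e : ∀ (ν : ℤˣ) (s : negCyclic k A (i + 1 + (-d + 1))),
          (ν • s).1 = ((ν : ℤ) : k) • s.1 := by
        intro ν s
        rcases Int.units_eq_one_or ν with rfl | rfl <;> simp
      exact e _ _
    refine (h2 _).trans (h1.symm.trans ?_)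
    exact congrArg (psi η₀) (twistedComplex_d hD i y).symm

end QuasiIsomorphism

/-! ### The tangent space as first cohomology. -/

section Tangent

variable {k : Type u} [Field k]

lemma exists_smul_epsMax (a : maxIdeal k k[ε]) : ∃ c : k, c • epsMax k = a := by
  have ha : a.1 ∈ IsLocalRing.maximalIdeal k[ε] := a.2
  rw [DualNumber.maximalIdeal_eq_span_singleton_eps, Ideal.mem_span_singleton'] at ha
  obtain ⟨b, hb⟩ := ha
  refine ⟨b.fst, Subtype.ext ?_⟩
  rw [← hb]
  change b.fst • (DualNumber.eps : k[ε]) = _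
  ext <;> simp

lemma maxIdealMul_dualNumber : maxIdealMul k k[ε] = 0 := by
  refine LinearMap.ext fun a => LinearMap.ext fun b => Subtype.ext ?_
  obtain ⟨c, rfl⟩ := exists_smul_epsMax a
  obtain ⟨c', rfl⟩ := exists_smul_epsMax b
  change (c • (DualNumber.eps : k[ε])) * (c' • DualNumber.eps) = 0
  simp [DualNumber.eps_mul_eps]

variable (k) in
/-- The maximal ideal of the dual numbers is one-dimensional. -/
def epsEquiv : k ≃ₗ[k] maxIdeal k k[ε] :=
  LinearEquiv.ofBijective (LinearMap.toSpanSingleton k _ (epsMax k)) ⟨by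
    intro c c' h
    have h1 : (c • (DualNumber.eps : k[ε])) = c' • DualNumber.eps := congrArg Subtype.val h
    simpa using congrArg TrivSqZeroExt.snd h1, exists_smul_epsMax⟩

variable (k) in
/-- The isomorphism `v ↦ v ⊗ ε`. -/
def tensorEps (E : Type*) [AddCommGroup E] [Module k E] : E ≃ₗ[k] E ⊗[k] maxIdeal k k[ε] :=
  (TensorProduct.rid k E).symm.trans (LinearEquiv.lTensor E (epsEquiv k))

lemma tensorEps_apply {E : Type*} [AddCommGroup E] [Module k E] (v : E) :
    tensorEps k E v = v ⊗ₜ epsMax k := by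
  have h : epsEquiv k 1 = epsMax k := one_smul k (epsMax k)
  simp [tensorEps, h]

variable {A : Type v} [Ring A] [Algebra k A] {d : ℕ} {η₀ : negCyclic k A (-d)}

/-- The maximal ideal of the dual numbers has square zero. -/
lemma bracketTensor_dualNumber {i j l : ℤ} (h : i + j = l) :
    bracketTensor (k := k) (A := A) k[ε] d h = 0 := by
  rw [bracketTensor, maxIdealMul_dualNumber]
  refine TensorProduct.ext' fun x a => ?_
  refine TensorProduct.ext' fun y b => ?_
  simp

lemma finrank_dualNumber_pos : 0 < Module.finrank k k[ε] := by
  have : Module.finrank k k[ε] = Module.finrank k (k × k) := rfl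
  rw [this, Module.finrank_prod]
  simp

/-- With vanishing brackets only the terms without an iterated bracket survive in both exponential
sums. -/
lemma gauge_dualNumber (x : DObj k A d 0 ⊗[k] maxIdeal k k[ε])
    (y : DObj k A d 1 ⊗[k] maxIdeal k k[ε]) :
    gauge k[ε] η₀ x y =
      y - (show DObj k A d 1 ⊗[k] maxIdeal k k[ε] from twistedDTensor k[ε] η₀ 0 x) := by
  -- The dimension bounds the sums; being positive, it guarantees that the term `n = 0` is present.
  obtain ⟨N, hN⟩ : ∃ N, Module.finrank k k[ε] = N + 1 :=
    ⟨_, (Nat.succ_pred_eq_of_pos finrank_dualNumber_pos).symm⟩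
  rw [gauge, bracketTensor_dualNumber, hN, Finset.sum_range_succ', Finset.sum_range_succ']
  simp

lemma twistedDTensor_tensorEps {i : ℤ} (v : DObj k A d i) :
    twistedDTensor k[ε] η₀ i (tensorEps k _ v) = tensorEps k _ (twistedD η₀ i v) := by
  rw [tensorEps_apply, tensorEps_apply]
  rfl

/-- The tangent space of the deformation functor is the first cohomology. -/
lemma exists_tangentSpace_equiv (hD : ∀ i, twistedD η₀ (i + 1) ∘ₗ twistedD η₀ i = 0) :
    ∃ e : TangentSpace η₀ ≃ (twistedComplex η₀ hD).homology 1,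
      ∀ (z : (twistedComplex η₀ hD).cycles 1) (y : MaurerCartan k[ε] η₀),
        y.1 = cocycleVal z ⊗ₜ epsMax k →
        e (Quot.mk _ y) = ((twistedComplex η₀ hD).homologyπ 1).hom z := by
  have hMC : ∀ y : DObj k A d 1, twistedDTensor k[ε] η₀ 1 (tensorEps k _ y)
      + (2 : k)⁻¹ • bracketTensor k[ε] d rfl (tensorEps k _ y) (tensorEps k _ y) = 0 ↔
      twistedD η₀ 1 y = 0 := by
    intro y
    rw [bracketTensor_dualNumber, twistedDTensor_tensorEps, LinearMap.zero_apply,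
      LinearMap.zero_apply, smul_zero, add_zero, LinearEquiv.map_eq_zero_iff]
  have hz : ∀ y : MaurerCartan k[ε] η₀, ∃ z : (twistedComplex η₀ hD).cycles 1,
      y.1 = tensorEps k _ (cocycleVal z) := by
    rintro ⟨y, hy⟩
    obtain ⟨v, rfl⟩ := (tensorEps k (DObj k A d 1)).surjective y
    obtain ⟨z, hz⟩ := exists_cycle (K := twistedComplex η₀ hD) (i := 1) rfl v
      ((twistedComplex_d hD 1 v).trans ((hMC v).mp hy))
    exact ⟨z, congrArg (tensorEps k _) hz.symm⟩
  choose Z hZ using hz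
  have hval : Function.Injective (cocycleVal (η₀ := η₀) (hD := hD) (i := 1)) :=
    iCycles_injective (twistedComplex η₀ hD) 1
  -- Gauge equivalence is literally equality of cohomology classes, so the quotient by it generates
  -- no further identifications.
  have key : ∀ y y' : MaurerCartan k[ε] η₀,
      ((twistedComplex η₀ hD).homologyπ 1).hom (Z y) =
        ((twistedComplex η₀ hD).homologyπ 1).hom (Z y') ↔
      ∃ x, y'.1 = gauge k[ε] η₀ x y.1 := by
    intro y y'
    rw [homologyπ_eq_iff (i := 0) (by norm_num)]
    have hdv : ∀ v : DObj k A d 0,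
        (show DObj k A d 1 from ((twistedComplex η₀ hD).d 0 1).hom v) = twistedD η₀ 0 v :=
      twistedComplex_d hD 0
    have hg : ∀ v : DObj k A d 0, y'.1 = gauge k[ε] η₀ (tensorEps k _ v) y.1 ↔
        (show DObj k A d 1 from twistedD η₀ 0 v) = cocycleVal (Z y) - cocycleVal (Z y') := by
      intro v
      rw [gauge_dualNumber, twistedDTensor_tensorEps, hZ y, hZ y', eq_comm, eq_comm (b := _ - _),
        sub_eq_iff_eq_add, sub_eq_iff_eq_add', ← (tensorEps k (DObj k A d 1)).injective.eq_iff,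
        map_add]
      rfl
    constructor
    · rintro ⟨v, hv⟩
      exact ⟨tensorEps k _ v, (hg v).mpr ((hdv v).symm.trans hv)⟩
    · rintro ⟨x, hx⟩
      obtain ⟨v, rfl⟩ := (tensorEps k (DObj k A d 0)).surjective x
      exact ⟨v, (hdv v).trans ((hg v).mp hx)⟩
  let G : TangentSpace η₀ → (twistedComplex η₀ hD).homology 1 :=
    Quot.lift (fun y => ((twistedComplex η₀ hD).homologyπ 1).hom (Z y))
      fun y y' h => (key y y').mpr h
  have hG : ∀ (z : (twistedComplex η₀ hD).cycles 1) (y : MaurerCartan k[ε] η₀),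
      y.1 = cocycleVal z ⊗ₜ epsMax k →
      G (Quot.mk _ y) = ((twistedComplex η₀ hD).homologyπ 1).hom z := by
    intro z y hy
    have : Z y = z := hval ((tensorEps k _).injective (by rw [← hZ y, hy, tensorEps_apply]))
    exact congrArg (fun t => ((twistedComplex η₀ hD).homologyπ 1).hom t) this
  refine ⟨Equiv.ofBijective G ⟨?_, fun a => ?_⟩, hG⟩
  · rintro ⟨y⟩ ⟨y'⟩ h
    exact Quot.sound ((key y y').mp h)
  · obtain ⟨z, rfl⟩ := homologyπ_surjective (twistedComplex η₀ hD) 1 a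
    have hz : twistedD η₀ 1 (cocycleVal z) = 0 :=
      (twistedComplex_d hD 1 (cocycleVal z)).symm.trans (d_iCycles_apply (twistedComplex η₀ hD) 1 2 z)
    exact ⟨Quot.mk _ ⟨_, (hMC _).mpr hz⟩, hG z _ (tensorEps_apply _)⟩

end Tangent

end CalabiYau

end

/-! ### Assembly of the theorem. -/

theorem theorem10p1 {k : Type*} [Field k] [CharZero k] {A : Type*} [Ring A] [Algebra k A]
    (d : ℕ) (η₀ : negCyclic k A (-d)) (hη₀ : IsCalabiYau η₀) :
    ∃ (hC : ∀ i, negCyclicD k A (i + 1) ∘ₗ negCyclicD k A i = 0)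
      (hD : ∀ i, twistedD η₀ (i + 1) ∘ₗ twistedD η₀ i = 0)
      (Ψ : twistedComplex η₀ hD ⟶ (negCyclicComplex k A hC)⟦(-d + 1 : ℤ)⟧),
      (∀ (i : ℤ) (y : DObj k A d i), (componentAt Ψ i y).1 = psi η₀ y) ∧
      QuasiIso Ψ ∧
      ∃ Φ : ∀ i m : ℤ, i = d - 1 - m →
          ((twistedComplex η₀ hD).homology i ≅ HCneg k A hC m),
        (∀ (i m : ℤ) (h : i = d - 1 - m) (z : (twistedComplex η₀ hD).cycles i)
          (w : (negCyclicComplex k A hC).cycles (-m)),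
          (cyclicCocycleVal w).1 = psi η₀ (cocycleVal z) →
          (Φ i m h).hom.hom (((twistedComplex η₀ hD).homologyπ i).hom z) =
            ((negCyclicComplex k A hC).homologyπ (-m)).hom w) ∧
        ∃ e : TangentSpace η₀ ≃ HCneg k A hC (d - 2),
          ∀ (z : (twistedComplex η₀ hD).cycles 1) (y : MaurerCartan k[ε] η₀),
            y.1 = cocycleVal z ⊗ₜ epsMax k →
            e (Quot.mk _ y) =
              (Φ 1 (d - 2) (by ring)).hom.hom (((twistedComplex η₀ hD).homologyπ 1).hom z) := by
  have h : cyclicD k A η₀.1 = 0 := congrArg Subtype.val hη₀.cycle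
  -- The constant coefficient of a negative cyclic cycle is a Hochschild cycle, as the `u^0` part of
  -- `b + uB` is `b`.
  have hb : ∀ n, hochschildB k A d n (η₀.1 d 0) = 0 := by
    intro n
    by_cases hn : d = n + 1
    · subst hn
      exact (cyclicD_zero _ _).symm.trans (congrFun (congrFun h n) 0)
    · rw [hochschildB_eq_zero hn, LinearMap.zero_apply]
  have hc : CapAcyclic (regBimod k A) (η₀.1 d 0) :=
    hη₀.smooth.capAcyclic hb (hη₀.nondegenerate.capAcyclic hb)
  refine ⟨negCyclicD_negCyclicD, twistedD_twistedD h,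
    psiMap h negCyclicD_negCyclicD (twistedD_twistedD h), fun i y => rfl, ⟨fun i => ?_⟩, ?_⟩
  · obtain ⟨i, rfl⟩ : ∃ j, i = j + 1 := ⟨i - 1, by ring⟩
    exact quasiIsoAt_of_inducesIso _ ((inducesIso_psiHom h hc _ _ (i := i)
      (e₀ := i + (-d + 1)) (e₁ := i + 1 + 1 + (-d + 1)) rfl (by ring) (by ring)).shift (-d + 1))
  -- The isomorphisms are built directly to degree `-m` of the unshifted complex, since `i = d - 1 -
  -- m` means `i + (-d + 1) = -m`.
  · have hΦ : ∀ i m : ℤ, i = d - 1 - m →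
        ∃ F : (twistedComplex η₀ (twistedD_twistedD h)).homology i ≃ₗ[k]
            HCneg k A negCyclicD_negCyclicD m,
          ∀ (z : (twistedComplex η₀ (twistedD_twistedD h)).cycles i)
            (w : (negCyclicComplex k A negCyclicD_negCyclicD).cycles (-m)),
            (cyclicCocycleVal w).1 = psi η₀ (cocycleVal z) →
            F (((twistedComplex η₀ (twistedD_twistedD h)).homologyπ i).hom z) =
              ((negCyclicComplex k A negCyclicD_negCyclicD).homologyπ (-m)).hom w := by
      intro i m him
      obtain ⟨i, rfl⟩ : ∃ j, i = j + 1 := ⟨i - 1, by ring⟩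
      obtain ⟨F, hF⟩ := (inducesIso_psiHom h hc negCyclicD_negCyclicD (twistedD_twistedD h)
        (i := i) (e := -m) (e₀ := -m - 1) (e₁ := -m + 1) (by omega) (by ring)
        rfl).exists_linearEquiv
      exact ⟨F, fun z w hzw => hF z w (Subtype.ext hzw)⟩
    choose F hF using hΦ
    obtain ⟨e, he⟩ := exists_tangentSpace_equiv (twistedD_twistedD h)
    exact ⟨fun i m him => (F i m him).toModuleIso, hF,
      e.trans (F 1 (d - 2) (by ring)).toEquiv, fun z y hy => congrArg (F 1 (d - 2) _) (he z y hy)⟩
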